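/- Write $\Delta_K$ for the discriminant of a number field $K$. Let $X_1(15)$ be given by the model $y^2+xy+y=x^3+x^2$ over $\mathbb{Q}$, whose point at infinity is a cusp and taken as the origin of the group law. On it put $$r=1+\frac{x(x+1)(y+1)}{y(y-x^2)},\qquad s=\frac{-1}{x+y},\qquad c=s(r-1),\qquad b=rc .$$ A point $(x,y)$ corresponds to the pair consisting of the curve $Y^2+(1-c)XY-bY=X^3-bX^2$ and its point $(0,0)$ of order 15; it is noncuspidal when $b,c$ are defined at it (that is, $y(y-x^2)(x+y)\neq 0$) and this curve is nonsingular, and a cusp otherwise. **Theorem 5.** (i) The quadratic field $K$ with smallest $|\Delta_K|$ such that $E(K)_{tors}\cong\mathbb{Z}/15\mathbb{Z}$ for some elliptic curve $E$ over $K$ is $K=\mathbb{Q}(\sqrt5)$: such an $E$ exists over $\mathbb{Q}(\sqrt 5)$, and every quadratic field $K\not\cong\mathbb{Q}(\sqrt5)$ over which such an $E$ exists satisfies $|\Delta_K|>|\Delta_{\mathbb{Q}(\sqrt5)}|$. (ii) $X_1(15)(\mathbb{Q})_{tors}\cong\mathbb{Z}/4\mathbb{Z}$, and all its points are cusps. (iii)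 For a quadratic field $K$ one has $X_1(15)(K)_{tors}\neq X_1(15)(\mathbb{Q})_{tors}$ if and only if $K$ is $\mathbb{Q}(\sqrt{-3})$, $\mathbb{Q}(\sqrt5)$ or $\mathbb{Q}(\sqrt{-15})$. (iv) For a quadratic field $K$ the group $X_1(15)(K)_{tors}$ contains a noncuspidal point if and only if $K$ is $\mathbb{Q}(\sqrt5)$ or $\mathbb{Q}(\sqrt{-15})$; over these two fields every torsion point of $X_1(15)(K)$ that is not defined over $\mathbb{Q}$ is noncuspidal. (v) For each square root $\sqrt5$ of $5$ in $\mathbb{Q}(\sqrt5)$, the elliptic curve $$y^2=x^3+(281880\sqrt5-630315)x+328392630-146861640\sqrt5$$ over $\mathbb{Q}(\sqrt5)$ has torsion group $\mathbb{Z}/15\mathbb{Z}$ over $\mathbb{Q}(\sqrt5)$, and $(264\sqrt5-585,\ 5076\sqrt5-11340)$ is a point of order $15$ on it. -/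

import Mathlib

/-- The field `ℚ(√d)`, as the subfield of `ℂ` generated by the square roots of `d`. -/
noncomputable def QSqrt (d : ℤ) : IntermediateField ℚ ℂ :=
  IntermediateField.adjoin ℚ {z : ℂ | z ^ 2 = (d : ℂ)}

instance QSqrt.numberField (d : ℤ) : NumberField (QSqrt d) where
  to_charZero := inferInstance
  to_finiteDimensional := by
    have hfin : {z : ℂ | z ^ 2 = (d : ℂ)}.Finite := by
      obtain ⟨w, hw⟩ := IsAlgClosed.exists_pow_nat_eq (d : ℂ) (n := 2) (by norm_num)
      refine (Set.toFinite {w, -w}).subset fun z hz => ?_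
      have hz' : z ^ 2 = w ^ 2 := by rw [hw]; exact hz
      rcases sq_eq_sq_iff_eq_or_eq_neg.mp hz' with h | h <;> simp [h]
    have := hfin.to_subtype
    refine IntermediateField.finiteDimensional_adjoin fun z hz => ?_
    refine IsIntegral.of_pow (n := 2) (by norm_num) ?_
    have hz' : z ^ 2 = (d : ℂ) := hz
    rw [hz']
    have h := isIntegral_algebraMap (R := ℚ) (A := ℂ) (x := (d : ℚ))
    simpa using h

/-- A number field `K` is a quadratic field if `[K : ℚ] = 2`. -/
def IsQuadraticField (K : Type*) [Field K] [NumberField K] : Prop :=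
  Module.finrank ℚ K = 2

/-- `K` is (isomorphic to) the field `ℚ(√d)`. -/
def IsQSqrt (K : Type*) [Field K] (d : ℤ) : Prop :=
  Nonempty (K ≃+* QSqrt d)

namespace WeierstrassCurve

open Classical in
/-- The torsion subgroup of the group `W(K)` of `K`-points is isomorphic to `G`. -/
def TorsionIso {K : Type*} [Field K] (W : WeierstrassCurve K) (G : Type*) [AddGroup G] : Prop :=
  Nonempty (AddCommGroup.torsion W.toAffine.Point ≃+ G)

open Classical in
/-- `P` is a torsion point of `W(K)`. -/
def IsTorsionPoint {K : Type*} [Field K] {W : WeierstrassCurve K} (P : W.toAffine.Point) : Prop :=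
  IsOfFinAddOrder P

open Classical in
/-- `(x, y)` is a point of `W(K)` of order exactly `n` (for `n ≥ 1`). -/
def IsPointOfOrder {K : Type*} [Field K] (W : WeierstrassCurve K) (x y : K) (n : ℕ) : Prop :=
  ∃ h : W.toAffine.Nonsingular x y, addOrderOf (Affine.Point.some x y h) = n

open Classical in
/-- For a Weierstrass curve `W` over `ℚ`, the point `P` of `W(K)` comes from `W(ℚ)`. -/
def IsRationalPoint {W : WeierstrassCurve ℚ} {K : Type*} [Field K] [CharZero K]
    (P : (W.baseChange K).toAffine.Point) : Prop :=
  ∃ Q : (W.baseChange ℚ).toAffine.Point, Affine.Point.baseChange ℚ K Q = P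

/-- The Weierstrass curve `W` over `ℚ` gains torsion over `K`: the inclusion of `W(ℚ)_tors` in
`W(K)_tors` is strict. -/
def GainsTorsion (W : WeierstrassCurve ℚ) (K : Type*) [Field K] [CharZero K] : Prop :=
  ∃ P : (W.baseChange K).toAffine.Point, IsTorsionPoint P ∧ ¬ IsRationalPoint P

end WeierstrassCurve

/-- `ℤ/nℤ` appears as a torsion group over `K`: some elliptic curve `E` over `K` has torsion
subgroup `E(K)_tors` isomorphic to `ℤ/nℤ`. -/
def TorsionAppears (K : Type*) [Field K] (n : ℕ) : Prop :=
  ∃ E : WeierstrassCurve K, E.IsElliptic ∧ E.TorsionIso (ZMod n)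

/-- The Tate normal form `y² + (1 - c)xy - by = x³ - bx²`, with the marked point `(0, 0)`. -/
def tateCurve {K : Type*} [Field K] (b c : K) : WeierstrassCurve K where
  a₁ := 1 - c
  a₂ := -b
  a₃ := -b
  a₄ := 0
  a₆ := 0

/-- The modular curve `X₁(15)`, in the model `y² + xy + y = x³ + x²` over `ℚ`. -/
def X1_15 : WeierstrassCurve ℚ where
  a₁ := 1
  a₂ := 1
  a₃ := 1
  a₄ := 0
  a₆ := 0

namespace X1_15

variable {K : Type*} [Field K]

/-- The first modular parameter on `X₁(15)`. -/
def r (x y : K) : K := 1 + x * (x + 1) * (y + 1) / (y * (y - x ^ 2))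

/-- The second modular parameter on `X₁(15)`. -/
def s (x y : K) : K := -1 / (x + y)

/-- The Tate parameter `c = s(r - 1)` of the elliptic curve that corresponds to `(x, y)`. -/
def c (x y : K) : K := s x y * (r x y - 1)

/-- The Tate parameter `b = rc` of the elliptic curve that corresponds to `(x, y)`. -/
def b (x y : K) : K := r x y * c x y

/-- The noncuspidal points of `X₁(15)` are those that correspond to an elliptic curve with a point
of order `15`. In the model `y² + xy + y = x³ + x²` the pair that corresponds to `(x, y)` is the
Tate normal form with the parameters `b = b(x, y)` and `c = c(x, y)`, together with its point
`(0, 0)`. So `(x, y)` is noncuspidal if these parameters are defined at it and give a nonsingular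
cubic; the remaining points, among them the point at infinity, are the cusps. -/
def IsNoncuspidal [CharZero K] : (X1_15.baseChange K).toAffine.Point → Prop
  | .zero => False
  | .some x y _ => y ≠ 0 ∧ y ≠ x ^ 2 ∧ x + y ≠ 0 ∧ (tateCurve (b x y) (c x y)).IsElliptic

end X1_15

/-- The curve `y² = x³ + (281880√5 - 630315)x + 328392630 - 146861640√5`, for a square root
`s = √5` of `5`. -/
def curve15 {K : Type*} [Field K] (s : K) : WeierstrassCurve K where
  a₁ := 0
  a₂ := 0
  a₃ := 0
  a₄ := 281880 * s - 630315
  a₆ := 328392630 - 146861640 * s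

/-! The curve `X1_15` is an elliptic curve with good reduction at 2. A quadratic field has a place
over 2 whose residue field embeds in `F_4`, and there the reduced curve is killed by 8. In the
kernel of reduction doubling strictly increases `v x`. Hence all torsion over a quadratic field is
of 2-power order, and a point divisible by every power of 2 vanishes.

Torsion is then found by halving the four rational points `O`, `(-1, 0)`, `(0, 0)`, `(0, -1)`. The
new halves have `4x² + x + 1 = 0`, `x = -2`, `x² - x - 1 = 0` or `x² + x + 1 = 0`, which requires a
square root of `-15`, `-15`, `5` or `-3`. The cusps are read off from the discriminant of the Tate
curve: the four rational points and the points with `x² + x + 1 = 0` are cusps. At any other point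
over a quadratic field, a vanishing discriminant would give a root of a quartic congruent to `x⁴ +
x³ + 1` modulo 2, which has no root in `F_4`.

For minimality of `ℚ(√5)`, the only other quadratic fields with `|Δ| ≤ 5` are `ℚ(i)` and `ℚ(√-3)`. A
descent by 2-isogeny on `X1_15` and its twists by `-1` and `-3` shows that, up to sign and rational
4-torsion, every point in question is a double. So four times such a point is infinitely
2-divisible, hence zero. Since `2P = (P + σP) + (P - σP)`, all points over these two fields are
torsion, hence cusps. A point of order 15 on an elliptic curve would give, through its Tate normal
form, a point of `X1_15` that is none of them.

For the explicit curve, multiples of the given point are computed up to `8P = -7P`. Torsion injects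
under reduction at a prime of `ℚ(√5)` over 11, and the reduced curve has no points besides the
images of the 15 multiples. The carrying lemmas are `exists_two_pow_nsmul_eq_zero`, `isNoncuspidal`,
`exists_halvable`, `isTorsionPoint`, `exists_equation_of_parameters` and
`shortWeierstrass.eq_of_sub_lt_one`. -/

/-! ### Places over 2 of a quadratic field. -/

namespace Valuation

variable {K Γ : Type*} [Field K] [LinearOrderedCommGroupWithZero Γ] (v : Valuation K Γ)

theorem map_intCast_le_one (n : ℤ) : v n ≤ 1 := by
  induction n using Int.induction_on with
  | zero => simp
  | succ n ih => push_cast; exact v.map_add_le (by exact_mod_cast ih) (by simp)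
  | pred n ih => push_cast at ih ⊢; exact (v.map_sub _ _).trans (max_le ih (by simp))

/-- An element satisfying a primitive quadratic equation over `ℤ` satisfies, at a valuation over
`2`, one of the equations `x = 0`, `x = 1` and `x ^ 2 + x + 1 = 0` in the residue field. -/
theorem lt_one_or_of_quadratic (h2 : v 2 < 1) {x : K} (hx : v x ≤ 1) {a b c : ℤ}
    (hodd : Odd a ∨ Odd b ∨ Odd c) (h : a * x ^ 2 + b * x + c = 0) :
    v x < 1 ∨ v (x + 1) < 1 ∨ v (x ^ 2 + x + 1) < 1 := by
  have hd : ∀ (n : ℤ) (z : K), v z ≤ 1 → v (2 * n * z) < 1 := by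
    intro n z hz
    rw [mul_assoc, map_mul, map_mul]
    exact mul_lt_one_of_nonneg_of_lt_one_left zero_le h2
      (mul_le_one' (v.map_intCast_le_one n) hz)
  have hxx : v (x ^ 2) ≤ 1 := by rw [map_pow]; exact pow_le_one₀ zero_le hx
  have hsq : ∀ z : K, v (z * z) < 1 → v z < 1 := by
    intro z hz
    by_contra! hle
    rw [map_mul] at hz
    exact absurd (one_le_mul_of_one_le_of_one_le hle hle) (not_le.mpr hz)
  have hneg : ∀ z : K, v (-z) < 1 → v z < 1 := fun z hz ↦ by rwa [v.map_neg] at hz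
  obtain ⟨a', ha⟩ := Int.even_or_odd' a
  obtain ⟨b', hb⟩ := Int.even_or_odd' b
  obtain ⟨c', hc⟩ := Int.even_or_odd' c
  have hr : v (2 * a' * x ^ 2 + 2 * b' * x + 2 * c' * 1) < 1 :=
    v.map_add_lt (v.map_add_lt (hd a' _ hxx) (hd b' _ hx)) (hd c' 1 (by simp))
  rcases ha with rfl | rfl <;> rcases hb with rfl | rfl <;> rcases hc with rfl | rfl <;>
    push_cast at h
  · exfalso
    simp [← Int.not_even_iff_odd] at hodd
  · exfalso
    have := hneg 1 (by convert hr using 2; linear_combination -h)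
    simp at this
  · exact Or.inl (hneg x (by convert hr using 2; linear_combination -h))
  · exact Or.inr (Or.inl (hneg _ (by convert hr using 2; linear_combination -h)))
  · exact Or.inl (hsq x (hneg _ (by convert hr using 2; linear_combination -h)))
  · refine Or.inr (Or.inl (hsq _ (hneg _ ?_)))
    have := v.map_add_lt hr (hd (-1) x hx)
    convert this using 2; push_cast; linear_combination -h
  · have : v (x * (x + 1)) < 1 := hneg _ (by convert hr using 2; linear_combination -h)
    by_contra! hle
    rw [map_mul] at this
    exact absurd (one_le_mul_of_one_le_of_one_le hle.1 hle.2.1) (not_le.mpr this)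
  · exact Or.inr (Or.inr (hneg _ (by convert hr using 2; linear_combination -h)))

end Valuation

/-- Descent on the size of the coefficients: while all three are even, halve them. -/
theorem exists_odd_quadratic {K : Type*} [Field K] [CharZero K] {x : K} (n : ℕ) :
    ∀ a b c : ℤ, a.natAbs + b.natAbs + c.natAbs ≤ n → (a ≠ 0 ∨ b ≠ 0 ∨ c ≠ 0) →
      a * x ^ 2 + b * x + c = 0 →
      ∃ a b c : ℤ, (Odd a ∨ Odd b ∨ Odd c) ∧ a * x ^ 2 + b * x + c = 0 := by
  induction n with
  | zero => intro a b c hn h0; omega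
  | succ n ih =>
    intro a b c hn h0 h
    by_cases hodd : Odd a ∨ Odd b ∨ Odd c
    · exact ⟨a, b, c, hodd, h⟩
    · push Not at hodd
      simp only [Int.not_odd_iff_even] at hodd
      obtain ⟨⟨a, rfl⟩, ⟨b, rfl⟩, ⟨c, rfl⟩⟩ := hodd
      refine ih a b c (by omega) (by omega) ?_
      push_cast at h
      linear_combination h / 2

namespace NumberField

open Module

variable {K : Type*} [Field K] [NumberField K]

theorem exists_quadratic (hK : finrank ℚ K ≤ 2) (x : K) :
    ∃ a b c : ℤ, (Odd a ∨ Odd b ∨ Odd c) ∧ a * x ^ 2 + b * x + c = 0 := by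
  have hdep : ¬ LinearIndependent ℚ ![1, x, x ^ 2] := by
    intro h
    have := h.fintype_card_le_finrank
    simp at this
    omega
  rw [← LinearIndependent.iff_fractionRing (R := ℤ), Fintype.linearIndependent_iff] at hdep
  push Not at hdep
  obtain ⟨g, hg, i, hi⟩ := hdep
  simp only [Fin.sum_univ_three, Matrix.cons_val_zero, Matrix.cons_val_one, Matrix.cons_val,
    zsmul_eq_mul] at hg
  refine exists_odd_quadratic _ (g 2) (g 1) (g 0) le_rfl ?_ (by linear_combination hg)
  fin_cases i
  · exact Or.inr (Or.inr hi)
  · exact Or.inr (Or.inl hi)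
  · exact Or.inl hi

variable (K) in
theorem exists_valuation_two_lt_one :
    ∃ v : Valuation K (WithZero (Multiplicative ℤ)), v 2 < 1 := by
  -- If 2 were a unit, then `1/2` would be an algebraic integer.
  have hne : (Ideal.span {(2 : 𝓞 K)}) ≠ ⊤ := by
    intro h
    rw [Ideal.span_singleton_eq_top] at h
    obtain ⟨u, hu⟩ := h.exists_right_inv
    have hu' : (2 : K) * u = 1 := by
      have := congrArg (algebraMap (𝓞 K) K) hu
      rwa [map_mul, map_ofNat, map_one] at this
    have hint : IsIntegral ℤ (algebraMap ℚ K 2⁻¹) := by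
      have : algebraMap ℚ K 2⁻¹ = (u : K) := by
        rw [map_inv₀, map_ofNat]
        exact (eq_inv_of_mul_eq_one_right hu').symm
      rw [this]
      exact u.isIntegral_coe
    rw [isIntegral_algebraMap_iff (algebraMap ℚ K).injective,
      IsIntegrallyClosed.isIntegral_iff] at hint
    obtain ⟨n, hn⟩ := hint
    have : (2 * n : ℚ) = 1 := by
      rw [eq_intCast] at hn
      rw [hn]; norm_num
    have : 2 * n = 1 := by exact_mod_cast this
    omega
  obtain ⟨p, hp, hle⟩ := Ideal.exists_le_maximal _ hne
  have hmem : (2 : 𝓞 K) ∈ p := hle (Ideal.mem_span_singleton_self 2)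
  let w : IsDedekindDomain.HeightOneSpectrum (𝓞 K) :=
    ⟨p, hp.isPrime, fun h ↦ by rw [h] at hmem; simp at hmem⟩
  refine ⟨w.valuation K, ?_⟩
  have := (w.valuation_lt_one_iff_mem (K := K) 2).mpr hmem
  exact_mod_cast this

/-- The three alternatives say that residues lie in `F_4`. This is all that is needed of the residue
field. -/
theorem exists_valuation (hK : finrank ℚ K ≤ 2) :
    ∃ v : Valuation K (WithZero (Multiplicative ℤ)), v 2 < 1 ∧
      ∀ x : K, v x ≤ 1 → v x < 1 ∨ v (x + 1) < 1 ∨ v (x ^ 2 + x + 1) < 1 := by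
  obtain ⟨v, hv⟩ := exists_valuation_two_lt_one K
  refine ⟨v, hv, fun x hx ↦ ?_⟩
  obtain ⟨a, b, c, hodd, h⟩ := exists_quadratic hK x
  exact v.lt_one_or_of_quadratic hv hx hodd h

end NumberField

/-! ### Quadratic fields and their square roots. -/

namespace IsQuadraticField

open Module Polynomial

variable {K : Type*} [Field K] [NumberField K]

theorem sqrt_notMem_range {d : ℤ} (hd : ¬ IsSquare (d : ℚ)) {α : K} (hα : α ^ 2 = d) (q : ℚ) :
    α ≠ q := by
  rintro rfl
  refine hd ⟨q, ?_⟩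
  have : q ^ 2 = d := by exact_mod_cast hα
  rw [← this, sq]

theorem exists_eq_add_mul (hK : IsQuadraticField K) {d : ℤ} (hd : ¬ IsSquare (d : ℚ)) {α : K}
    (hα : α ^ 2 = d) (x : K) : ∃ p q : ℚ, x = p + q * α := by
  have hli : LinearIndependent ℚ ![1, α] := by
    rw [LinearIndependent.pair_iff]
    intro s t h
    rw [Algebra.smul_def, Algebra.smul_def, eq_ratCast, eq_ratCast, mul_one] at h
    by_cases ht : t = 0
    · subst ht
      refine ⟨?_, rfl⟩
      simpa using h
    · exfalso
      refine sqrt_notMem_range hd hα (-s / t) ?_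
      push_cast
      have : (t : K) ≠ 0 := by exact_mod_cast ht
      field_simp
      linear_combination h
  let b := basisOfLinearIndependentOfCardEqFinrank hli (by rw [hK]; rfl)
  refine ⟨b.repr x 0, b.repr x 1, ?_⟩
  conv_lhs => rw [← b.sum_repr x]
  simp [b, Algebra.smul_def]

theorem eq_zero_of_add_mul_eq_zero {d : ℤ} (hd : ¬ IsSquare (d : ℚ)) {α : K}
    (hα : α ^ 2 = d) {p q : ℚ} (h : (p : K) + q * α = 0) : p = 0 ∧ q = 0 := by
  by_cases hq : q = 0
  · subst hq
    exact ⟨by simpa using h, rfl⟩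
  · exfalso
    refine sqrt_notMem_range hd hα (-p / q) ?_
    push_cast
    have : (q : K) ≠ 0 := by exact_mod_cast hq
    field_simp
    linear_combination h

/-- This one extension property supplies the isomorphism with `QSqrt d`, the conjugation of `K` and
the embedding of `ℚ(√5)` into `ℚ_[11]`. -/
theorem exists_algHom (hK : IsQuadraticField K) {d : ℤ} (hd : ¬ IsSquare (d : ℚ)) {α : K}
    (hα : α ^ 2 = d) {L : Type*} [Field L] [Algebra ℚ L] {β : L} (hβ : β ^ 2 = d) :
    ∃ φ : K →ₐ[ℚ] L, φ α = β := by
  have hint : IsIntegral ℚ α := Algebra.IsIntegral.isIntegral α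
  have hirr : Irreducible (X ^ 2 - C (d : ℚ)) :=
    X_pow_sub_C_irreducible_of_prime Nat.prime_two fun b hb ↦ hd ⟨b, by rw [← hb, sq]⟩
  have hmin : minpoly ℚ α = X ^ 2 - C (d : ℚ) := by
    refine (minpoly.eq_of_irreducible_of_monic hirr ?_ (monic_X_pow_sub_C _ two_ne_zero)).symm
    simp [hα]
  have htop : IntermediateField.adjoin ℚ {α} = ⊤ := by
    rw [eq_top_iff]
    intro x _
    obtain ⟨p, q, rfl⟩ := hK.exists_eq_add_mul hd hα x
    have hmem := IntermediateField.mem_adjoin_simple_self ℚ α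
    exact add_mem (algebraMap_mem _ p) (mul_mem (algebraMap_mem _ q) hmem)
  refine IntermediateField.exists_algHom_of_adjoin_splits_of_aeval (S := {α}) ?_ htop ?_
  · rintro _ rfl
    refine ⟨hint, ?_⟩
    rw [hmin]
    have : (X ^ 2 - C (d : ℚ)).map (algebraMap ℚ L) = (X - C β) * (X + C β) := by
      rw [Polynomial.map_sub, Polynomial.map_pow, map_X, map_C, map_intCast, ← hβ, C_pow]
      ring
    rw [this]
    exact (Splits.X_sub_C β).mul (Splits.X_add_C β)
  · rw [hmin]
    simp [hβ]

end IsQuadraticField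

theorem QSqrt.exists_sq_eq (d : ℤ) : ∃ α : QSqrt d, α ^ 2 = d := by
  obtain ⟨w, hw⟩ := IsAlgClosed.exists_pow_nat_eq (d : ℂ) (n := 2) (by norm_num)
  exact ⟨⟨w, IntermediateField.subset_adjoin _ _ hw⟩, Subtype.ext (by simpa using hw)⟩

theorem QSqrt.isQuadraticField {d : ℤ} (hd : ¬ IsSquare (d : ℚ)) : IsQuadraticField (QSqrt d) := by
  open Polynomial in
  obtain ⟨w, hw⟩ := IsAlgClosed.exists_pow_nat_eq (d : ℂ) (n := 2) (by norm_num)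
  have hset : QSqrt d = IntermediateField.adjoin ℚ {w} := by
    apply le_antisymm
    · refine IntermediateField.adjoin_le_iff.mpr fun z hz ↦ ?_
      have hmem := IntermediateField.mem_adjoin_simple_self ℚ w
      have hz' : z ^ 2 = w ^ 2 := by rw [hw]; exact hz
      rcases sq_eq_sq_iff_eq_or_eq_neg.mp hz' with rfl | rfl
      · exact hmem
      · exact neg_mem hmem
    · exact IntermediateField.adjoin.mono _ _ _ (by simpa using hw)
  have hirr : Irreducible (X ^ 2 - C (d : ℚ)) :=
    X_pow_sub_C_irreducible_of_prime Nat.prime_two fun b hb ↦ hd ⟨b, by rw [← hb, sq]⟩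
  have hmin : minpoly ℚ w = X ^ 2 - C (d : ℚ) := by
    refine (minpoly.eq_of_irreducible_of_monic hirr ?_ (monic_X_pow_sub_C _ two_ne_zero)).symm
    simp [hw]
  have hint : IsIntegral ℚ w :=
    ⟨X ^ 2 - C (d : ℚ), monic_X_pow_sub_C _ two_ne_zero, by rw [← aeval_def]; simp [hw]⟩
  have h := IntermediateField.adjoin.finrank hint
  rw [← hset, hmin, natDegree_X_pow_sub_C] at h
  rw [IsQuadraticField]
  convert h

theorem isQSqrt_iff {K : Type*} [Field K] [NumberField K] (hK : IsQuadraticField K) {d : ℤ}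
    (hd : ¬ IsSquare (d : ℚ)) : IsQSqrt K d ↔ ∃ α : K, α ^ 2 = d := by
  obtain ⟨β, hβ⟩ := QSqrt.exists_sq_eq d
  constructor
  · rintro ⟨e⟩
    exact ⟨e.symm β, by rw [← map_pow, hβ, map_intCast]⟩
  · rintro ⟨α, hα⟩
    obtain ⟨φ, hφ⟩ := hK.exists_algHom hd hα hβ
    refine ⟨RingEquiv.ofBijective φ ⟨φ.injective, fun x ↦ ?_⟩⟩
    obtain ⟨p, q, rfl⟩ := (QSqrt.isQuadraticField hd).exists_eq_add_mul hd hβ x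
    exact ⟨p + q * α, by simp [hφ]⟩

/-! ### Quadratic fields of small discriminant. -/

namespace IsQuadraticField

open Module NumberField

variable {K : Type*} [Field K] [NumberField K]

/-- The discriminant of a quadratic field with integral basis `x, y` is `(xy' - x'y) ^ 2`. -/
theorem exists_integral_basis (hK : IsQuadraticField K) :
    ∃ (σ : K ≃ₐ[ℚ] K) (x y : 𝓞 K), (∀ z, σ (σ z) = z) ∧
      (∀ z : 𝓞 K, ∃ m n : ℤ, (z : K) = m * x + n * y) ∧
      (discr K : K) = (x * σ y - y * σ x) ^ 2 ∧
      ∃ t n : ℤ, discr K = t ^ 2 - 4 * n := by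
  classical
  have : Algebra.IsQuadraticExtension ℚ K := ⟨hK⟩
  have hcard : Nat.card Gal(K/ℚ) = 2 := by rw [IsGalois.card_aut_eq_finrank, hK]
  obtain ⟨σ, hσ⟩ : ∃ σ : Gal(K/ℚ), σ ≠ 1 := by
    have : Nontrivial Gal(K/ℚ) := Finite.one_lt_card_iff_nontrivial.mp (by omega)
    exact exists_ne 1
  have huniv : (Finset.univ : Finset Gal(K/ℚ)) = {1, σ} := by
    symm
    apply Finset.eq_univ_of_card
    rw [Finset.card_pair hσ.symm, Fintype.card_eq_nat_card, hcard]
  have hσσ : σ * σ = 1 := by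
    have : σ * σ ∈ (Finset.univ : Finset Gal(K/ℚ)) := Finset.mem_univ _
    rw [huniv, Finset.mem_insert, Finset.mem_singleton] at this
    exact this.resolve_right fun h ↦ hσ (mul_eq_left.mp h)
  have htrZ : ∀ z : 𝓞 K, (Algebra.trace ℤ (𝓞 K) z : K) = z + σ z := by
    intro z
    have h1 := trace_eq_sum_automorphisms (K := ℚ) (z : K)
    rw [huniv, Finset.sum_pair hσ.symm, ← Algebra.coe_trace_int] at h1
    simpa using h1
  have hnZ : ∀ z : 𝓞 K, (Algebra.norm ℤ z : K) = z * σ z := by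
    intro z
    have h1 := Algebra.norm_eq_prod_automorphisms ℚ (z : K)
    rw [huniv, Finset.prod_pair hσ.symm, ← Algebra.coe_norm_int] at h1
    simpa using h1
  have hrank : finrank ℤ (𝓞 K) = 2 := by rw [RingOfIntegers.rank, hK]
  let b : Basis (Fin 2) ℤ (𝓞 K) := (finBasis ℤ (𝓞 K)).reindex (finCongr hrank)
  have hd : discr K = Algebra.trace ℤ (𝓞 K) (b 0 * b 0) * Algebra.trace ℤ (𝓞 K) (b 1 * b 1) -
      Algebra.trace ℤ (𝓞 K) (b 0 * b 1) ^ 2 := by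
    rw [← discr_eq_discr K b, Algebra.discr_def, Matrix.det_fin_two]
    simp only [Algebra.traceMatrix_apply, Algebra.traceForm_apply]
    rw [mul_comm (b 1) (b 0), sq]
  refine ⟨σ, b 0, b 1, fun z ↦ DFunLike.congr_fun hσσ z,
    fun z ↦ ⟨b.repr z 0, b.repr z 1, ?_⟩, ?_, ?_⟩
  · conv_lhs => rw [← b.sum_repr z]
    simp
  · rw [hd]
    push_cast
    rw [htrZ, htrZ, htrZ]
    simp only [map_mul]
    ring
  -- Stickelberger: `(xσy - yσx)² = (xσy + yσx)² - 4 · xσx · yσy`, where `xσy + yσx = Tr x · Tr y -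
  -- Tr xy`.
  · refine ⟨Algebra.trace ℤ (𝓞 K) (b 0) * Algebra.trace ℤ (𝓞 K) (b 1) -
      Algebra.trace ℤ (𝓞 K) (b 0 * b 1), Algebra.norm ℤ (b 0 * b 1), ?_⟩
    have : (discr K : K) = ((Algebra.trace ℤ (𝓞 K) (b 0) * Algebra.trace ℤ (𝓞 K) (b 1) -
      Algebra.trace ℤ (𝓞 K) (b 0 * b 1)) ^ 2 - 4 * Algebra.norm ℤ (b 0 * b 1) : ℤ) := by
      rw [hd]
      push_cast
      rw [htrZ, htrZ, htrZ, htrZ, htrZ, hnZ]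
      simp only [map_mul]
      ring
    exact_mod_cast this

/-- By Minkowski `|D| > 2`, and `D` is 0 or 1 modulo 4, so `D` is `-4`, `-3`, `4` or `5`. The value
4 is impossible: `xσy - yσx` is negated by `σ`, whereas `±2` is fixed. -/
theorem exists_sq_eq_of_abs_discr_le (hK : IsQuadraticField K) (h : |discr K| ≤ 5) :
    ∃ d : ℤ, (d = 5 ∨ d = -1 ∨ d = -3) ∧ ∃ α : K, α ^ 2 = d := by
  obtain ⟨σ, x, y, hσ, -, hD, t, n, htn⟩ := hK.exists_integral_basis
  have h2 : 2 < |discr K| := abs_discr_gt_two (by rw [hK]; norm_num)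
  generalize discr K = D at *
  have hmod : D % 4 = 0 ∨ D % 4 = 1 := by
    obtain ⟨k, hk⟩ := Int.even_or_odd' t
    rcases hk with rfl | rfl
    · left; rw [htn]; ring_nf; omega
    · right; rw [htn]; ring_nf; omega
  have hcases : D = -4 ∨ D = -3 ∨ D = 4 ∨ D = 5 := by
    rw [abs_le] at h
    rw [lt_abs] at h2
    omega
  rcases hcases with rfl | rfl | rfl | rfl
  · refine ⟨-1, by simp, (x * σ y - y * σ x) / 2, ?_⟩
    push_cast at hD ⊢
    linear_combination -hD / 4
  · exact ⟨-3, by simp, _, hD.symm⟩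
  · exfalso
    have h4 : (x * σ y - y * σ x - 2) * (x * σ y - y * σ x + 2) = 0 := by
      push_cast at hD
      linear_combination -hD
    have hneg : σ (x * σ y - y * σ x) = -(x * σ y - y * σ x) := by
      simp only [map_sub, map_mul, hσ]; ring
    rcases mul_eq_zero.mp h4 with h5 | h5
    · have h6 : (x * σ y - y * σ x : K) = 2 := by linear_combination h5
      rw [h6, map_ofNat] at hneg
      norm_num [eq_neg_iff_add_eq_zero] at hneg
    · have h6 : (x * σ y - y * σ x : K) = -2 := by linear_combination h5
      rw [h6, map_neg, map_ofNat] at hneg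
      norm_num [eq_neg_iff_add_eq_zero] at hneg
  · exact ⟨5, by simp, _, hD.symm⟩

theorem not_isSquare_five : ¬ IsSquare ((5 : ℤ) : ℚ) := by norm_num

/-- The integers `1` and `(1 + √5)/2` have determinant `-√5` with their conjugates, so 5 is a square
times the discriminant. -/
theorem abs_discr_QSqrt_five : |discr (QSqrt 5)| ≤ 5 := by
  obtain ⟨s, hs⟩ := QSqrt.exists_sq_eq 5
  have hK := QSqrt.isQuadraticField not_isSquare_five
  obtain ⟨σ, x, y, hσ, hspan, hD, -⟩ := hK.exists_integral_basis
  have hint : IsIntegral ℤ ((1 + s) / 2) := by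
    refine ⟨Polynomial.X ^ 2 - Polynomial.X - 1, ?_, ?_⟩
    · monicity!
    · simp only [Polynomial.eval₂_sub, Polynomial.eval₂_pow, Polynomial.eval₂_X,
        Polynomial.eval₂_one]
      push_cast at hs
      linear_combination hs / 4
  obtain ⟨m, n, h1⟩ := hspan 1
  obtain ⟨m', n', h2⟩ := hspan ⟨_, hint⟩
  change (1 : QSqrt 5) = _ at h1
  change (1 + s) / 2 = _ at h2
  have h1' := congrArg σ h1
  have h2' := congrArg σ h2
  simp only [map_add, map_mul, map_intCast, map_one, map_div₀, map_ofNat] at h1' h2'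
  have hσs : (σ s - s) * (σ s + s) = 0 := by
    have : σ s ^ 2 = 5 := by rw [← map_pow, hs, map_intCast]; norm_num
    push_cast at hs
    linear_combination this - hs
  have hne : σ s ≠ s := by
    intro h0
    have hfix : ∀ z, σ z = z := by
      intro z
      obtain ⟨p, q, rfl⟩ := hK.exists_eq_add_mul not_isSquare_five hs z
      simp [h0]
    rw [hfix, hfix] at hD
    refine discr_ne_zero (QSqrt 5) ?_
    have : ((discr (QSqrt 5) : ℤ) : QSqrt 5) = 0 := by rw [hD]; ring
    exact_mod_cast this
  have hσs' : σ s = -s :=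
    eq_neg_of_add_eq_zero_left ((mul_eq_zero.mp hσs).resolve_left (sub_ne_zero.mpr hne))
  have key : (5 : QSqrt 5) = ((m * n' - n * m') ^ 2 * discr (QSqrt 5) : ℤ) := by
    push_cast
    rw [hD]
    push_cast at hs
    have h3 : (m * n' - n * m') * ((x : QSqrt 5) * σ y - y * σ x) = -s := by
      rw [hσs'] at h2'
      linear_combination (m' * σ x + n' * σ y) * (-h1) + h2' * (-1) + (m * σ x + n * σ y) * h2 +
        (1 + s) / 2 * h1'
    rw [← mul_pow, h3, neg_sq, hs]
  have key' : 5 = (m * n' - n * m') ^ 2 * discr (QSqrt 5) := by exact_mod_cast key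
  have hdvd : discr (QSqrt 5) ∣ 5 := ⟨_, by rw [mul_comm]; exact key'⟩
  have := Int.le_of_dvd (by norm_num) ((abs_dvd _ _).mpr hdvd)
  exact this

end IsQuadraticField

/-! ### Duplication formulas, in general and on `X1_15`. -/

namespace WeierstrassCurve.Affine.Point

variable {F : Type*} [Field F] [DecidableEq F] {W : Affine F}

theorem add_self_eq_zero_iff {x y : F} (h : W.Nonsingular x y) :
    some x y h + some x y h = 0 ↔ 2 * y + W.a₁ * x + W.a₃ = 0 := by
  constructor
  · intro e
    by_contra hne
    have hy : y ≠ W.negY x y := by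
      intro h1
      apply hne
      rw [Affine.negY] at h1
      linear_combination h1
    rw [add_self_of_Y_ne hy] at e
    exact some_ne_zero _ e
  · intro e
    apply add_self_of_Y_eq
    rw [Affine.negY]
    linear_combination e

theorem add_self_eq_some {x y x' y' : F} {h : W.Nonsingular x y}
    {h' : W.Nonsingular x' y'} (e : some x y h + some x y h = some x' y' h') :
    2 * y + W.a₁ * x + W.a₃ ≠ 0 ∧
      x' * (2 * y + W.a₁ * x + W.a₃) ^ 2 = x ^ 4 - W.b₄ * x ^ 2 - 2 * W.b₆ * x - W.b₈ ∧
      (2 * y + W.a₁ * x + W.a₃) ^ 2 = 4 * x ^ 3 + W.b₂ * x ^ 2 + 2 * W.b₄ * x + W.b₆ := by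
  have hne : 2 * y + W.a₁ * x + W.a₃ ≠ 0 := by
    intro h0
    rw [(add_self_eq_zero_iff h).mpr h0] at e
    exact some_ne_zero _ e.symm
  have heq := (W.equation_iff x y).mp h.1
  have hy : y ≠ W.negY x y := by
    intro h1
    apply hne
    rw [Affine.negY] at h1
    linear_combination h1
  rw [add_self_of_Y_ne hy, some.injEq] at e
  refine ⟨hne, ?_, ?_⟩
  · rw [← e.1]
    obtain ⟨ℓ, hℓ⟩ : ∃ ℓ, ℓ = W.slope x x y y := ⟨_, rfl⟩
    rw [← hℓ]
    have hs : ℓ * (2 * y + W.a₁ * x + W.a₃) = 3 * x ^ 2 + 2 * W.a₂ * x + W.a₄ - W.a₁ * y := by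
      rw [hℓ, Affine.slope_of_Y_ne rfl hy, Affine.negY, div_mul_eq_mul_div, div_eq_iff]
      · ring
      · intro h0; apply hne; linear_combination h0
    simp only [Affine.addX, b₄, b₆, b₈]
    linear_combination (-8 * x - 4 * W.a₂ - W.a₁ ^ 2) * heq +
      (ℓ * (2 * y + W.a₁ * x + W.a₃) + (3 * x ^ 2 + 2 * W.a₂ * x + W.a₄ - W.a₁ * y) +
        W.a₁ * (2 * y + W.a₁ * x + W.a₃)) * hs
  · simp only [b₂, b₄, b₆]
    linear_combination 4 * heq

end WeierstrassCurve.Affine.Point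
open WeierstrassCurve WeierstrassCurve.Affine
namespace X1_15

variable {K : Type*} [Field K] [CharZero K]

theorem baseChange_eq : X1_15.baseChange K = ⟨1, 1, 1, 0, 0⟩ := by
  ext <;> simp [X1_15, WeierstrassCurve.baseChange, WeierstrassCurve.map]

theorem equation_iff (x y : K) : (X1_15.baseChange K).toAffine.Equation x y ↔
    y ^ 2 + x * y + y = x ^ 3 + x ^ 2 := by
  rw [baseChange_eq, Affine.equation_iff]
  simp

instance : (X1_15.baseChange K).IsElliptic := by
  rw [baseChange_eq, isElliptic_iff, isUnit_iff_ne_zero]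
  norm_num [Δ, b₂, b₄, b₆, b₈]

theorem nonsingular_iff (x y : K) : (X1_15.baseChange K).toAffine.Nonsingular x y ↔
    y ^ 2 + x * y + y = x ^ 3 + x ^ 2 := by
  rw [← Affine.equation_iff_nonsingular, equation_iff]

theorem sq_eq {x y : K} (h : (X1_15.baseChange K).toAffine.Nonsingular x y) :
    (2 * y + x + 1) ^ 2 = (x + 1) * (4 * x ^ 2 + x + 1) := by
  linear_combination 4 * (nonsingular_iff x y).mp h

theorem neg_some {x y : K} (h : (X1_15.baseChange K).toAffine.Nonsingular x y) :
    ∃ h', -Point.some x y h = Point.some x (-y - x - 1) h' := by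
  have h2 : (X1_15.baseChange K).toAffine.negY x y = -y - x - 1 := by
    simp [Affine.negY, baseChange_eq]
  rw [Point.neg_some, ← h2]
  exact ⟨_, rfl⟩

variable [DecidableEq K]

theorem add_self_eq_zero_iff {x y : K} (h : (X1_15.baseChange K).toAffine.Nonsingular x y) :
    Point.some x y h + Point.some x y h = 0 ↔ 2 * y + x + 1 = 0 := by
  rw [Point.add_self_eq_zero_iff, baseChange_eq]
  simp

/-- The third conclusion shows that `x(2P) + 1` is always a square. The 2-torsion point `(-1, 0)` is
responsible for this. -/
theorem add_self_eq_some {x y x' y' : K} {h : (X1_15.baseChange K).toAffine.Nonsingular x y}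
    {h' : (X1_15.baseChange K).toAffine.Nonsingular x' y'}
    (e : Point.some x y h + Point.some x y h = Point.some x' y' h') :
    2 * y + x + 1 ≠ 0 ∧
      x' * (2 * y + x + 1) ^ 2 = (x ^ 2 - x - 1) * (x ^ 2 + x + 1) ∧
      (x' + 1) * (2 * y + x + 1) ^ 2 = (x * (x + 2)) ^ 2 := by
  obtain ⟨h1, h2, -⟩ := Point.add_self_eq_some e
  simp only [baseChange_eq, b₄, b₆, b₈, one_mul] at h1 h2
  refine ⟨h1, ?_, ?_⟩
  · linear_combination h2
  · linear_combination h2 + sq_eq h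

/-- The points that reduce to the point at infinity at the valuation `v`. -/
def ReducesToZero {Γ : Type*} [LinearOrderedCommGroupWithZero Γ] (v : Valuation K Γ)
    (P : (X1_15.baseChange K).toAffine.Point) : Prop :=
  ∀ x y h, P = Point.some x y h → 1 < v x

/-! ### Reduction of `X1_15` at a place over 2. -/

section Valuation

variable {Γ : Type*} [LinearOrderedCommGroupWithZero Γ] {v : Valuation K Γ}

/-- For `v x > 1` the numerator of `x(2P)` has size `v x ^ 4`. The denominator `(x + 1)(4x² + x +
1)` is smaller than `v x ^ 3`, because 4 is small. -/
theorem valuation_lt_of_add_self (h2 : v 2 < 1) {x y x' y' : K}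
    {h : (X1_15.baseChange K).toAffine.Nonsingular x y}
    {h' : (X1_15.baseChange K).toAffine.Nonsingular x' y'}
    (e : Point.some x y h + Point.some x y h = Point.some x' y' h') (hx : 1 < v x) :
    v x < v x' := by
  obtain ⟨h0, hd, -⟩ := add_self_eq_some e
  rw [sq_eq h] at hd
  have hv := congrArg v hd
  rw [map_mul, map_mul, map_mul] at hv
  have hx0 : 0 < v x := lt_trans zero_lt_one hx
  have hxx : v x < v (x ^ 2) := by
    rw [map_pow, sq]; exact lt_mul_of_one_lt_left hx0 hx
  have hx1 : v (x + 1) = v x := v.map_add_eq_of_lt_left (by simpa using hx)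
  have e1 : v (x ^ 2 - x - 1) = v x ^ 2 := by
    rw [show x ^ 2 - x - 1 = x ^ 2 + -(x + 1) by ring, ← map_pow]
    exact v.map_add_eq_of_lt_left (by rwa [v.map_neg, hx1])
  have e2 : v (x ^ 2 + x + 1) = v x ^ 2 := by
    rw [add_assoc, ← map_pow]
    exact v.map_add_eq_of_lt_left (by rwa [hx1])
  have e3 : v (4 * x ^ 2 + x + 1) < v x ^ 2 := by
    rw [add_assoc, ← map_pow]
    refine v.map_add_lt ?_ (by rwa [hx1])
    rw [show (4 : K) = 2 * 2 by norm_num, map_mul, map_mul]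
    refine mul_lt_of_lt_one_left (lt_trans hx0 hxx) ?_
    exact mul_lt_one_of_nonneg_of_lt_one_left zero_le h2 h2.le
  rw [hx1, e1, e2] at hv
  by_contra hle
  rw [not_lt] at hle
  have : v x' * (v x * v (4 * x ^ 2 + x + 1)) < v x ^ 2 * v x ^ 2 := by
    calc v x' * (v x * v (4 * x ^ 2 + x + 1)) ≤ v x * (v x * v (4 * x ^ 2 + x + 1)) := by gcongr
      _ = v x ^ 2 * v (4 * x ^ 2 + x + 1) := by rw [sq (v x), mul_assoc]
      _ < v x ^ 2 * v x ^ 2 := by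
        have : 0 < v x ^ 2 := pow_pos hx0 2
        gcongr
  exact this.ne hv

theorem ReducesToZero.add_self (h2 : v 2 < 1) {P : (X1_15.baseChange K).toAffine.Point}
    (hP : ReducesToZero v P) : ReducesToZero v (P + P) := by
  intro x' y' h' e
  rcases P with _ | ⟨x, y, h⟩
  · exact absurd e.symm (Point.some_ne_zero _)
  · have hx := hP x y h rfl
    exact hx.trans (valuation_lt_of_add_self h2 e hx)

/-- Modulo the place, `x = -1` is the abscissa of the 2-torsion point. -/
theorem reducesToZero_add_self_of_add_one (h2 : v 2 < 1) {x y : K}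
    {h : (X1_15.baseChange K).toAffine.Nonsingular x y} (hx : v (x + 1) < 1) :
    ReducesToZero v (Point.some x y h + Point.some x y h) := by
  intro x' y' h' e
  obtain ⟨h0, hd, -⟩ := add_self_eq_some e
  rw [sq_eq h] at hd
  have hv := congrArg v hd
  rw [map_mul, map_mul, map_mul] at hv
  have e0 : v x = 1 := by
    rw [show x = -1 + (x + 1) by ring]
    rw [v.map_add_eq_of_lt_left (by simpa using hx)]; simp
  have e1 : v (x ^ 2 - x - 1) = 1 := by
    rw [show x ^ 2 - x - 1 = 1 + (x + 1) * (x - 2) by ring]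
    rw [v.map_add_eq_of_lt_left ?_, map_one]
    rw [map_mul, map_one]
    refine mul_lt_one_of_nonneg_of_lt_one_left zero_le hx ?_
    refine (v.map_sub x 2).trans (max_le e0.le h2.le)
  have e2 : v (x ^ 2 + x + 1) = 1 := by
    rw [show x ^ 2 + x + 1 = 1 + (x + 1) * x by ring]
    rw [v.map_add_eq_of_lt_left ?_, map_one]
    rw [map_mul, map_one, e0, mul_one]
    exact hx
  have e4 : v (4 * x ^ 2) ≤ 1 := by
    rw [show 4 * x ^ 2 = 2 * 2 * (x * x) by ring]
    simp only [map_mul, e0, mul_one]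
    exact mul_le_one' h2.le h2.le
  have e3 : v (4 * x ^ 2 + x + 1) ≤ 1 := by
    rw [add_assoc]
    exact v.map_add_le e4 hx.le
  rw [e1, e2, mul_one] at hv
  by_contra hle
  rw [not_lt] at hle
  have : v x' * (v (x + 1) * v (4 * x ^ 2 + x + 1)) < 1 := by
    calc v x' * (v (x + 1) * v (4 * x ^ 2 + x + 1)) ≤ 1 * (v (x + 1) * 1) := by gcongr
      _ < 1 := by simpa using hx
  exact this.ne hv

/-- Points that reduce to `x = 0` have order 4 there: their doubles reduce to `x = -1` or to the
origin. -/
theorem reducesToZero_of_lt_one (h2 : v 2 < 1) {x y : K}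
    {h : (X1_15.baseChange K).toAffine.Nonsingular x y} (hx : v x < 1)
    {P : (X1_15.baseChange K).toAffine.Point}
    (hP : P = Point.some x y h + Point.some x y h) : ReducesToZero v (P + P) := by
  rcases P with _ | ⟨x', y', h'⟩
  · intro _ _ _ e
    exact absurd e.symm (Point.some_ne_zero _)
  apply reducesToZero_add_self_of_add_one h2
  obtain ⟨h0, -, hd⟩ := add_self_eq_some hP.symm
  rw [sq_eq h] at hd
  have hv := congrArg v hd
  have e1 : v (x + 1) = 1 := by
    rw [v.map_add_eq_of_lt_right (by simpa using hx), map_one]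
  have e4 : v (4 * x ^ 2 + x) < 1 := by
    rw [show 4 * x ^ 2 + x = x * (2 * 2 * x + 1) by ring, map_mul]
    refine mul_lt_one_of_nonneg_of_lt_one_left zero_le hx ?_
    refine v.map_add_le ?_ (by simp)
    simp only [map_mul]
    exact mul_le_one' (mul_le_one' h2.le h2.le) hx.le
  have e2 : v (4 * x ^ 2 + x + 1) = 1 := by
    rw [v.map_add_eq_of_lt_right (by simpa using e4), map_one]
  have e3 : v (x * (x + 2)) < 1 := by
    rw [map_mul]
    refine mul_lt_one_of_nonneg_of_lt_one_left zero_le hx ?_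
    exact v.map_add_le hx.le h2.le
  rw [map_mul, map_mul, e1, e2, mul_one, mul_one, map_pow] at hv
  rw [hv]
  exact pow_lt_one₀ zero_le e3 two_ne_zero

/-- The remaining residues in `F_4`, the primitive cube roots of unity, double to `x = 0`. -/
theorem lt_one_of_add_self (h2 : v 2 < 1) {x y x' y' : K}
    {h : (X1_15.baseChange K).toAffine.Nonsingular x y}
    {h' : (X1_15.baseChange K).toAffine.Nonsingular x' y'}
    (e : Point.some x y h + Point.some x y h = Point.some x' y' h') (hx1 : v x ≤ 1)
    (hx : v (x ^ 2 + x + 1) < 1) : v x' < 1 := by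
  obtain ⟨h0, hd, -⟩ := add_self_eq_some e
  rw [sq_eq h] at hd
  have hv := congrArg v hd
  have e0 : v (x * (x + 1)) = 1 := by
    rw [show x * (x + 1) = -1 + (x ^ 2 + x + 1) by ring,
      v.map_add_eq_of_lt_left (by simpa using hx)]
    simp
  have e1' : v (x + 1) ≤ 1 := v.map_add_le hx1 (by simp)
  have e1 : v (x + 1) = 1 := by
    refine le_antisymm e1' ?_
    by_contra hlt
    rw [not_le] at hlt
    rw [map_mul] at e0
    exact absurd e0 (mul_lt_one_of_nonneg_of_lt_one_right hx1 zero_le hlt).ne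
  have e4 : v (4 * x ^ 2) < 1 := by
    rw [show 4 * x ^ 2 = 2 * (2 * (x * x)) by ring, map_mul]
    refine mul_lt_one_of_nonneg_of_lt_one_left zero_le h2 ?_
    simp only [map_mul]
    exact mul_le_one' h2.le (mul_le_one' hx1 hx1)
  have e2 : v (4 * x ^ 2 + x + 1) = 1 := by
    rw [add_assoc, v.map_add_eq_of_lt_right (by rwa [e1]), e1]
  have e3 : v (x ^ 2 - x - 1) ≤ 1 := by
    rw [show x ^ 2 - x - 1 = x * x + -(x + 1) by ring]
    refine v.map_add_le ?_ (by rwa [v.map_neg])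
    rw [map_mul]
    exact mul_le_one' hx1 hx1
  rw [map_mul, map_mul, map_mul, e1, e2, mul_one, mul_one] at hv
  rw [hv]
  exact mul_lt_one_of_nonneg_of_lt_one_right e3 zero_le hx

theorem reducesToZero_eight_nsmul (h2 : v 2 < 1)
    (hres : ∀ x : K, v x ≤ 1 → v x < 1 ∨ v (x + 1) < 1 ∨ v (x ^ 2 + x + 1) < 1)
    (P : (X1_15.baseChange K).toAffine.Point) : ReducesToZero v (8 • P) := by
  rw [show 8 • P = ((P + P) + (P + P)) + ((P + P) + (P + P)) by abel]
  rcases P with _ | ⟨x, y, h⟩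
  · intro _ _ _ e
    exact absurd e.symm (Point.some_ne_zero _)
  rcases le_or_gt (v x) 1 with hx | hx
  · rcases hres x hx with h1 | h1 | h1
    · exact (reducesToZero_of_lt_one h2 h1 rfl).add_self h2
    · exact ((reducesToZero_add_self_of_add_one h2 h1).add_self h2).add_self h2
    · obtain ⟨Q, hQ⟩ : ∃ Q, Q = Point.some x y h + Point.some x y h := ⟨_, rfl⟩
      rw [← hQ]
      rcases Q with _ | ⟨x', y', h'⟩
      · intro _ _ _ e
        exact absurd e.symm (Point.some_ne_zero _)
      · exact reducesToZero_of_lt_one h2 (lt_one_of_add_self h2 hQ.symm hx h1) rfl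
  · have : ReducesToZero v (Point.some x y h) := by
      rintro _ _ _ ⟨⟩
      exact hx
    exact ((this.add_self h2).add_self h2).add_self h2

theorem ReducesToZero.two_pow_nsmul (h2 : v 2 < 1) {P : (X1_15.baseChange K).toAffine.Point}
    (hP : ReducesToZero v P) (n : ℕ) : ReducesToZero v (2 ^ n • P) := by
  induction n with
  | zero => simpa using hP
  | succ n ih => rw [pow_succ', mul_smul, two_nsmul]; exact ih.add_self h2

/-- Otherwise the multiples `2 ^ k • 8 • P` have strictly increasing `v x`, so a torsion point would
have infinitely many multiples. -/
theorem exists_two_pow_nsmul_eq_zero (h2 : v 2 < 1)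
    (hres : ∀ x : K, v x ≤ 1 → v x < 1 ∨ v (x + 1) < 1 ∨ v (x ^ 2 + x + 1) < 1)
    {P : (X1_15.baseChange K).toAffine.Point} (hP : IsOfFinAddOrder P) :
    ∃ k : ℕ, 2 ^ k • P = 0 := by
  by_contra! hne
  have hsome : ∀ k : ℕ, ∃ x y h, 2 ^ k • (8 • P) = Point.some x y h := by
    intro k
    have := hne (k + 3)
    rw [pow_add, mul_smul] at this
    norm_num at this
    rcases hQ : 2 ^ k • 8 • P with _ | ⟨x, y, h⟩
    · exact absurd hQ this
    · exact ⟨x, y, h, rfl⟩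
  choose x y h hxy using hsome
  have hmono : StrictMono fun k ↦ v (x k) := by
    refine strictMono_nat_of_lt_succ fun k ↦ ?_
    refine valuation_lt_of_add_self h2 (h := h k) (h' := h (k + 1)) ?_ ?_
    · rw [← hxy, ← hxy, pow_succ', mul_smul, two_nsmul]
    · exact (reducesToZero_eight_nsmul h2 hres P).two_pow_nsmul h2 k _ _ _ (hxy k)
  have hinj : Function.Injective fun k : ℕ ↦ 2 ^ k • (8 • P) := by
    intro i j hij
    simp only [hxy, Point.some.injEq] at hij
    exact hmono.injective (congrArg v hij.1)
  have hfin : (AddSubmonoid.multiples P : Set (X1_15.baseChange K).toAffine.Point).Finite := finite_multiples.mpr hP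
  refine Set.infinite_range_of_injective hinj (hfin.subset ?_)
  rintro _ ⟨k, rfl⟩
  exact ⟨2 ^ k * 8, by simp [mul_smul]⟩

end Valuation

/-- The valuation is discrete, so each doubling in the kernel of reduction raises `log (v x)` by at
least 1. The lemma replaces finite generation of the group of points in the descent. -/
theorem eq_zero_of_forall_two_pow_dvd {v : Valuation K (WithZero (Multiplicative ℤ))}
    (h2 : v 2 < 1)
    (hres : ∀ x : K, v x ≤ 1 → v x < 1 ∨ v (x + 1) < 1 ∨ v (x ^ 2 + x + 1) < 1)
    {P : (X1_15.baseChange K).toAffine.Point}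
    (hP : ∀ n : ℕ, ∃ Q, P = 2 ^ n • Q) : P = 0 := by
  rcases P with _ | ⟨x, y, h⟩
  · rfl
  exfalso
  have key : ∀ n : ℕ, ∀ Q : (X1_15.baseChange K).toAffine.Point, ∀ x y h,
      2 ^ n • 8 • Q = Point.some x y h → (n : ℤ) < WithZero.log (v x) := by
    intro n Q
    have hQ := reducesToZero_eight_nsmul h2 hres Q
    induction n with
    | zero =>
      intro x y h e
      have h1 := hQ x y h (by simpa using e)
      rw [WithZero.lt_log_iff_exp_lt (zero_lt_one.trans h1).ne']
      simpa using h1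
    | succ n ih =>
      intro x y h e
      rw [pow_succ', mul_smul, two_nsmul] at e
      rcases hR : 2 ^ n • 8 • Q with _ | ⟨x', y', h'⟩
      · rw [hR] at e
        exact absurd e.symm (Point.some_ne_zero _)
      rw [hR] at e
      have h1 := ih x' y' h' hR
      have h0 := hQ.two_pow_nsmul h2 n _ _ _ hR
      have h3 := valuation_lt_of_add_self h2 e h0
      have h4 := (WithZero.log_lt_log (zero_lt_one.trans h0).ne'
        (zero_lt_one.trans (h0.trans h3)).ne').mpr h3
      push_cast
      omega
  obtain ⟨n, hn⟩ : ∃ n : ℕ, WithZero.log (v x) ≤ n := ⟨_, Int.self_le_toNat _⟩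
  obtain ⟨Q, hQ⟩ := hP (n + 3)
  rw [pow_add, mul_smul] at hQ
  norm_num at hQ
  exact absurd (key n Q x y h hQ.symm) (not_lt.mpr hn)

end X1_15

/-! ### Halving the rational torsion points. -/

namespace X1_15

section Field

variable {K : Type*} [Field K] [CharZero K]

/-- The four rational torsion points. -/
def IsKnown (P : (X1_15.baseChange K).toAffine.Point) : Prop :=
  ∀ x y h, P = Point.some x y h → x = -1 ∨ x = 0

theorem isKnown_zero : IsKnown (0 : (X1_15.baseChange K).toAffine.Point) := by
  intro x y h e
  exact absurd e.symm (Point.some_ne_zero _)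

theorem isKnown_some {x y : K} {h : (X1_15.baseChange K).toAffine.Nonsingular x y} :
    IsKnown (Point.some x y h) ↔ x = -1 ∨ x = 0 := by
  refine ⟨fun H ↦ H x y h rfl, ?_⟩
  rintro H _ _ _ ⟨⟩
  exact H

theorem IsKnown.eq {x y : K} {h : (X1_15.baseChange K).toAffine.Nonsingular x y}
    (hP : IsKnown (Point.some x y h)) :
    x = -1 ∧ y = 0 ∨ x = 0 ∧ y = 0 ∨ x = 0 ∧ y = -1 := by
  have he := (nonsingular_iff x y).mp h
  rcases isKnown_some.mp hP with rfl | rfl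
  · refine Or.inl ⟨rfl, ?_⟩
    exact pow_eq_zero_iff two_ne_zero |>.mp (by linear_combination he)
  · refine Or.inr ?_
    have : y * (y + 1) = 0 := by linear_combination he
    rcases mul_eq_zero.mp this with h0 | h0
    · exact Or.inl ⟨rfl, h0⟩
    · exact Or.inr ⟨rfl, eq_neg_of_add_eq_zero_left h0⟩

/-- The abscissae of the points outside the four rational torsion points whose double is one of
these. -/
def IsNewAbscissa (x : K) : Prop :=
  4 * x ^ 2 + x + 1 = 0 ∨ x = -2 ∨ x ^ 2 - x - 1 = 0 ∨ x ^ 2 + x + 1 = 0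

variable [DecidableEq K]

theorem isNewAbscissa_of_add_self {x y : K}
    {h : (X1_15.baseChange K).toAffine.Nonsingular x y}
    (hP : ¬ IsKnown (Point.some x y h)) (h2 : IsKnown (Point.some x y h + Point.some x y h)) :
    IsNewAbscissa x := by
  rw [isKnown_some, not_or] at hP
  have hsq := sq_eq h
  rcases hQ : Point.some x y h + Point.some x y h with _ | ⟨x', y', h'⟩
  · have h0 := (add_self_eq_zero_iff h).mp hQ
    rw [h0, zero_pow two_ne_zero, eq_comm, mul_eq_zero] at hsq
    rcases hsq with h1 | h1
    · exact absurd (eq_neg_of_add_eq_zero_left h1) hP.1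
    · exact Or.inl h1
  · obtain ⟨-, hx, hx1⟩ := add_self_eq_some hQ
    rw [hQ, isKnown_some] at h2
    rcases h2 with rfl | rfl
    · rw [neg_add_cancel, zero_mul, eq_comm, sq_eq_zero_iff, mul_eq_zero] at hx1
      exact Or.inr (Or.inl (eq_neg_of_add_eq_zero_left (hx1.resolve_left hP.2)))
    · rw [zero_mul, eq_comm, mul_eq_zero] at hx
      exact Or.inr (Or.inr hx)

theorem isKnown_add_self {x y : K} {h : (X1_15.baseChange K).toAffine.Nonsingular x y}
    (hx : IsNewAbscissa x) : IsKnown (Point.some x y h + Point.some x y h) := by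
  have hsq := sq_eq h
  rcases hQ : Point.some x y h + Point.some x y h with _ | ⟨x', y', h'⟩
  · exact isKnown_zero
  · obtain ⟨h0, hx0, hx1⟩ := add_self_eq_some hQ
    rw [isKnown_some]
    have h0' := pow_ne_zero 2 h0
    rcases hx with hx | rfl | hx | hx
    · rw [hx, mul_zero] at hsq
      exact absurd hsq h0'
    · left
      have : (x' + 1) * (2 * y + (-2) + 1) ^ 2 = 0 := by rw [hx1]; ring
      exact eq_neg_of_add_eq_zero_left ((mul_eq_zero.mp this).resolve_right h0')
    · right
      rw [hx, zero_mul] at hx0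
      exact (mul_eq_zero.mp hx0).resolve_right h0'
    · right
      rw [hx, mul_zero] at hx0
      exact (mul_eq_zero.mp hx0).resolve_right h0'

/-- A point with `x = -1` is killed by 2, and a point with `x = 0` doubles to one with `x = -1`. -/
theorem IsKnown.four_nsmul {P : (X1_15.baseChange K).toAffine.Point} (hP : IsKnown P) :
    4 • P = 0 := by
  have hm1 : ∀ {Q : (X1_15.baseChange K).toAffine.Point},
      (∀ x y h, Q = Point.some x y h → x = -1) → Q + Q = 0 := by
    intro Q hQ
    rcases Q with _ | ⟨x, y, h⟩
    · rfl
    · obtain rfl := hQ x y h rfl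
      rw [add_self_eq_zero_iff, ← sq_eq_zero_iff, sq_eq h]
      ring
  rw [show 4 • P = (P + P) + (P + P) by abel]
  rcases P with _ | ⟨x, y, h⟩
  · rfl
  rcases isKnown_some.mp hP with rfl | rfl
  · rw [hm1 (Q := Point.some (-1) y h) (by rintro _ _ _ ⟨⟩; rfl), add_zero]
  · refine hm1 fun x' y' h' e ↦ ?_
    obtain ⟨h0, -, hx1⟩ := add_self_eq_some e
    have : (x' + 1) * (2 * y + 0 + 1) ^ 2 = 0 := by rw [hx1]; ring
    exact eq_neg_of_add_eq_zero_left ((mul_eq_zero.mp this).resolve_right (pow_ne_zero 2 h0))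

theorem isOfFinAddOrder_of_isNewAbscissa {x y : K}
    {h : (X1_15.baseChange K).toAffine.Nonsingular x y} (hx : IsNewAbscissa x) :
    IsOfFinAddOrder (Point.some x y h) := by
  refine isOfFinAddOrder_iff_nsmul_eq_zero.mpr ⟨8, by norm_num, ?_⟩
  rw [← (isKnown_add_self (h := h) hx).four_nsmul]
  abel

/-- Take the least `k` for which `2 ^ k • P` is one of the four points. The multiple just before it
is a new half. -/
theorem exists_isNewAbscissa {P : (X1_15.baseChange K).toAffine.Point} (hP : ¬ IsKnown P)
    {k : ℕ} (hk : 2 ^ k • P = 0) :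
    ∃ j x y h, 2 ^ j • P = Point.some x y h ∧ IsNewAbscissa x := by
  have hex : ∃ k : ℕ, IsKnown (2 ^ k • P) := ⟨k, by rw [hk]; exact isKnown_zero⟩
  classical
  have hspec := Nat.find_spec hex
  obtain ⟨j, hj⟩ : ∃ j, Nat.find hex = j + 1 := by
    refine Nat.exists_eq_succ_of_ne_zero fun h0 ↦ hP ?_
    rw [h0] at hspec
    simpa using hspec
  have hmin := Nat.find_min hex (m := j) (by omega)
  rw [hj, pow_succ', mul_smul, two_nsmul] at hspec
  rcases hQ : 2 ^ j • P with _ | ⟨x, y, h⟩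
  · rw [hQ] at hmin
    exact absurd isKnown_zero hmin
  · rw [hQ] at hmin hspec
    exact ⟨j, x, y, h, hQ, isNewAbscissa_of_add_self hmin hspec⟩

omit [DecidableEq K] in
-- The discriminants are `-15`, `5` and `-3` for the three quadratics in `x`. For `x = -2` the
-- equation in `y` has discriminant `-15`.
theorem isSquare_of_isNewAbscissa {x y : K} (h : (X1_15.baseChange K).toAffine.Nonsingular x y)
    (hx : IsNewAbscissa x) :
    (∃ α : K, α ^ 2 = (-3 : ℤ)) ∧ x ^ 2 + x + 1 = 0 ∨ (∃ α : K, α ^ 2 = (5 : ℤ)) ∨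
      (∃ α : K, α ^ 2 = (-15 : ℤ)) := by
  have he := (nonsingular_iff x y).mp h
  rcases hx with hx | rfl | hx | hx
  · exact Or.inr (Or.inr ⟨8 * x + 1, by push_cast; linear_combination 16 * hx⟩)
  · exact Or.inr (Or.inr ⟨2 * y - 1, by push_cast; linear_combination 4 * he⟩)
  · exact Or.inr (Or.inl ⟨2 * x - 1, by push_cast; linear_combination 4 * hx⟩)
  · exact Or.inl ⟨⟨2 * x + 1, by push_cast; linear_combination 4 * hx⟩, hx⟩

end Field

section NumberField

variable {K : Type*} [Field K] [NumberField K] [DecidableEq K]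

theorem exists_isNewAbscissa_of_isOfFinAddOrder (hK : Module.finrank ℚ K ≤ 2)
    {P : (X1_15.baseChange K).toAffine.Point} (hP : ¬ IsKnown P) (hfin : IsOfFinAddOrder P) :
    ∃ j x y h, 2 ^ j • P = Point.some x y h ∧ IsNewAbscissa x := by
  obtain ⟨v, h2, hres⟩ := NumberField.exists_valuation hK
  obtain ⟨k, hk⟩ := exists_two_pow_nsmul_eq_zero h2 hres hfin
  exact exists_isNewAbscissa hP hk

end NumberField

theorem isKnown_of_isOfFinAddOrder_rat [DecidableEq ℚ]
    {P : (X1_15.baseChange ℚ).toAffine.Point} (hfin : IsOfFinAddOrder P) : IsKnown P := by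
  by_contra hP
  obtain ⟨j, x, y, h, -, hx⟩ := exists_isNewAbscissa_of_isOfFinAddOrder (by simp) hP hfin
  have hneg : ∀ α : ℚ, ∀ n : ℤ, n < 0 → α ^ 2 ≠ n := by
    intro α n hn h0
    have : (n : ℚ) < 0 := by exact_mod_cast hn
    nlinarith [sq_nonneg α]
  rcases isSquare_of_isNewAbscissa h hx with ⟨⟨α, hα⟩, -⟩ | ⟨α, hα⟩ | ⟨α, hα⟩
  · exact hneg α _ (by norm_num) hα
  · exact IsQuadraticField.not_isSquare_five ⟨α, by rw [← sq, hα]⟩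
  · exact hneg α _ (by norm_num) hα

end X1_15

theorem AddCommGroup.nonempty_torsion_equiv_zmod {G : Type*} [AddCommGroup G] {P : G} {n : ℕ}
    (hn : 0 < n) (hP : addOrderOf P = n)
    (h : ∀ Q : G, IsOfFinAddOrder Q → Q ∈ AddSubgroup.zmultiples P) :
    Nonempty (AddCommGroup.torsion G ≃+ ZMod n) := by
  have hfin : IsOfFinAddOrder P := addOrderOf_pos_iff.mp (by omega)
  have heq : AddCommGroup.torsion G = AddSubgroup.zmultiples P :=
    le_antisymm h (AddSubgroup.zmultiples_le.mpr hfin)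
  have e := zmodAddCyclicAddEquiv (G := AddSubgroup.zmultiples P) inferInstance
  rw [Nat.card_zmultiples, hP] at e
  exact ⟨(AddEquiv.addSubgroupCongr heq).trans e.symm⟩

namespace X1_15

section

variable {K : Type*} [Field K] [CharZero K]

theorem nonsingular_zero_zero : (X1_15.baseChange K).toAffine.Nonsingular 0 0 := by
  rw [nonsingular_iff]; ring

theorem isRationalPoint_of_isKnown {P : (X1_15.baseChange K).toAffine.Point} (hP : IsKnown P) :
    IsRationalPoint P := by
  rcases P with _ | ⟨x, y, h⟩
  · exact ⟨0, rfl⟩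
  · have hr : ∀ a b : ℚ, b ^ 2 + a * b + b = a ^ 3 + a ^ 2 → x = a → y = b →
        IsRationalPoint (Point.some x y h) := by
      rintro a b hab rfl rfl
      exact ⟨Point.some a b ((nonsingular_iff a b).mpr hab), rfl⟩
    rcases hP.eq with ⟨hx, hy⟩ | ⟨hx, hy⟩ | ⟨hx, hy⟩
    · exact hr (-1) 0 (by norm_num) (by simpa using hx) (by simpa using hy)
    · exact hr 0 0 (by norm_num) (by simpa using hx) (by simpa using hy)
    · exact hr 0 (-1) (by norm_num) (by simpa using hx) (by simpa using hy)

theorem isKnown_of_isRationalPoint {P : (X1_15.baseChange K).toAffine.Point}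
    (hP : IsTorsionPoint P) (hrat : IsRationalPoint P) : IsKnown P := by
  obtain ⟨Q, rfl⟩ := hrat
  have hQ : IsOfFinAddOrder Q := by
    classical
    unfold IsTorsionPoint at hP
    exact (Point.map_injective (W' := X1_15) (Algebra.ofId ℚ K)).isOfFinAddOrder_iff.mp hP
  have hk := isKnown_of_isOfFinAddOrder_rat hQ
  rcases Q with _ | ⟨x, y, h⟩
  · exact isKnown_zero
  · rintro _ _ _ ⟨⟩
    rcases isKnown_some.mp hk with rfl | rfl
    · left; simp
    · right; simp

end

theorem nonempty_torsion_equiv_zmod_four {K : Type*} [Field K] [CharZero K] [DecidableEq K]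
    (hK : ∀ Q : (X1_15.baseChange K).toAffine.Point, IsOfFinAddOrder Q → IsKnown Q) :
    Nonempty (AddCommGroup.torsion (X1_15.baseChange K).toAffine.Point ≃+ ZMod 4) := by
  obtain ⟨t, ht⟩ : ∃ t : (X1_15.baseChange K).toAffine.Point,
    t = Point.some 0 0 nonsingular_zero_zero := ⟨_, rfl⟩
  have h0 : t + t ≠ 0 := by
    rw [ht, Ne, add_self_eq_zero_iff]; norm_num
  have hk : IsKnown t := ht ▸ isKnown_some.mpr (Or.inr rfl)
  refine AddCommGroup.nonempty_torsion_equiv_zmod (P := t) (n := 4) (by norm_num) ?_ ?_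
  · refine addOrderOf_eq_prime_pow (p := 2) (n := 1) ?_ hk.four_nsmul
    rwa [pow_one, two_nsmul]
  · intro Q hQ
    have hQk : IsKnown Q := hK Q hQ
    rcases Q with _ | ⟨x, y, h⟩
    · exact zero_mem _
    rcases hQk.eq with ⟨rfl, rfl⟩ | ⟨rfl, rfl⟩ | ⟨rfl, rfl⟩
    · refine AddSubgroup.mem_zmultiples_iff.mpr ⟨2, ?_⟩
      rw [two_zsmul]
      rcases hR : t + t with _ | ⟨x', y', h'⟩
      · exact absurd hR h0
      · rw [ht] at hR
        obtain ⟨-, -, h1⟩ := add_self_eq_some hR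
        have hx' : x' = -1 := by linear_combination h1
        subst hx'
        have hy' : y' = 0 := by
          have := (nonsingular_iff _ _).mp h'
          exact pow_eq_zero_iff two_ne_zero |>.mp (by linear_combination this)
        subst hy'
        rfl
    · exact ht ▸ AddSubgroup.mem_zmultiples _
    · refine AddSubgroup.mem_zmultiples_iff.mpr ⟨-1, ?_⟩
      rw [neg_one_zsmul, ht]
      obtain ⟨h', e⟩ := neg_some (nonsingular_zero_zero (K := K))
      rw [e]
      simp

/-! ### Cusps. -/

theorem tateCurve_Δ {K : Type*} [Field K] (r s : K) :
    (tateCurve (r * (s * (r - 1))) (s * (r - 1))).Δ = r ^ 3 * s ^ 4 * (r - 1) ^ 5 *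
      (r ^ 2 * s ^ 3 - 8 * r ^ 2 * s ^ 2 + 16 * r ^ 2 * s - 2 * r * s ^ 3 + 5 * r * s ^ 2 -
        20 * r * s + s ^ 3 + 3 * s ^ 2 + 3 * s + 1) := by
  simp only [Δ, b₂, b₄, b₆, b₈, tateCurve]
  ring

variable {K : Type*} [Field K] [CharZero K]

theorem not_isNoncuspidal_of_isKnown {P : (X1_15.baseChange K).toAffine.Point} (hP : IsKnown P) :
    ¬ IsNoncuspidal P := by
  rcases P with _ | ⟨x, y, h⟩
  · exact id
  · rintro ⟨h1, h2, h3, h4⟩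
    rcases hP.eq with ⟨rfl, rfl⟩ | ⟨rfl, rfl⟩ | ⟨rfl, rfl⟩
    · exact h1 rfl
    · exact h1 rfl
    · rw [isElliptic_iff, isUnit_iff_ne_zero] at h4
      apply h4
      rw [b, c, tateCurve_Δ]
      simp [r]

/-- When `x² + x + 1 = 0` the curve equation reads `(x + y)(y + 1) = 0`. On the first factor `s` is
undefined, and on the second `r = 1` makes the discriminant vanish. -/
theorem not_isNoncuspidal_of_sq_add_add_one {x y : K}
    (h : (X1_15.baseChange K).toAffine.Nonsingular x y) (hx : x ^ 2 + x + 1 = 0) :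
    ¬ IsNoncuspidal (Point.some x y h) := by
  rintro ⟨h1, h2, h3, h4⟩
  have he := (nonsingular_iff x y).mp h
  have : (x + y) * (y + 1) = 0 := by linear_combination he + x * hx
  have hy := (mul_eq_zero.mp this).resolve_left h3
  rw [isElliptic_iff, isUnit_iff_ne_zero] at h4
  apply h4
  rw [b, c, tateCurve_Δ]
  simp [r, hy]

theorem torsionIso_rat : (X1_15.baseChange ℚ).TorsionIso (ZMod 4) := by
  have h := @nonempty_torsion_equiv_zmod_four ℚ _ _ (fun a b ↦ Classical.propDecidable (a = b))
    fun _ hQ ↦ @isKnown_of_isOfFinAddOrder_rat (fun a b ↦ Classical.propDecidable (a = b)) _ hQ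
  -- The two `ℚ`-algebra structures on `ℚ` coincide.
  have e : (DivisionRing.toRatAlgebra : Algebra ℚ ℚ) = Algebra.id ℚ := Subsingleton.elim _ _
  rw [e] at h
  exact h

theorem not_isNoncuspidal_rat (P : (X1_15.baseChange ℚ).toAffine.Point)
    (hP : IsTorsionPoint P) : ¬ IsNoncuspidal P := by
  have key : ∀ P : (@WeierstrassCurve.baseChange ℚ _ X1_15 ℚ _
      DivisionRing.toRatAlgebra).toAffine.Point, IsTorsionPoint P → ¬ IsNoncuspidal P :=
    fun P hP ↦ not_isNoncuspidal_of_isKnown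
      (@isKnown_of_isOfFinAddOrder_rat (fun a b ↦ Classical.propDecidable (a = b)) _ hP)
  exact key P hP

theorem isNoncuspidal {v : Valuation K (WithZero (Multiplicative ℤ))}
    (h2 : v 2 < 1)
    (hres : ∀ x : K, v x ≤ 1 → v x < 1 ∨ v (x + 1) < 1 ∨ v (x ^ 2 + x + 1) < 1)
    {x y : K} (h : (X1_15.baseChange K).toAffine.Nonsingular x y)
    (hP : ¬ IsKnown (Point.some x y h)) (hx : x ^ 2 + x + 1 ≠ 0) :
    IsNoncuspidal (Point.some x y h) := by
  have he := (nonsingular_iff x y).mp h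
  rw [isKnown_some, not_or] at hP
  obtain ⟨hx1, hx0⟩ := hP
  have hx1' : x + 1 ≠ 0 := fun h0 ↦ hx1 (eq_neg_of_add_eq_zero_left h0)
  -- Such a quartic reduces to `x⁴ + x³ + 1`, which is irreducible over `F_2` and so has no root in
  -- `F_4`. A root in `K` would be integral at `v`.
  have hquartic : ∀ a b d : ℤ, x ^ 4 + x ^ 3 + 1 + 2 * (a * x ^ 3 + b * x ^ 2 + d * x) ≠ 0 := by
    intro a b d h0
    have hint : ∀ n : ℤ, v (n : K) ≤ 1 := v.map_intCast_le_one
    have hv : v x ≤ 1 := by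
      by_contra! hlt
      have hv0 : 0 < v x := zero_lt_one.trans hlt
      have hp : ∀ n : ℤ, ∀ i : ℕ, i ≤ 3 → v (n * x ^ i) ≤ v (x ^ 3) := by
        intro n i hi
        rw [map_mul, map_pow, map_pow, ← one_mul (v x ^ 3)]
        exact mul_le_mul' (hint n) (pow_le_pow_right₀ hlt.le hi)
      have h3 : v (x ^ 4) ≤ v (x ^ 3) := by
        rw [show x ^ 4 = ((-1 - 2 * a : ℤ) : K) * x ^ 3 + ((-2 * b : ℤ) : K) * x ^ 2 +
          ((-2 * d : ℤ) : K) * x ^ 1 + ((-1 : ℤ) : K) * x ^ 0 by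
            push_cast; linear_combination h0]
        exact v.map_add_le (v.map_add_le (v.map_add_le (hp _ _ (by norm_num))
          (hp _ _ (by norm_num))) (hp _ _ (by norm_num))) (hp _ _ (by norm_num))
      rw [map_pow, map_pow] at h3
      exact absurd h3 (not_le.mpr (pow_lt_pow_right₀ hlt (by norm_num)))
    have hp : ∀ i : ℕ, ∀ n : ℤ, v (n * x ^ i) ≤ 1 := by
      intro i n
      rw [map_mul, map_pow]
      exact mul_le_one' (hint n) (pow_le_one₀ zero_le hv)
    have hq : v (x ^ 4 + x ^ 3 + 1) < 1 := by
      rw [show x ^ 4 + x ^ 3 + 1 = 2 * (((-a : ℤ) : K) * x ^ 3 + ((-b : ℤ) : K) * x ^ 2 +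
        ((-d : ℤ) : K) * x ^ 1) by push_cast; linear_combination h0, map_mul]
      exact mul_lt_one_of_nonneg_of_lt_one_left zero_le h2
        (v.map_add_le (v.map_add_le (hp _ _) (hp _ _)) (hp _ _))
    have key : ∀ u w : K, v u < 1 → v w ≤ 1 → v (x ^ 4 + x ^ 3 + 1 - u * w) < 1 := by
      intro u w hu hw
      refine v.map_sub_lt hq ?_
      rw [map_mul]
      exact mul_lt_one_of_nonneg_of_lt_one_left zero_le hu hw
    have hx' := hp 1 1
    rcases hres x hv with h1 | h1 | h1
    · have := key x (x ^ 3 + x ^ 2) h1 (v.map_add_le (by simpa using hp 3 1)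
        (by simpa using hp 2 1))
      rw [show x ^ 4 + x ^ 3 + 1 - x * (x ^ 3 + x ^ 2) = 1 by ring, map_one] at this
      exact this.ne rfl
    · have := key (x + 1) (x ^ 3) h1 (by simpa using hp 3 1)
      rw [show x ^ 4 + x ^ 3 + 1 - (x + 1) * x ^ 3 = 1 by ring, map_one] at this
      exact this.ne rfl
    · have := key (x ^ 2 + x + 1) (x ^ 2 - 1) h1 (v.map_sub_le (by simpa using hp 2 1) (by simp))
      rw [show x ^ 4 + x ^ 3 + 1 - (x ^ 2 + x + 1) * (x ^ 2 - 1) = x + 2 by ring] at this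
      have hxlt : v x < 1 := by
        rw [show x = x + 2 - 2 by ring]
        exact v.map_sub_lt this h2
      have h3 : v (x ^ 2 + x) < 1 := by
        rw [show x ^ 2 + x = x * (x + 1) by ring, map_mul]
        exact mul_lt_one_of_nonneg_of_lt_one_left zero_le hxlt (v.map_add_le hv (by simp))
      have h4 := v.map_sub_lt h1 h3
      rw [show x ^ 2 + x + 1 - (x ^ 2 + x) = 1 by ring, map_one] at h4
      exact h4.ne rfl
  have hy0 : y ≠ 0 := by
    rintro rfl
    have : x ^ 2 * (x + 1) = 0 := by linear_combination -he
    simp [hx0, hx1'] at this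
  have hyx : y ≠ x ^ 2 := by
    rintro rfl
    have : x ^ 4 = 0 := by linear_combination he
    simp [hx0] at this
  have hxy : x + y ≠ 0 := by
    intro h0
    have : x * (x ^ 2 + x + 1) = 0 := by linear_combination (y + 1) * h0 - he
    simp [hx0, hx] at this
  have hy1 : y + 1 ≠ 0 := by
    intro h0
    have : x * (x ^ 2 + x + 1) = 0 := by linear_combination (x + y) * h0 - he
    simp [hx0, hx] at this
  have hden : y * (y - x ^ 2) ≠ 0 := mul_ne_zero hy0 (sub_ne_zero.mpr hyx)
  refine ⟨hy0, hyx, hxy, ?_⟩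
  rw [isElliptic_iff, isUnit_iff_ne_zero, b, c, tateCurve_Δ]
  have hs : s x y ≠ 0 := by simp [s, hxy]
  have hr1 : r x y - 1 ≠ 0 := by
    rw [r, add_sub_cancel_left]
    exact div_ne_zero (mul_ne_zero (mul_ne_zero hx0 hx1') hy1) hden
  have hr : r x y ≠ 0 := by
    intro h0
    rw [r, one_add_div hden, div_eq_zero_iff] at h0
    have h1 := h0.resolve_right hden
    -- The numerator of `r` is `y² + xy + x² + x`. Comparison with the curve equation gives `y`.
    have h3 : y = x * (x + 1) ^ 2 := by linear_combination he - h1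
    have h4 : x * (x + 1) * (x ^ 4 + 3 * x ^ 3 + 4 * x ^ 2 + 2 * x + 1) = 0 := by
      rw [h3] at he
      linear_combination he
    refine hquartic 1 2 1 ?_
    push_cast
    linear_combination (mul_eq_zero.mp h4).resolve_left (mul_ne_zero hx0 hx1')
  refine mul_ne_zero (mul_ne_zero (mul_ne_zero (pow_ne_zero _ hr) (pow_ne_zero _ hs))
    (pow_ne_zero _ hr1)) fun h0 ↦ ?_
  -- Modulo the curve equation the last factor of the discriminant becomes linear in `y`.
  have hA : (x^10 + 3*x^9 - 4*x^8 - 31*x^7 - 60*x^6 - 59*x^5 - 32*x^4 - 9*x^3 - x^2) * y +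
      (-x^11 - 9*x^10 - 37*x^9 - 90*x^8 - 141*x^7 - 146*x^6 - 99*x^5 - 42*x^4 - 10*x^3 - x^2)
      = 0 := by
    rw [r, one_add_div hden, s] at h0
    field_simp at h0
    linear_combination h0 - (y^5 - 2*y^4*x^2 + 2*y^4*x + y^3*x^4 - 3*y^3*x^3 - 10*y^3*x^2 -
      12*y^3*x - 7*y^2*x^4 - 32*y^2*x^3 - 40*y^2*x^2 - 11*y^2*x + y*x^7 + y*x^6 - 14*y*x^5 -
      54*y*x^4 - 76*y*x^3 - 35*y*x^2 - x^8 - 8*x^7 - 29*x^6 - 61*x^5 - 80*x^4 - 50*x^3 - 9*x^2) * he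
  -- Up to sign this is the norm of the linear form under `y ↦ -y - x - 1`.
  have h1 : x ^ 7 * (x + 1) ^ 12 * (x ^ 4 - 7 * x ^ 3 - 6 * x ^ 2 + 2 * x + 1) = 0 := by
    linear_combination ((x^10 + 3*x^9 - 4*x^8 - 31*x^7 - 60*x^6 - 59*x^5 - 32*x^4 - 9*x^3 - x^2) *
      (-y - x - 1) + (-x^11 - 9*x^10 - 37*x^9 - 90*x^8 - 141*x^7 - 146*x^6 - 99*x^5 - 42*x^4 -
      10*x^3 - x^2)) * (-hA) - (x^10 + 3*x^9 - 4*x^8 - 31*x^7 - 60*x^6 - 59*x^5 - 32*x^4 - 9*x^3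
      - x^2) ^ 2 * he
  refine hquartic (-4) (-3) 1 ?_
  push_cast
  linear_combination (mul_eq_zero.mp h1).resolve_left
    (mul_ne_zero (pow_ne_zero _ hx0) (pow_ne_zero _ hx1'))

end X1_15

theorem IsQuadraticField.not_isSquare_of_sq_eq {K : Type*} [Field K] [NumberField K]
    (hK : IsQuadraticField K) {d e : ℤ} (hd : ¬ IsSquare (d : ℚ)) (he : ¬ IsSquare (e : ℚ))
    (hde : ¬ IsSquare ((d * e : ℤ) : ℚ)) {α : K} (hα : α ^ 2 = d) (β : K) : β ^ 2 ≠ e := by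
  intro hβ
  obtain ⟨p, q, rfl⟩ := hK.exists_eq_add_mul hd hα β
  have h : ((p ^ 2 + q ^ 2 * d - e : ℚ) : K) + ((2 * p * q : ℚ) : K) * α = 0 := by
    push_cast
    linear_combination hβ - q ^ 2 * hα
  obtain ⟨h1, h2⟩ := IsQuadraticField.eq_zero_of_add_mul_eq_zero hd hα h
  rcases mul_eq_zero.mp h2 with h3 | h3
  · obtain rfl : p = 0 := by linarith
    refine hde ⟨q * d, ?_⟩
    push_cast
    linear_combination -(d : ℚ) * h1
  · subst h3
    refine he ⟨p, ?_⟩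
    linear_combination -h1

/-! ### Torsion of `X1_15` over quadratic fields. -/

namespace X1_15

variable {K : Type*} [Field K] [NumberField K]

theorem isRationalPoint_iff {P : (X1_15.baseChange K).toAffine.Point} (hP : IsTorsionPoint P) :
    IsRationalPoint P ↔ IsKnown P :=
  ⟨isKnown_of_isRationalPoint hP, isRationalPoint_of_isKnown⟩

theorem exists_torsion_of_sq_eq {d : ℤ} (hd : d = -3 ∨ d = 5 ∨ d = -15) {α : K}
    (hα : α ^ 2 = d) : GainsTorsion X1_15 K := by
  classical
  suffices h : ∃ x y : K, y ^ 2 + x * y + y = x ^ 3 + x ^ 2 ∧ IsNewAbscissa x ∧ x ≠ 0 ∧ x ≠ -1 by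
    obtain ⟨x, y, he, hx, hx0, hx1⟩ := h
    have hP : IsTorsionPoint (Point.some x y ((nonsingular_iff x y).mpr he)) := by
      unfold IsTorsionPoint
      convert isOfFinAddOrder_of_isNewAbscissa (h := (nonsingular_iff x y).mpr he) hx
    refine ⟨_, hP, ?_⟩
    rw [isRationalPoint_iff hP, isKnown_some]
    tauto
  -- The witnesses are a primitive cube root of unity with `y = -1`, the golden ratio with `y = x`,
  -- and `(-2, (1 + √-15)/2)`.
  rcases hd with rfl | rfl | rfl <;> push_cast at hα
  · have hx : ((-1 + α) / 2) ^ 2 + (-1 + α) / 2 + 1 = 0 := by linear_combination hα / 4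
    refine ⟨(-1 + α) / 2, -1, by linear_combination -(-1 + α) / 2 * hx, Or.inr (Or.inr (Or.inr hx)),
      ?_, ?_⟩ <;> intro h0 <;> rw [h0] at hx <;> norm_num at hx
  · have hx : ((1 + α) / 2) ^ 2 - (1 + α) / 2 - 1 = 0 := by linear_combination hα / 4
    refine ⟨(1 + α) / 2, (1 + α) / 2, by linear_combination -(1 + α) / 2 * hx,
      Or.inr (Or.inr (Or.inl hx)), ?_, ?_⟩ <;> intro h0 <;> rw [h0] at hx <;> norm_num at hx
  · refine ⟨-2, (1 + α) / 2, by linear_combination hα / 4, Or.inr (Or.inl rfl), ?_, ?_⟩ <;>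
      norm_num

theorem exists_sq_eq_of_not_isKnown (hK : IsQuadraticField K)
    {P : (X1_15.baseChange K).toAffine.Point} (hP : IsTorsionPoint P) (hk : ¬ IsKnown P) :
    (∃ α : K, α ^ 2 = (-3 : ℤ)) ∨ (∃ α : K, α ^ 2 = (5 : ℤ)) ∨ (∃ α : K, α ^ 2 = (-15 : ℤ)) := by
  classical
  unfold IsTorsionPoint at hP
  obtain ⟨j, x, y, h, -, hx⟩ := exists_isNewAbscissa_of_isOfFinAddOrder hK.le hk
    (by convert hP)
  exact (isSquare_of_isNewAbscissa h hx).imp_left And.left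

/-- Over `ℚ(√-3)` the new torsion points have abscissa a primitive cube root of unity. -/
theorem sq_add_add_one_eq_zero (hK : IsQuadraticField K) {α : K} (hα : α ^ 2 = (-3 : ℤ))
    {x y : K} {h : (X1_15.baseChange K).toAffine.Nonsingular x y}
    (hP : IsTorsionPoint (Point.some x y h)) (hk : ¬ IsKnown (Point.some x y h)) :
    x ^ 2 + x + 1 = 0 := by
  classical
  have hno : ∀ e : ℤ, ¬ IsSquare (e : ℚ) → ¬ IsSquare ((-3 * e : ℤ) : ℚ) → ∀ β : K, β ^ 2 ≠ e :=
    fun e he he' ↦ hK.not_isSquare_of_sq_eq (by norm_num) he he' hα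
  unfold IsTorsionPoint at hP
  obtain ⟨j, x', y', h', hj, hx⟩ := exists_isNewAbscissa_of_isOfFinAddOrder hK.le hk
    (by convert hP)
  rcases isSquare_of_isNewAbscissa h' hx with ⟨-, hx'⟩ | ⟨β, hβ⟩ | ⟨β, hβ⟩
  · rcases j with _ | j
    · simp only [pow_zero, one_smul, Point.some.injEq] at hj
      rw [hj.1]
      exact hx'
    · exfalso
      rw [pow_succ', mul_smul, two_nsmul] at hj
      rcases hR : 2 ^ j • Point.some x y h with _ | ⟨x₀, y₀, h₀⟩
      · rw [hR] at hj
        exact absurd hj.symm (Point.some_ne_zero _)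
      · rw [hR] at hj
        obtain ⟨h0, -, h1⟩ := add_self_eq_some hj
        have hx0 : x' ≠ 0 := by
          rintro rfl
          norm_num at hx'
        -- Here `x' + 1 = -x'²`, while `x' + 1` is a square because the point is a double. So `-1`
        -- would be a square in `ℚ(√-3)`.
        refine hno (-1) (by norm_num)
          (by norm_num)
          (x₀ * (x₀ + 2) / (x' * (2 * y₀ + x₀ + 1))) ?_
        rw [div_pow, ← h1]
        field_simp
        push_cast
        linear_combination hx'
  · exact absurd hβ (hno 5 (by norm_num)
      (by norm_num) β)
  · exact absurd hβ (hno (-15) (by norm_num) (by norm_num) β)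

theorem gainsTorsion_iff (hK : IsQuadraticField K) :
    GainsTorsion X1_15 K ↔ IsQSqrt K (-3) ∨ IsQSqrt K 5 ∨ IsQSqrt K (-15) := by
  rw [isQSqrt_iff hK (by norm_num),
    isQSqrt_iff hK (by norm_num),
    isQSqrt_iff hK (by norm_num)]
  constructor
  · rintro ⟨P, hP, hr⟩
    rw [isRationalPoint_iff hP] at hr
    exact exists_sq_eq_of_not_isKnown hK hP hr
  · rintro (⟨α, hα⟩ | ⟨α, hα⟩ | ⟨α, hα⟩)
    · exact exists_torsion_of_sq_eq (Or.inl rfl) hα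
    · exact exists_torsion_of_sq_eq (Or.inr (Or.inl rfl)) hα
    · exact exists_torsion_of_sq_eq (Or.inr (Or.inr rfl)) hα

theorem isNoncuspidal_of_not_isRationalPoint (hK : IsQuadraticField K)
    (h : IsQSqrt K 5 ∨ IsQSqrt K (-15)) {P : (X1_15.baseChange K).toAffine.Point}
    (hP : IsTorsionPoint P) (hr : ¬ IsRationalPoint P) : IsNoncuspidal P := by
  classical
  rw [isQSqrt_iff hK (by norm_num),
    isQSqrt_iff hK (by norm_num)] at h
  rw [isRationalPoint_iff hP] at hr
  rcases P with _ | ⟨x, y, hxy⟩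
  · exact absurd isKnown_zero hr
  obtain ⟨v, h2, hres⟩ := NumberField.exists_valuation (K := K) hK.le
  refine isNoncuspidal h2 hres hxy hr fun hx ↦ ?_
  have h3 : (2 * x + 1) ^ 2 = ((-3 : ℤ) : K) := by push_cast; linear_combination 4 * hx
  rcases h with ⟨α, hα⟩ | ⟨α, hα⟩
  · exact hK.not_isSquare_of_sq_eq (by norm_num)
      (by norm_num) (by norm_num) hα _ h3
  · exact hK.not_isSquare_of_sq_eq (by norm_num)
      (by norm_num) (by norm_num)
      hα _ h3

theorem exists_isNoncuspidal_iff (hK : IsQuadraticField K) :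
    (∃ P : (X1_15.baseChange K).toAffine.Point, IsTorsionPoint P ∧ IsNoncuspidal P) ↔
      IsQSqrt K 5 ∨ IsQSqrt K (-15) := by
  constructor
  · rintro ⟨P, hP, hn⟩
    have hk : ¬ IsKnown P := fun h ↦ not_isNoncuspidal_of_isKnown h hn
    rw [isQSqrt_iff hK (by norm_num),
      isQSqrt_iff hK (by norm_num)]
    refine (exists_sq_eq_of_not_isKnown hK hP hk).resolve_left ?_
    rintro ⟨α, hα⟩
    rcases P with _ | ⟨x, y, hxy⟩
    · exact hn
    · exact not_isNoncuspidal_of_sq_add_add_one hxy (sq_add_add_one_eq_zero hK hα hP hk) hn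
  · intro h
    obtain ⟨P, hP, hr⟩ := (gainsTorsion_iff hK).mpr (Or.inr h)
    exact ⟨P, hP, isNoncuspidal_of_not_isRationalPoint hK h hP hr⟩

end X1_15

/-! ### Tools for descent by 2-isogeny over `ℚ`. -/

/-- If `u * t` is a square, then the squarefree part of `u` divides `t`. -/
theorem Int.exists_eq_mul_sq_of_mul_eq_sq {u t k : ℤ} (hu : u ≠ 0) (h : u * t = k ^ 2) :
    ∃ δ m : ℤ, u = δ * m ^ 2 ∧ Squarefree δ ∧ δ ∣ u ∧ δ ∣ t := by
  obtain ⟨a, b, ha, hb, hsq⟩ : ∃ a b : ℕ, 0 < a ∧ b ^ 2 * a = u.natAbs ∧ Squarefree a := by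
    obtain ⟨a, b, ha, -, h1, h2⟩ := Nat.sq_mul_squarefree_of_pos (Int.natAbs_pos.mpr hu)
    exact ⟨a, b, ha, h1, h2⟩
  have hb0 : b ≠ 0 := by
    rintro rfl
    apply hu
    simpa using hb.symm
  obtain ⟨δ, hδ, hδa⟩ : ∃ δ : ℤ, u = δ * (b : ℤ) ^ 2 ∧ δ.natAbs = a := by
    rcases Int.natAbs_eq u with e | e
    · exact ⟨a, by rw [e, ← hb]; push_cast; ring, by simp⟩
    · exact ⟨-a, by rw [e, ← hb]; push_cast; ring, by simp⟩
  have hsqδ : Squarefree δ := by rwa [← Int.squarefree_natAbs, hδa]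
  refine ⟨δ, b, hδ, hsqδ, ⟨_, hδ⟩, ?_⟩
  have hbk : (b : ℤ) ∣ k := by
    rw [← Int.pow_dvd_pow_iff two_ne_zero, ← h, hδ]
    exact ⟨δ * t, by ring⟩
  obtain ⟨l, rfl⟩ := hbk
  have hδt : δ * t = l ^ 2 := by
    have : (b : ℤ) ^ 2 ≠ 0 := by positivity
    apply mul_left_cancel₀ this
    rw [hδ] at h
    linear_combination h
  have hδl : δ ∣ l := (hsqδ.dvd_pow_iff_dvd two_ne_zero).mp ⟨t, hδt.symm⟩
  obtain ⟨n, rfl⟩ := hδl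
  have hδ0 : δ ≠ 0 := hsqδ.ne_zero
  exact ⟨n ^ 2, mul_left_cancel₀ hδ0 (by linear_combination hδt)⟩

theorem Rat.exists_int_sq {q : ℚ} {n : ℤ} (h : q ^ 2 = n) : ∃ k : ℤ, q = k ∧ k ^ 2 = n := by
  obtain ⟨k, hk⟩ := Rat.isSquare_intCast_iff.mp ⟨q, by rw [← h]; ring⟩
  have : q ^ 2 = (k : ℚ) ^ 2 := by rw [h, hk]; push_cast; ring
  rcases sq_eq_sq_iff_eq_or_eq_neg.mp this with e | e
  · exact ⟨k, e, by rw [hk]; ring⟩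
  · exact ⟨-k, by rw [e]; push_cast; rfl, by rw [hk]; ring⟩

/-- The image of the descent map of `y² = x(x² + ax + b)` consists of divisors of `b`. -/
theorem Rat.exists_eq_squarefree_mul_sq {a b : ℤ} {x y : ℚ} (hx : x ≠ 0)
    (h : y ^ 2 = x * (x ^ 2 + a * x + b)) :
    ∃ δ : ℤ, Squarefree δ ∧ δ ∣ b ∧ ∃ q : ℚ, x = δ * q ^ 2 := by
  have hw0 : (x.den : ℚ) ≠ 0 := by exact_mod_cast x.den_ne_zero
  have hxe : x * x.den = x.num := Rat.mul_den_eq_num x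
  have hcop : IsCoprime x.num (x.den : ℤ) := by
    rw [Int.isCoprime_iff_gcd_eq_one]
    exact x.reduced
  have hu0 : x.num ≠ 0 := Rat.num_ne_zero.mpr hx
  generalize x.num = u at *
  have hwz : (x.den : ℤ) ≠ 0 := by exact_mod_cast x.den_ne_zero
  generalize hw : (x.den : ℤ) = w at *
  have hww : (x.den : ℚ) = w := by rw [← hw]; push_cast; rfl
  rw [hww] at hxe hw0
  -- With `x = u / w` in lowest terms, `(y w²)²` is the product of `w` and an integer coprime to it.
  -- Both are squares up to sign, and `w > 0` fixes the signs.
  obtain ⟨k, -, hk⟩ := Rat.exists_int_sq (q := y * w ^ 2)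
    (n := w * (u * (u ^ 2 + a * u * w + b * w ^ 2))) (by
      push_cast
      rw [← hxe, mul_pow, h]
      ring)
  have hT : IsCoprime w (u * (u ^ 2 + a * u * w + b * w ^ 2)) := by
    refine IsCoprime.mul_right hcop.symm ?_
    have : IsCoprime w (u ^ 2 + w * (a * u + b * w)) :=
      (IsCoprime.pow_right hcop.symm).add_mul_left_right _
    convert this using 1
    ring
  obtain ⟨w₁, hw₁⟩ := Int.sq_of_isCoprime hT hk.symm
  obtain ⟨k₁, hk₁⟩ := Int.sq_of_isCoprime hT.symm (by rw [mul_comm]; exact hk.symm)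
  have hwpos : 0 < w := by
    rw [← hw]
    exact_mod_cast x.den_pos
  have hw₁' : w = w₁ ^ 2 := by
    rcases hw₁ with e | e
    · exact e
    · nlinarith [sq_nonneg w₁]
  have hk₁' : u * (u ^ 2 + a * u * w + b * w ^ 2) = k₁ ^ 2 := by
    rcases hk₁ with e | e
    · exact e
    · have : w * (-k₁ ^ 2) = k ^ 2 := by rw [← e, hk]
      have h2 : k₁ ^ 2 = 0 := by nlinarith [sq_nonneg k₁, sq_nonneg k]
      rw [e, h2]; ring
  obtain ⟨δ, m, hδ, hsq, hδu, hδt⟩ := Int.exists_eq_mul_sq_of_mul_eq_sq hu0 hk₁'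
  refine ⟨δ, hsq, ?_, m / w₁, ?_⟩
  · have h1 : δ ∣ b * w ^ 2 := by
      have : b * w ^ 2 = (u ^ 2 + a * u * w + b * w ^ 2) - u * (u + a * w) := by ring
      rw [this]
      exact dvd_sub hδt (hδu.mul_right _)
    exact (hcop.of_isCoprime_of_dvd_left hδu).pow_right.dvd_of_dvd_mul_right h1
  · have hw1 : (w : ℚ) = (w₁ : ℚ) ^ 2 := by exact_mod_cast hw₁'
    have hw1' : (w₁ : ℚ) ≠ 0 := by
      intro e
      rw [hw1, e] at hw0
      norm_num at hw0
    have hu : (u : ℚ) = δ * (m : ℚ) ^ 2 := by exact_mod_cast hδ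
    rw [hu, hw1] at hxe
    field_simp
    linear_combination hxe

/-- The residues of the squares modulo `N`. -/
def squareResidues (N : ℕ) : List ℤ :=
  ((List.range N).map fun i ↦ ((i ^ 2 % N : ℕ) : ℤ)).dedup

theorem sq_emod_mem_squareResidues {N : ℕ} (hN : N ≠ 0) (k : ℤ) :
    k ^ 2 % N ∈ squareResidues N := by
  have hN' : (N : ℤ) ≠ 0 := by exact_mod_cast hN
  rw [squareResidues, List.mem_dedup, List.mem_map]
  refine ⟨(k % N).toNat, ?_, ?_⟩
  · rw [List.mem_range]
    have := Int.emod_lt_of_pos k (by positivity : (0 : ℤ) < N)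
    omega
  · push_cast
    rw [Int.toNat_of_nonneg (Int.emod_nonneg _ hN')]
    exact (Int.ModEq.pow 2 (Int.mod_modEq k N))

/-- A binary quadratic form in two squares that takes no square value modulo `N`. -/
def IsObstructed (N p : ℕ) (A B C : ℤ) : Prop :=
  ∀ M ∈ squareResidues N, ∀ E ∈ squareResidues N, ¬ (M % p = 0 ∧ E % p = 0) →
    (A * M ^ 2 + B * M * E + C * E ^ 2) % N ∉ squareResidues N

instance (N p : ℕ) (A B C : ℤ) : Decidable (IsObstructed N p A B C) := by
  unfold IsObstructed; infer_instance

/-- Putting `x = δ m² / e²` in lowest terms gives the covering `k² = δ³ m⁴ + a δ² m² e² + b δ e⁴`. A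
congruence obstruction that respects coprimality of `m` and `e` excludes the class `δ`. -/
theorem not_eq_mul_sq_of_isObstructed {a b : ℤ} {x y : ℚ} (hx : x ≠ 0)
    (h : y ^ 2 = x * (x ^ 2 + a * x + b)) {δ : ℤ} {N p : ℕ} (hN : N ≠ 0) (hp : p.Prime)
    (hpN : p ∣ N) (hδ : IsObstructed N p (δ ^ 3) (a * δ ^ 2) (b * δ)) (q : ℚ) :
    x ≠ δ * q ^ 2 := by
  rintro rfl
  have hq0 : q ≠ 0 := by
    rintro rfl
    simp at hx
  have he0 : (q.den : ℚ) ≠ 0 := by exact_mod_cast q.den_ne_zero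
  have hqe : q * q.den = q.num := Rat.mul_den_eq_num q
  have hcop : IsCoprime q.num (q.den : ℤ) := by
    rw [Int.isCoprime_iff_gcd_eq_one]
    exact q.reduced
  generalize q.num = m at *
  generalize he : (q.den : ℤ) = e at *
  have hee : (q.den : ℚ) = e := by rw [← he]; push_cast; rfl
  rw [hee] at hqe he0
  obtain ⟨k, -, hk⟩ := Rat.exists_int_sq (q := y / q * e ^ 2)
    (n := δ ^ 3 * (m ^ 2) ^ 2 + a * δ ^ 2 * m ^ 2 * e ^ 2 + b * δ * (e ^ 2) ^ 2) (by
      push_cast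
      rw [← hqe, mul_pow, div_pow, h]
      field_simp)
  refine hδ _ (sq_emod_mem_squareResidues hN m) _ (sq_emod_mem_squareResidues hN e) ?_ ?_
  · rintro ⟨h1, h2⟩
    have hpp : Prime (p : ℤ) := Nat.prime_iff_prime_int.mp hp
    have hd : ∀ n : ℤ, n ^ 2 % N % p = 0 → (p : ℤ) ∣ n := by
      intro n hn
      rw [Int.emod_emod_of_dvd _ (by exact_mod_cast hpN)] at hn
      exact hpp.dvd_of_dvd_pow (Int.dvd_of_emod_eq_zero hn)
    exact hpp.not_isUnit (hcop.isUnit_of_dvd' (hd _ h1) (hd _ h2))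
  · have : (δ ^ 3 * (m ^ 2 % N) ^ 2 + a * δ ^ 2 * (m ^ 2 % N) * (e ^ 2 % N)
        + b * δ * (e ^ 2 % N) ^ 2) % N = k ^ 2 % N := by
      rw [hk]
      have hM := Int.mod_modEq (m ^ 2) N
      have hE := Int.mod_modEq (e ^ 2) N
      exact (((hM.pow 2).mul_left _).add ((hM.mul_left _).mul hE)).add ((hE.pow 2).mul_left _)
    rw [this]
    exact sq_emod_mem_squareResidues hN k

/-- Testing the squares 4 and 9 suffices for the values 16, 144, 15 and 135 of `n` that occur. -/
theorem Int.eq_of_squarefree_of_dvd {δ : ℤ} (hδ : Squarefree δ) {n : ℕ} (hn : n ≠ 0)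
    (h : δ ∣ n) (l : List ℕ)
    (hl : ∀ a ∈ Nat.divisors n, ¬ 4 ∣ a → ¬ 9 ∣ a → a ∈ l) :
    ∃ a ∈ l, δ = a ∨ δ = -a := by
  have hsq : ∀ k : ℕ, 1 < k → ¬ k * k ∣ δ.natAbs := by
    intro k hk hd
    have := Int.squarefree_natAbs.mpr hδ k hd
    rw [Nat.isUnit_iff] at this
    omega
  refine ⟨δ.natAbs, hl _ ?_ (hsq 2 (by norm_num)) (hsq 3 (by norm_num)), δ.natAbs_eq⟩
  rw [Nat.mem_divisors]
  exact ⟨Int.natCast_dvd_natCast.mp (by simpa using h), hn⟩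

/-! ### The descent on `X1_15` and its twists by `-1` and `-3`. -/

namespace X1_15

/-- The `2`-descent on the curves `y² = x(x² - 7dx + 16d²)`: all rational abscissae are squares. -/
theorem isSquare_of_sq_eq {d : ℤ} (hd : d = 1 ∨ d = -1 ∨ d = -3) {X Y : ℚ} (hX : X ≠ 0)
    (h : Y ^ 2 = X * (X ^ 2 + (-7 * d : ℤ) * X + (16 * d ^ 2 : ℤ))) : ∃ z, X = z ^ 2 := by
  have hd0 : (d : ℚ) ≠ 0 := by rcases hd with rfl | rfl | rfl <;> norm_num
  -- The quadratic factor has discriminant `-15d²`, so it is positive, and only positive classes `δ`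
  -- survive.
  have hpos : 0 < X := by
    have h1 : 0 < X ^ 2 + (-7 * d : ℤ) * X + (16 * d ^ 2 : ℤ) := by
      have : 0 < (d : ℚ) ^ 2 := by positivity
      push_cast
      nlinarith [sq_nonneg (2 * X - 7 * d)]
    have h2 : 0 ≤ X * (X ^ 2 + (-7 * d : ℤ) * X + (16 * d ^ 2 : ℤ)) := h ▸ sq_nonneg Y
    exact lt_of_le_of_ne (nonneg_of_mul_nonneg_left h2 h1) hX.symm
  obtain ⟨δ, hδ, hdvd, q, hq⟩ := Rat.exists_eq_squarefree_mul_sq hX h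
  have hδpos : 0 < δ := by
    by_contra hneg
    have h1 : (δ : ℚ) ≤ 0 := by exact_mod_cast not_lt.mp hneg
    nlinarith [sq_nonneg q]
  have key := fun N hN p hp hpN hO ↦
    not_eq_mul_sq_of_isObstructed hX h (δ := δ) (N := N) (p := p) hN hp hpN hO q hq
  have h1 : δ = 1 → ∃ z, X = z ^ 2 := fun e ↦ ⟨q, by rw [hq, e]; push_cast; ring⟩
  rcases hd with rfl | rfl | rfl
  · obtain ⟨a, ha, e⟩ := Int.eq_of_squarefree_of_dvd hδ (n := 16) (by norm_num) hdvd [1, 2]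
      (by decide +kernel)
    simp only [List.mem_cons, List.not_mem_nil, or_false] at ha
    obtain rfl | rfl : δ = 1 ∨ δ = 2 := by omega
    · exact h1 rfl
    · exact (key 64 (by norm_num) 2 Nat.prime_two (by norm_num) (by decide +kernel)).elim
  · obtain ⟨a, ha, e⟩ := Int.eq_of_squarefree_of_dvd hδ (n := 16) (by norm_num) hdvd [1, 2]
      (by decide +kernel)
    simp only [List.mem_cons, List.not_mem_nil, or_false] at ha
    obtain rfl | rfl : δ = 1 ∨ δ = 2 := by omega
    · exact h1 rfl
    · exact (key 3 (by norm_num) 3 Nat.prime_three (by norm_num) (by decide +kernel)).elim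
  · obtain ⟨a, ha, e⟩ := Int.eq_of_squarefree_of_dvd hδ (n := 144) (by norm_num) hdvd [1, 2, 3, 6]
      (by decide +kernel)
    simp only [List.mem_cons, List.not_mem_nil, or_false] at ha
    obtain rfl | rfl | rfl | rfl : δ = 1 ∨ δ = 2 ∨ δ = 3 ∨ δ = 6 := by omega
    · exact h1 rfl
    · exact (key 64 (by norm_num) 2 Nat.prime_two (by norm_num) (by decide +kernel)).elim
    · exact (key 25 (by norm_num) 5 Nat.prime_five (by norm_num) (by decide +kernel)).elim
    · exact (key 64 (by norm_num) 2 Nat.prime_two (by norm_num) (by decide +kernel)).elim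

/-- The `2`-descent on the curves `y² = t(t² + 14dt - 15d²)`. -/
theorem exists_eq_mul_sq {d : ℤ} (hd : d = 1 ∨ d = -1 ∨ d = -3) {t Y : ℚ} (ht : t ≠ 0)
    (h : Y ^ 2 = t * (t ^ 2 + (14 * d : ℤ) * t + (-15 * d ^ 2 : ℤ))) :
    ∃ q, t = q ^ 2 ∨ t = -15 * q ^ 2 ∨
      (d = 1 ∧ (t = 5 * q ^ 2 ∨ t = -3 * q ^ 2)) ∨
      (d ≠ 1 ∧ (t = d * q ^ 2 ∨ t = -15 * d * q ^ 2)) := by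
  obtain ⟨δ, hδ, hdvd, q, hq⟩ := Rat.exists_eq_squarefree_mul_sq ht h
  -- Modulus 64 excludes every class that has to be excluded on these isogenous curves.
  have key := fun hO ↦ not_eq_mul_sq_of_isObstructed ht h (δ := δ) (N := 64) (p := 2)
    (by norm_num) Nat.prime_two (by norm_num) hO q hq
  obtain ⟨a, ha, e⟩ : ∃ a ∈ [1, 3, 5, 15], δ = (a : ℕ) ∨ δ = -(a : ℕ) := by
    rcases hd with rfl | rfl | rfl
    · exact Int.eq_of_squarefree_of_dvd hδ (n := 15) (by norm_num)
        (by rw [← dvd_neg]; exact hdvd) _ (by decide +kernel)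
    · exact Int.eq_of_squarefree_of_dvd hδ (n := 15) (by norm_num)
        (by rw [← dvd_neg]; exact hdvd) _ (by decide +kernel)
    · exact Int.eq_of_squarefree_of_dvd hδ (n := 135) (by norm_num)
        (by rw [← dvd_neg]; exact hdvd) _ (by decide +kernel)
  simp only [List.mem_cons, List.not_mem_nil, or_false] at ha
  obtain rfl | rfl | rfl | rfl | rfl | rfl | rfl | rfl : δ = 1 ∨ δ = -1 ∨ δ = 3 ∨ δ = -3 ∨ δ = 5 ∨
    δ = -5 ∨ δ = 15 ∨ δ = -15 := by omega
  · exact ⟨q, Or.inl (by rw [hq]; push_cast; ring)⟩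
  · rcases hd with rfl | rfl | rfl
    · exact (key (by decide +kernel)).elim
    · exact ⟨q, by rw [hq]; norm_num⟩
    · exact (key (by decide +kernel)).elim
  · rcases hd with rfl | rfl | rfl <;> exact (key (by decide +kernel)).elim
  · rcases hd with rfl | rfl | rfl
    · exact ⟨q, by rw [hq]; norm_num⟩
    · exact (key (by decide +kernel)).elim
    · exact ⟨q, by rw [hq]; norm_num⟩
  · rcases hd with rfl | rfl | rfl
    · exact ⟨q, by rw [hq]; norm_num⟩
    · exact (key (by decide +kernel)).elim
    -- For `d = -3` the class of `-15d = 45` is that of 5, which accounts for the factor 3.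
    · exact ⟨q / 3, by rw [hq]; push_cast; right; right; right; constructor; norm_num; right; ring⟩
  · rcases hd with rfl | rfl | rfl <;> exact (key (by decide +kernel)).elim
  · rcases hd with rfl | rfl | rfl
    · exact (key (by decide +kernel)).elim
    · exact ⟨q, by rw [hq]; norm_num⟩
    · exact (key (by decide +kernel)).elim
  · exact ⟨q, Or.inr (Or.inl (by rw [hq]; push_cast; ring))⟩

/-- The condition on the abscissa `x` of a point of `dv² = (x + 1)(4x² + x + 1)` for the point to be
a double. -/
def Halvable (d : ℤ) (x : ℚ) : Prop :=
  ∃ z w s : ℚ, z ^ 2 = 4 * d * (x + 1) ∧ w ^ 2 = z ^ 4 - 7 * d * z ^ 2 + 16 * d ^ 2 ∧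
    s ^ 2 = 2 * z ^ 2 - 7 * d + 2 * w

/-- With `X = 4d(x + 1)` the curve is `Y² = X(X² - 7dX + 16d²)`, and doubling sends `X` to `((X² -
16d²)/(2Y))²`. The half found has `Y = sX` and satisfies `(X² - 16d²)/(2Y) = z`. -/
theorem Halvable.exists_half {d : ℤ} (hd : d ≠ 0) {x : ℚ} (h : Halvable d x) :
    ∃ x' v : ℚ, v ≠ 0 ∧ d * v ^ 2 = (x' + 1) * (4 * x' ^ 2 + x' + 1) ∧
      (x' * (x' + 2)) ^ 2 = (x + 1) * (d * v ^ 2) := by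
  obtain ⟨z, w, s, hz, hw, hs⟩ := h
  have hd0 : (d : ℚ) ≠ 0 := by exact_mod_cast hd
  have hs0 : s ≠ 0 := by
    rintro rfl
    have h1 : (2 * z ^ 2 - 7 * d) ^ 2 = 4 * w ^ 2 := by
      linear_combination (-(2 * z ^ 2 - 7 * d - 2 * w)) * hs
    have : 15 * (d : ℚ) ^ 2 = 0 := by linear_combination -h1 - 4 * hw
    exact hd0 (pow_eq_zero_iff two_ne_zero |>.mp (by linarith))
  -- This is a root of `X² - 2(z² + w)X + 16d²`. The other root is `z² + w - zs`.
  obtain ⟨X, hX⟩ : ∃ X, X = z ^ 2 + w + z * s := ⟨_, rfl⟩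
  have hX0 : X ≠ 0 := by
    intro e
    rw [hX] at e
    have : 16 * (d : ℚ) ^ 2 = 0 := by linear_combination (z ^ 2 + w - z * s) * e - hw + z ^ 2 * hs
    exact hd0 (pow_eq_zero_iff two_ne_zero |>.mp (by linarith))
  have hXd : X ^ 2 - 16 * d ^ 2 = 2 * X * (z * s) := by
    rw [hX]
    linear_combination hw - z ^ 2 * hs
  have hXs : (s * X) ^ 2 = X * (X ^ 2 - 7 * d * X + 16 * d ^ 2) := by
    linear_combination X ^ 2 * hs + X * hXd - 2 * X ^ 2 * hX
  have hX2 : (X ^ 2 - 16 * d ^ 2) ^ 2 = 4 * (s * X) ^ 2 * z ^ 2 := by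
    rw [hXd]
    ring
  have hx : x + 1 = z ^ 2 / (4 * d) := by rw [hz]; field_simp
  refine ⟨X / (4 * d) - 1, s * X / (4 * d ^ 2), ?_, ?_, ?_⟩
  · positivity
  · field_simp
    linear_combination hXs
  · rw [hx]
    field_simp
    linear_combination hX2

/-- Translation by `(-1, 0)` replaces `X` by `16d² / X`. It multiplies the class of `t = 2z² - 7d +
2w` by `d`, so the class `d` becomes trivial. -/
theorem halvable_neg_div {d : ℤ} {x z w q : ℚ} (hx : x + 1 ≠ 0) (hd : (d : ℚ) ≠ 0) (hq0 : q ≠ 0)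
    (hz : z ^ 2 = 4 * d * (x + 1)) (hw : w ^ 2 = z ^ 4 - 7 * d * z ^ 2 + 16 * d ^ 2)
    (hq : d * q ^ 2 = 2 * z ^ 2 - 7 * d + 2 * w) : Halvable d (-x / (x + 1)) := by
  have hz0 : z ≠ 0 := by
    rintro rfl
    have : (d : ℚ) * (x + 1) = 0 := by linarith
    exact mul_ne_zero hd hx this
  obtain rfl : x = z ^ 2 / (4 * d) - 1 := by
    field_simp
    linear_combination -hz
  refine ⟨4 * d / z, 4 * d * w / z ^ 2, (w + z ^ 2 + 4 * d) / (q * z), ?_, ?_, ?_⟩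
  · field_simp
    ring
  · field_simp
    linear_combination 16 * hw
  · have key : (w + z ^ 2 + 4 * d) ^ 2 = (32 * d - 7 * z ^ 2 + 8 * w) * (d * q ^ 2) := by
      rw [hq]
      linear_combination -15 * hw
    field_simp
    linear_combination key

/-- At the point `(0, 0)` of order 4 the value `t` is `5` or `-3`, so translation by this point
turns the class 5 into the trivial one. The proof is this translation written on the coverings
`4q²z² = 5q⁴ + 14q² - 3` and `4s²z'² = s⁴ + 14s² - 15`. -/
theorem exists_halvable_of_five_mul_sq {x z w q : ℚ} (hq0 : q ≠ 0)
    (hz : z ^ 2 = 4 * (x + 1)) (hw : w ^ 2 = z ^ 4 - 7 * z ^ 2 + 16)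
    (hq : 5 * q ^ 2 = 2 * z ^ 2 - 7 + 2 * w) :
    x = 0 ∨ ∃ y, y ^ 2 + x * y + y = x ^ 3 + x ^ 2 ∧ Halvable 1 ((y / x) ^ 2 + y / x - 1 - x) := by
  rw [or_iff_not_imp_left]
  intro hx
  obtain rfl : x = z ^ 2 / 4 - 1 := by linarith
  have hx4 : z ^ 2 - 4 ≠ 0 := fun e ↦ hx (by linarith)
  have h1 : 4 * q ^ 2 * z ^ 2 = 5 * q ^ 4 + 14 * q ^ 2 - 3 := by
    linear_combination (-(5 * q ^ 2 - 2 * z ^ 2 + 7 + 2 * w) / 5) * hq - 4 / 5 * hw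
  have h2 : 4 * q ^ 2 * w = 5 * q ^ 4 + 3 := by linear_combination -h1 - 2 * q ^ 2 * hq
  have hq1 : q ^ 2 - 1 ≠ 0 := by
    intro e
    have e' : q ^ 2 = 1 := by linarith
    apply hx4
    rw [show q ^ 4 = (q ^ 2) ^ 2 by ring, e'] at h1
    linarith
  -- `s` is a root of `(q² - 1)s² - 8qs - 5q² - 3`, whose discriminant in `s` is `16q²z²`. As a
  -- quadratic in `q` the same form has discriminant `4(s⁴ + 14s² - 15)`, and this yields `z'`.
  obtain ⟨s, hs⟩ : ∃ s, s * (q ^ 2 - 1) = 4 * q - 2 * z * q :=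
    ⟨(4 * q - 2 * z * q) / (q ^ 2 - 1), div_mul_cancel₀ _ hq1⟩
  have hs0 : s ≠ 0 := by
    rintro rfl
    have : q * (2 - z) = 0 := by linarith
    have hz2 : z = 2 := by linarith [(mul_eq_zero.mp this).resolve_left hq0]
    apply hx4
    rw [hz2]
    norm_num
  have hF : s ^ 2 * q ^ 2 - s ^ 2 - 8 * q * s - 5 * q ^ 2 - 3 = 0 := by
    apply (mul_eq_zero.mp (_ : (q ^ 2 - 1) * _ = 0)).resolve_left hq1
    linear_combination (s * (q ^ 2 - 1) - 4 * q - 2 * z * q) * hs + h1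
  obtain ⟨z', hz'⟩ : ∃ z', 2 * s * z' = 4 * s - q * s ^ 2 + 5 * q :=
    ⟨(4 * s - q * s ^ 2 + 5 * q) / (2 * s), mul_div_cancel₀ _ (by positivity)⟩
  have hsq : 4 * s ^ 2 * z' ^ 2 = s ^ 4 + 14 * s ^ 2 - 15 := by
    linear_combination (2 * s * z' + 4 * s - q * s ^ 2 + 5 * q) * hz' + (s ^ 2 - 5) * hF
  have hz : z = (4 * q - s * (q ^ 2 - 1)) / (2 * q) := by
    field_simp
    linear_combination hs
  have hw : w = (5 * q ^ 4 + 3) / (4 * q ^ 2) := by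
    field_simp
    linear_combination h2
  have hz'' : z' = (4 * s - q * s ^ 2 + 5 * q) / (2 * s) := by
    field_simp
    linear_combination hz'
  have hL : (1 - z * z' / 2) * (z ^ 2 - 4) = z * w - 4 := by
    have : 2 * z - z' * (z ^ 2 - 4) = 2 * w := by
      rw [hz'', hz, hw]
      field_simp
      linear_combination 4 * (s ^ 2 * q ^ 3 - s ^ 2 * q - 4 * s * q ^ 2 + 4 * s) * hF
    linear_combination z / 2 * this
  have hN : (1 - z * z' / 2) ^ 2 + 3 - z ^ 2 - z' ^ 2 = 0 := by
    rw [hz'', hz]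
    field_simp
    linear_combination (s ^ 4 * q ^ 4 - s ^ 4 * q ^ 2 - 8 * s ^ 3 * q ^ 3 + 8 * s ^ 3 * q -
      5 * s ^ 2 * q ^ 4 - 3 * s ^ 2 * q ^ 2 + 40 * s * q ^ 3) * hF
  refine ⟨(z * w - z ^ 2) / 8, ?_, z', (s ^ 2 + 7 - 2 * z' ^ 2) / 2, s, ?_, ?_, ?_⟩
  · linear_combination z ^ 2 / 64 * ‹w ^ 2 = _›
  · have hμ : (z * w - z ^ 2) / 8 / (z ^ 2 / 4 - 1) = -z * z' / 4 := by
      rw [div_eq_iff hx]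
      linear_combination -hL / 8
    rw [hμ]
    push_cast
    linear_combination -hN
  · push_cast
    linear_combination -hsq / 4
  · push_cast
    ring

theorem exists_halvable {d : ℤ} (hd : d = 1 ∨ d = -1 ∨ d = -3) {x v : ℚ} (hx : x ≠ -1)
    (h : d * v ^ 2 = (x + 1) * (4 * x ^ 2 + x + 1)) :
    Halvable d x ∨ (d ≠ 1 ∧ Halvable d (-x / (x + 1))) ∨ (d = 1 ∧ (x = 0 ∨
      ∃ y, y ^ 2 + x * y + y = x ^ 3 + x ^ 2 ∧ Halvable 1 ((y / x) ^ 2 + y / x - 1 - x))) := by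
  have hd0 : (d : ℚ) ≠ 0 := by rcases hd with rfl | rfl | rfl <;> norm_num
  have hx1 : x + 1 ≠ 0 := fun e ↦ hx (eq_neg_of_add_eq_zero_left e)
  have hX : 4 * d * (x + 1) ≠ 0 := by positivity
  obtain ⟨z, hz⟩ := isSquare_of_sq_eq hd (X := 4 * d * (x + 1)) (Y := 4 * d ^ 2 * v) hX (by
    push_cast
    linear_combination 16 * d ^ 3 * h)
  have hz0 : z ≠ 0 := by
    rintro rfl
    exact hX (by rw [hz]; norm_num)
  obtain ⟨w, hw⟩ : ∃ w : ℚ, w ^ 2 = z ^ 4 - 7 * d * z ^ 2 + 16 * d ^ 2 := by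
    refine ⟨4 * d ^ 2 * v / z, ?_⟩
    rw [div_pow, div_eq_iff (by positivity), show z ^ 4 = (z ^ 2) ^ 2 by ring, ← hz]
    linear_combination 16 * d ^ 3 * h
  have ht : (2 * z ^ 2 - 7 * d + 2 * w) * (2 * z ^ 2 - 7 * d - 2 * w) = -15 * d ^ 2 := by
    linear_combination -4 * hw
  have ht0 : 2 * z ^ 2 - 7 * d + 2 * w ≠ 0 := by
    intro e
    rw [e, zero_mul] at ht
    have : (d : ℚ) ^ 2 = 0 := by linarith
    exact hd0 (pow_eq_zero_iff two_ne_zero |>.mp this)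
  have hw' : (-w) ^ 2 = z ^ 4 - 7 * d * z ^ 2 + 16 * d ^ 2 := by rw [neg_sq, hw]
  obtain ⟨q, hq⟩ := exists_eq_mul_sq hd (Y := 2 * z * (2 * z ^ 2 - 7 * d + 2 * w)) ht0 (by
    push_cast
    linear_combination (2 * z ^ 2 - 7 * d + 2 * w) * ht)
  have hq0 : q ≠ 0 := by
    rintro rfl
    apply ht0
    rcases hq with hq | hq | ⟨-, hq | hq⟩ | ⟨-, hq | hq⟩ <;> rw [hq] <;> ring
  -- Changing the sign of `w` replaces `t` by `-15d² / t`. So the classes `-15`, `-3` (for `d = 1`)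
  -- and `-15d` turn into `1`, `5` and `d`.
  have hconj : ∀ {e f : ℚ}, 2 * z ^ 2 - 7 * d + 2 * w = e * q ^ 2 → e ≠ 0 → e * f = -15 * d ^ 2 →
      2 * z ^ 2 - 7 * d - 2 * w = f * (1 / q) ^ 2 := by
    intro e f he he0 hef
    rw [he] at ht
    have : q ^ 2 ≠ 0 := by positivity
    field_simp
    apply mul_left_cancel₀ he0
    linear_combination ht - hef
  rcases hq with hq | hq | ⟨rfl, hq | hq⟩ | ⟨h1, hq | hq⟩
  · exact Or.inl ⟨z, w, q, hz.symm, hw, hq.symm⟩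
  · have := hconj (f := d ^ 2) hq (by norm_num) (by ring)
    exact Or.inl ⟨z, -w, d * (1 / q), hz.symm, hw', by linear_combination -this⟩
  · refine Or.inr (Or.inr ⟨rfl, exists_halvable_of_five_mul_sq (z := z) (w := w) hq0 ?_ ?_ ?_⟩)
    · rw [← hz]; push_cast; ring
    · rw [hw]; push_cast; ring
    · rw [← hq]; push_cast; ring
  · have := hconj (f := 5) hq (by norm_num) (by push_cast; norm_num)
    refine Or.inr (Or.inr ⟨rfl, exists_halvable_of_five_mul_sq (z := z) (w := -w) (q := 1 / q)
      (by positivity) ?_ ?_ ?_⟩)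
    · rw [← hz]; push_cast; ring
    · rw [hw']; push_cast; ring
    · rw [← this]; push_cast; ring
  · exact Or.inr (Or.inl ⟨h1, halvable_neg_div hx1 hd0 hq0 hz.symm hw hq.symm⟩)
  · have := hconj (f := d) hq (by simpa using hd0) (by ring)
    refine Or.inr (Or.inl ⟨h1, halvable_neg_div hx1 hd0 (q := 1 / q) (by positivity) hz.symm hw' ?_⟩)
    rw [← this]; ring

end X1_15

/-! ### All points over `ℚ(i)` and `ℚ(√-3)` are torsion. -/

namespace X1_15

section Descent

theorem nonsingular_neg_one_zero {K : Type*} [Field K] [CharZero K] : (X1_15.baseChange K).toAffine.Nonsingular (-1) 0 := by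
  rw [nonsingular_iff]
  ring

variable {K : Type*} [Field K] [CharZero K] [DecidableEq K]

theorem exists_add_eq_some {x₁ y₁ x₂ y₂ : K}
    {h₁ : (X1_15.baseChange K).toAffine.Nonsingular x₁ y₁}
    {h₂ : (X1_15.baseChange K).toAffine.Nonsingular x₂ y₂} (hx : x₁ ≠ x₂) :
    ∃ y h, Point.some x₁ y₁ h₁ + Point.some x₂ y₂ h₂ =
      Point.some (((y₁ - y₂) / (x₁ - x₂)) ^ 2 + (y₁ - y₂) / (x₁ - x₂) - 1 - x₁ - x₂) y h := by
  have e : (X1_15.baseChange K).toAffine.addX x₁ x₂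
      ((X1_15.baseChange K).toAffine.slope x₁ x₂ y₁ y₂) =
      ((y₁ - y₂) / (x₁ - x₂)) ^ 2 + (y₁ - y₂) / (x₁ - x₂) - 1 - x₁ - x₂ := by
    simp [addX, slope_of_X_ne hx, baseChange_eq]
  have h := nonsingular_add h₁ h₂ fun hxy ↦ hx hxy.left
  rw [e] at h
  refine ⟨_, h, ?_⟩
  rw [Point.add_of_X_ne hx, Point.some.injEq]
  exact ⟨e, rfl⟩

/-- The points with rational abscissa for which `2y + x + 1` is a rational multiple of `α`. -/
def IsSemirational (α : K) (P : (X1_15.baseChange K).toAffine.Point) : Prop :=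
  P = 0 ∨ ∃ (x v : ℚ) (y : K) (h : _), P = Point.some (x : K) y h ∧ 2 * y + x + 1 = v * α

theorem Halvable.exists_two_nsmul {d : ℤ} (hd : d ≠ 0) {α : K} (hα : α ^ 2 = d) {x : ℚ}
    (hx : Halvable d x) {x₀ y : K} {h : (X1_15.baseChange K).toAffine.Nonsingular x₀ y}
    (hx₀ : x₀ = x) :
    ∃ R, IsSemirational α R ∧ (Point.some x₀ y h = 2 • R ∨ Point.some x₀ y h = -(2 • R)) := by
  subst hx₀
  obtain ⟨x', v, hv, hv2, hx'⟩ := hx.exists_half hd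
  have hα0 : α ≠ 0 := by
    rintro rfl
    apply hd
    have : ((d : ℤ) : K) = 0 := by rw [← hα]; ring
    exact_mod_cast this
  have hv2' : (d : K) * v ^ 2 = (x' + 1) * (4 * x' ^ 2 + x' + 1) := by exact_mod_cast congrArg (Rat.cast (K := K)) hv2
  have hx'' : ((x' : K) * (x' + 2)) ^ 2 = (x + 1) * (d * v ^ 2) := by exact_mod_cast congrArg (Rat.cast (K := K)) hx'
  have hv0 : (v : K) ≠ 0 := by exact_mod_cast hv
  have hns : (X1_15.baseChange K).toAffine.Nonsingular (x' : K) ((v * α - x' - 1) / 2) := by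
    rw [nonsingular_iff]
    linear_combination v ^ 2 / 4 * hα + hv2' / 4
  have h2 : 2 * ((v * α - x' - 1) / 2) + x' + 1 = v * α := by ring
  refine ⟨Point.some _ _ hns, Or.inr ⟨x', v, _, hns, rfl, h2⟩, ?_⟩
  rw [two_nsmul]
  rcases hQ : Point.some _ _ hns + Point.some _ _ hns with _ | ⟨x₂, y₂, h'⟩
  · have h0 := (add_self_eq_zero_iff hns).mp hQ
    rw [h2] at h0
    exact absurd h0 (mul_ne_zero hv0 hα0)
  · rw [← Point.X_eq_iff]
    obtain ⟨-, -, hx₂⟩ := add_self_eq_some hQ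
    rw [h2, hx'', mul_pow, hα, mul_comm ((v : K) ^ 2)] at hx₂
    have h0 : (d : K) * (v : K) ^ 2 ≠ 0 := by
      rw [← hα]
      exact mul_ne_zero (pow_ne_zero 2 hα0) (pow_ne_zero 2 hv0)
    exact (add_right_cancel (mul_right_cancel₀ h0 hx₂)).symm

/-- Translations by rational torsion disappear after multiplication by 4. Since `R` is again
semirational, the halving can be iterated. -/
theorem IsSemirational.exists_half {d : ℤ} (hd : d = 1 ∨ d = -1 ∨ d = -3) {α : K} (hα : α ^ 2 = d)
    {P : (X1_15.baseChange K).toAffine.Point} (hP : IsSemirational α P) :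
    ∃ R, IsSemirational α R ∧ (4 • P = 2 • 4 • R ∨ 4 • P = -((2 : ℕ) • (4 : ℕ) • R)) := by
  have hd0 : d ≠ 0 := by rcases hd with rfl | rfl | rfl <;> norm_num
  have h40 : ∀ Q : (X1_15.baseChange K).toAffine.Point, 4 • Q = 0 →
      ∃ R, IsSemirational α R ∧ (4 • Q = 2 • 4 • R ∨ 4 • Q = -((2 : ℕ) • (4 : ℕ) • R)) :=
    fun Q hQ ↦ ⟨0, Or.inl rfl, Or.inl (by simp [hQ])⟩
  have hshift : ∀ Q T : (X1_15.baseChange K).toAffine.Point, IsKnown T →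
      (∃ R, IsSemirational α R ∧ (Q + T = 2 • R ∨ Q + T = -(2 • R))) →
      ∃ R, IsSemirational α R ∧ (4 • Q = 2 • 4 • R ∨ 4 • Q = -((2 : ℕ) • (4 : ℕ) • R)) := by
    rintro Q T hT ⟨R, hR, hQ⟩
    have e : 4 • Q = 4 • (Q + T) := by rw [nsmul_add, hT.four_nsmul, add_zero]
    refine ⟨R, hR, hQ.imp (fun hQ ↦ ?_) (fun hQ ↦ ?_)⟩
    · rw [e, hQ, smul_comm]
    · rw [e, hQ, smul_neg, smul_comm]
  rcases hP with rfl | ⟨x, v, y, h, rfl, hv⟩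
  · exact h40 _ (nsmul_zero _)
  have hsq : d * v ^ 2 = (x + 1) * (4 * x ^ 2 + x + 1) := by
    have := sq_eq h
    rw [hv, mul_pow, hα, mul_comm] at this
    exact_mod_cast this
  by_cases hx1 : x = -1
  · refine h40 _ (IsKnown.four_nsmul (isKnown_some.mpr (Or.inl ?_)))
    rw [hx1]
    push_cast
    rfl
  rcases exists_halvable hd hx1 hsq with hx | ⟨-, hx⟩ | ⟨rfl, rfl | ⟨y₀, hy₀, hx⟩⟩
  · refine hshift _ 0 isKnown_zero ?_
    rw [add_zero]
    exact hx.exists_two_nsmul hd0 hα rfl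
  · have hx1' : (x : K) ≠ -1 := by exact_mod_cast hx1
    refine hshift _ (Point.some (-1) 0 nonsingular_neg_one_zero)
      (isKnown_some.mpr (Or.inl rfl)) ?_
    obtain ⟨y', h', e⟩ := exists_add_eq_some (h₁ := h)
      (h₂ := nonsingular_neg_one_zero (K := K)) hx1'
    rw [e]
    refine hx.exists_two_nsmul hd0 hα ?_
    have h0 : (x : K) + 1 ≠ 0 := fun e ↦ hx1' (eq_neg_of_add_eq_zero_left e)
    have he := (nonsingular_iff _ _).mp h
    push_cast
    rw [sub_zero, sub_neg_eq_add]
    field_simp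
    linear_combination (x + 1) * he
  · refine h40 _ (IsKnown.four_nsmul (isKnown_some.mpr (Or.inr ?_)))
    push_cast
    rfl
  · by_cases hx0 : x = 0
    · refine h40 _ (IsKnown.four_nsmul (isKnown_some.mpr (Or.inr ?_)))
      rw [hx0]
      push_cast
      rfl
    have hx0' : (x : K) ≠ 0 := by exact_mod_cast hx0
    have hns : (X1_15.baseChange K).toAffine.Nonsingular (x : K) (y₀ : K) := by
      rw [nonsingular_iff]
      exact_mod_cast congrArg (Rat.cast (K := K)) hy₀
    have key : ∃ R, IsSemirational α R ∧ (4 • Point.some _ _ hns = 2 • 4 • R ∨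
        4 • Point.some _ _ hns = -((2 : ℕ) • (4 : ℕ) • R)) := by
      refine hshift _ (Point.some 0 0 nonsingular_zero_zero) (isKnown_some.mpr (Or.inr rfl)) ?_
      obtain ⟨y', h', e⟩ := exists_add_eq_some (h₁ := hns)
        (h₂ := nonsingular_zero_zero (K := K)) hx0'
      rw [e]
      refine hx.exists_two_nsmul hd0 hα ?_
      push_cast
      ring
    rcases Point.X_eq_iff.mp (rfl : (x : K) = x) with e | e
    · rw [show Point.some _ _ h = Point.some _ _ hns from e]
      exact key
    · rw [show Point.some _ _ h = -Point.some _ _ hns from e]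
      obtain ⟨R, hR, hR'⟩ := key
      refine ⟨R, hR, hR'.symm.imp (fun e ↦ ?_) (fun e ↦ ?_)⟩
      · rw [smul_neg, e, neg_neg]
      · rw [smul_neg, e]

theorem IsSemirational.four_nsmul_eq_zero {K : Type*} [Field K] [NumberField K] [DecidableEq K]
    (hK : Module.finrank ℚ K ≤ 2) {d : ℤ} (hd : d = 1 ∨ d = -1 ∨ d = -3) {α : K} (hα : α ^ 2 = d)
    {P : (X1_15.baseChange K).toAffine.Point} (hP : IsSemirational α P) : 4 • P = 0 := by
  obtain ⟨v, h2, hres⟩ := NumberField.exists_valuation hK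
  refine eq_zero_of_forall_two_pow_dvd h2 hres fun n ↦ ?_
  induction n generalizing P with
  | zero => exact ⟨4 • P, by simp⟩
  | succ n ih =>
    obtain ⟨R, hR, e⟩ := hP.exists_half hd hα
    obtain ⟨Q, hQ⟩ := ih hR
    rcases e with e | e
    · exact ⟨Q, by rw [e, hQ, smul_smul, pow_succ']⟩
    · exact ⟨-Q, by rw [e, hQ, smul_smul, pow_succ', smul_neg]⟩

/-- Over `ℚ(i)` and `ℚ(√-3)` all points of `X₁(15)` are torsion points. -/
theorem isTorsionPoint {K : Type*} [Field K] [NumberField K] (hK : IsQuadraticField K) {d : ℤ}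
    (hd : d = -1 ∨ d = -3) {α : K} (hα : α ^ 2 = d)
    (P : (X1_15.baseChange K).toAffine.Point) : IsTorsionPoint P := by
  classical
  have hsq : ¬ IsSquare (d : ℚ) := by rcases hd with rfl | rfl <;> norm_num
  obtain ⟨σ, hσ⟩ := hK.exists_algHom hsq hα (β := -α) (by rw [neg_sq, hα])
  have hα0 : α ≠ 0 := by
    rintro rfl
    apply hsq
    have : ((d : ℤ) : K) = 0 := by rw [← hα]; ring
    have : d = 0 := by exact_mod_cast this
    rw [this]
    exact ⟨0, by norm_num⟩
  have hσ' : ∀ p q : ℚ, σ (p + q * α) = p - q * α := by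
    intro p q
    rw [map_add, map_mul, hσ, map_ratCast, map_ratCast]
    ring
  have hσσ : ∀ x, σ (σ x) = x := by
    intro x
    obtain ⟨p, q, rfl⟩ := hK.exists_eq_add_mul hsq hα x
    rw [hσ', map_sub, map_mul, hσ, map_ratCast, map_ratCast]
    ring
  have hfix : ∀ x, σ x = x → ∃ p : ℚ, x = p := by
    intro x hx
    obtain ⟨p, q, rfl⟩ := hK.exists_eq_add_mul hsq hα x
    rw [hσ'] at hx
    refine ⟨p, ?_⟩
    linear_combination -hx / 2
  have hanti : ∀ x, σ x = -x → ∃ p : ℚ, x = p * α := by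
    intro x hx
    obtain ⟨p, q, rfl⟩ := hK.exists_eq_add_mul hsq hα x
    rw [hσ'] at hx
    refine ⟨q, ?_⟩
    linear_combination hx / 2
  let τ : (X1_15.baseChange K).toAffine.Point →+ (X1_15.baseChange K).toAffine.Point :=
    Point.map (W' := X1_15) σ
  have hτ : ∀ x y h, ∃ h', τ (Point.some x y h) = Point.some (σ x) (σ y) h' :=
    fun x y h ↦ ⟨_, Point.map_some (W' := X1_15) σ h⟩
  have hττ : ∀ Q, τ (τ Q) = Q := by
    rintro (_ | ⟨x, y, h⟩)
    · exact (congrArg τ (_root_.map_zero τ)).trans (_root_.map_zero τ)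
    · obtain ⟨h', e⟩ := hτ x y h
      obtain ⟨h'', e'⟩ := hτ _ _ h'
      rw [e, e', Point.some.injEq]
      exact ⟨hσσ x, hσσ y⟩
  -- `P + τP` is invariant under conjugation, so it is a rational point.
  have h1 : 4 • (P + τ P) = 0 := by
    refine IsSemirational.four_nsmul_eq_zero (d := 1) (α := 1) hK.le (by norm_num) (by norm_num) ?_
    have hinv : τ (P + τ P) = P + τ P := by rw [_root_.map_add, hττ, add_comm]
    rcases hQ : P + τ P with _ | ⟨x, y, h⟩
    · exact Or.inl rfl
    · rw [hQ] at hinv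
      obtain ⟨h', e⟩ := hτ x y h
      rw [e, Point.some.injEq] at hinv
      obtain ⟨p, rfl⟩ := hfix _ hinv.1
      obtain ⟨q, rfl⟩ := hfix _ hinv.2
      exact Or.inr ⟨p, 2 * q + p + 1, q, h, rfl, by push_cast; ring⟩
  -- `P - τP` is negated by conjugation, so it comes from the twist by `d`.
  have h2 : 4 • (P - τ P) = 0 := by
    refine IsSemirational.four_nsmul_eq_zero (d := d) (α := α) hK.le (Or.inr hd) hα ?_
    have hinv : τ (P - τ P) = -(P - τ P) := by rw [_root_.map_sub, hττ, neg_sub]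
    rcases hQ : P - τ P with _ | ⟨x, y, h⟩
    · exact Or.inl rfl
    · rw [hQ] at hinv
      obtain ⟨h', e⟩ := hτ x y h
      obtain ⟨h'', e'⟩ := neg_some h
      rw [e, e', Point.some.injEq] at hinv
      obtain ⟨p, rfl⟩ := hfix _ hinv.1
      obtain ⟨q, hq⟩ := hanti (2 * y + p + 1) (by
        rw [map_add, map_add, map_mul, hinv.2, map_ratCast, map_one, map_ofNat]
        ring)
      exact Or.inr ⟨p, q, y, h, rfl, hq⟩
  have h8 : 8 • P = 0 := by
    have : 8 • P = 4 • (P + τ P) + 4 • (P - τ P) := by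
      rw [← nsmul_add, add_add_sub_cancel, ← two_nsmul, smul_smul]
      rfl
    rw [this, h1, h2, add_zero]
  have : IsOfFinAddOrder P := isOfFinAddOrder_iff_nsmul_eq_zero.mpr ⟨8, by norm_num, h8⟩
  unfold IsTorsionPoint
  convert this

/-- Over `ℚ(i)` and `ℚ(√-3)` there are only cusps on `X₁(15)`. -/
theorem eq_or_eq_of_sq_eq {K : Type*} [Field K] [NumberField K] (hK : IsQuadraticField K) {d : ℤ}
    (hd : d = -1 ∨ d = -3) {α : K} (hα : α ^ 2 = d) {x y : K}
    (he : y ^ 2 + x * y + y = x ^ 3 + x ^ 2) :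
    x = -1 ∧ y = 0 ∨ x = 0 ∧ y = 0 ∨ x = 0 ∧ y = -1 ∨ x ^ 2 + x + 1 = 0 := by
  have h := (nonsingular_iff x y).mpr he
  have hP := isTorsionPoint hK hd hα (Point.some x y h)
  by_cases hk : IsKnown (Point.some x y h)
  · have := hk.eq
    tauto
  · refine Or.inr (Or.inr (Or.inr ?_))
    rcases hd with rfl | rfl
    · have hno : ∀ e : ℤ, ¬ IsSquare (e : ℚ) → ¬ IsSquare ((-1 * e : ℤ) : ℚ) → ∀ β : K, β ^ 2 ≠ e :=
        fun e he he' ↦ hK.not_isSquare_of_sq_eq (by norm_num) he he' hα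
      rcases exists_sq_eq_of_not_isKnown hK hP hk with ⟨β, hβ⟩ | ⟨β, hβ⟩ | ⟨β, hβ⟩
      · exact absurd hβ (hno _ (by norm_num) (by norm_num) β)
      · exact absurd hβ (hno _ (by norm_num) (by norm_num) β)
      · exact absurd hβ (hno _ (by norm_num) (by norm_num) β)
    · exact sq_add_add_one_eq_zero hK hα hP hk

end Descent

end X1_15

/-! ### Addition with a given slope, and changes of variables. -/

namespace WeierstrassCurve.Affine.Point

variable {F : Type*} [Field F] [DecidableEq F] {W : Affine F}

theorem add_eq_some_of_slope {x₁ y₁ x₂ y₂ ℓ x₃ y₃ : F} {h₁ : W.Nonsingular x₁ y₁}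
    {h₂ : W.Nonsingular x₂ y₂} (hx : x₁ ≠ x₂) (hℓ : ℓ * (x₁ - x₂) = y₁ - y₂)
    (hx₃ : x₃ = ℓ ^ 2 + W.a₁ * ℓ - W.a₂ - x₁ - x₂)
    (hy₃ : y₃ = -(ℓ * (x₃ - x₁) + y₁) - W.a₁ * x₃ - W.a₃) :
    ∃ h, some x₁ y₁ h₁ + some x₂ y₂ h₂ = some x₃ y₃ h := by
  have e : W.slope x₁ x₂ y₁ y₂ = ℓ := by
    rw [slope_of_X_ne hx, div_eq_iff (sub_ne_zero.mpr hx), hℓ]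
  have h := nonsingular_add h₁ h₂ fun hxy ↦ hx hxy.left
  have ex : W.addX x₁ x₂ (W.slope x₁ x₂ y₁ y₂) = x₃ := by rw [e, hx₃, addX]
  have ey : W.addY x₁ x₂ y₁ (W.slope x₁ x₂ y₁ y₂) = y₃ := by
    rw [addY, negAddY, negY, ex, e, hy₃]
  rw [add_of_X_ne hx]
  rw [ex, ey] at h
  exact ⟨h, by rw [some.injEq]; exact ⟨ex, ey⟩⟩

theorem add_self_eq_some_of_slope {x y ℓ x₃ y₃ : F} {h : W.Nonsingular x y}
    (hne : 2 * y + W.a₁ * x + W.a₃ ≠ 0)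
    (hℓ : ℓ * (2 * y + W.a₁ * x + W.a₃) = 3 * x ^ 2 + 2 * W.a₂ * x + W.a₄ - W.a₁ * y)
    (hx₃ : x₃ = ℓ ^ 2 + W.a₁ * ℓ - W.a₂ - x - x)
    (hy₃ : y₃ = -(ℓ * (x₃ - x) + y) - W.a₁ * x₃ - W.a₃) :
    ∃ h', some x y h + some x y h = some x₃ y₃ h' := by
  have hy : y ≠ W.negY x y := by
    intro h1
    apply hne
    rw [Affine.negY] at h1
    linear_combination h1
  have hy' : y - W.negY x y = 2 * y + W.a₁ * x + W.a₃ := by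
    rw [Affine.negY]
    ring
  have e : W.slope x x y y = ℓ := by
    rw [slope_of_Y_ne rfl hy, hy', div_eq_iff hne, hℓ]
  have h' := nonsingular_add h h fun hxy ↦ hy hxy.right
  have ex : W.addX x x (W.slope x x y y) = x₃ := by rw [e, hx₃, addX]
  have ey : W.addY x x y (W.slope x x y y) = y₃ := by
    rw [addY, negAddY, negY, ex, e, hy₃]
  rw [add_self_of_Y_ne hy]
  rw [ex, ey] at h'
  exact ⟨h', by rw [some.injEq]; exact ⟨ex, ey⟩⟩

end Point

/-- The substitution `(x, y) ↦ (u²x + r, u³y + u²sx + t)` maps `W'` to `W`. -/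
structure IsVariableChange {F : Type*} [Field F] (W W' : Affine F) (u r s t : F) : Prop where
  ne_zero : u ≠ 0
  a₁ : u * W'.a₁ = W.a₁ + 2 * s
  a₂ : u ^ 2 * W'.a₂ = W.a₂ - s * W.a₁ + 3 * r - s ^ 2
  a₃ : u ^ 3 * W'.a₃ = W.a₃ + r * W.a₁ + 2 * t
  a₄ : u ^ 4 * W'.a₄ =
    W.a₄ - s * W.a₃ + 2 * r * W.a₂ - (t + r * s) * W.a₁ + 3 * r ^ 2 - 2 * s * t
  a₆ : u ^ 6 * W'.a₆ = W.a₆ + r * W.a₄ + r ^ 2 * W.a₂ + r ^ 3 - t * W.a₃ - t ^ 2 - r * t * W.a₁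

namespace IsVariableChange

variable {F : Type*} [Field F] {W W' : Affine F} {u r s t : F}

theorem equation (H : IsVariableChange W W' u r s t) {x y : F} (h : W'.Equation x y) :
    W.Equation (u ^ 2 * x + r) (u ^ 3 * y + u ^ 2 * s * x + t) := by
  rw [equation_iff] at h ⊢
  linear_combination u ^ 6 * h - u ^ 5 * x * y * H.a₁ + u ^ 4 * x ^ 2 * H.a₂ - u ^ 3 * y * H.a₃ +
    u ^ 2 * x * H.a₄ + H.a₆

theorem negY (H : IsVariableChange W W' u r s t) (x y : F) :
    W.negY (u ^ 2 * x + r) (u ^ 3 * y + u ^ 2 * s * x + t) =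
      u ^ 3 * W'.negY x y + u ^ 2 * s * x + t := by
  rw [Affine.negY, Affine.negY]
  linear_combination u ^ 2 * x * H.a₁ + H.a₃

theorem slope [DecidableEq F] (H : IsVariableChange W W' u r s t) {x₁ y₁ x₂ y₂ : F}
    (h₁ : W'.Equation x₁ y₁) (h₂ : W'.Equation x₂ y₂) (hxy : ¬ (x₁ = x₂ ∧ y₁ = W'.negY x₂ y₂)) :
    W.slope (u ^ 2 * x₁ + r) (u ^ 2 * x₂ + r) (u ^ 3 * y₁ + u ^ 2 * s * x₁ + t)
      (u ^ 3 * y₂ + u ^ 2 * s * x₂ + t) = u * W'.slope x₁ x₂ y₁ y₂ + s := by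
  have hu := H.ne_zero
  by_cases hx : x₁ = x₂
  · subst hx
    have hy : y₁ ≠ W'.negY x₁ y₂ := fun e ↦ hxy ⟨rfl, e⟩
    obtain rfl := Y_eq_of_Y_ne h₁ h₂ rfl hy
    have hy' : u ^ 3 * y₁ + u ^ 2 * s * x₁ + t ≠
        W.negY (u ^ 2 * x₁ + r) (u ^ 3 * y₁ + u ^ 2 * s * x₁ + t) := by
      rw [H.negY]
      intro e
      apply hy
      apply mul_left_cancel₀ (pow_ne_zero 3 hu)
      linear_combination e
    rw [slope_of_Y_ne rfl hy', div_eq_iff (sub_ne_zero.mpr hy'), H.negY]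
    obtain ⟨ℓ, hℓ⟩ : ∃ ℓ, ℓ = W'.slope x₁ x₁ y₁ y₁ := ⟨_, rfl⟩
    rw [← hℓ]
    rw [slope_of_Y_ne rfl hy, eq_div_iff (sub_ne_zero.mpr hy)] at hℓ
    rw [Affine.negY] at hℓ ⊢
    linear_combination -u ^ 4 * hℓ - 2 * u ^ 2 * x₁ * H.a₂ - H.a₄ +
      (u ^ 3 * y₁ - s * u ^ 2 * x₁) * H.a₁ - s * H.a₃
  · have hx' : u ^ 2 * x₁ + r ≠ u ^ 2 * x₂ + r := by
      intro e
      exact hx (mul_left_cancel₀ (pow_ne_zero 2 hu) (add_right_cancel e))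
    rw [slope_of_X_ne hx', slope_of_X_ne hx]
    have h0 := sub_ne_zero.mpr hx
    have h0' := sub_ne_zero.mpr hx'
    rw [div_eq_iff h0']
    field_simp
    ring

/-- The homomorphism on points induced by a change of variables. -/
noncomputable def pointHom [DecidableEq F] (H : IsVariableChange W W' u r s t) [W.IsElliptic] :
    W'.Point →+ W.Point where
  toFun P := match P with
    | .zero => 0
    | .some _ _ h => .some _ _ (equation_iff_nonsingular.mp (H.equation h.1))
  map_zero' := rfl
  map_add' := by
    rintro (_ | ⟨x₁, y₁, h₁⟩) (_ | ⟨x₂, y₂, h₂⟩)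
    · rfl
    · rfl
    · rfl
    have hu := H.ne_zero
    by_cases hxy : x₁ = x₂ ∧ y₁ = W'.negY x₂ y₂
    · rw [Point.add_of_Y_eq hxy.1 hxy.2]
      refine (Point.add_of_Y_eq (by rw [hxy.1]) ?_).symm
      rw [H.negY, hxy.1, hxy.2]
    · have hxy' : ¬ (u ^ 2 * x₁ + r = u ^ 2 * x₂ + r ∧ u ^ 3 * y₁ + u ^ 2 * s * x₁ + t =
          W.negY (u ^ 2 * x₂ + r) (u ^ 3 * y₂ + u ^ 2 * s * x₂ + t)) := by
        rintro ⟨ex, ey⟩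
        have hx := mul_left_cancel₀ (pow_ne_zero 2 hu) (add_right_cancel ex)
        refine hxy ⟨hx, mul_left_cancel₀ (pow_ne_zero 3 hu) ?_⟩
        rw [H.negY, hx] at ey
        linear_combination ey
      rw [Point.add_some hxy]
      refine Eq.trans ?_ (Point.add_some hxy').symm
      rw [Point.some.injEq, H.slope h₁.1 h₂.1 hxy]
      generalize W'.slope x₁ x₂ y₁ y₂ = ℓ
      have ex : u ^ 2 * W'.addX x₁ x₂ ℓ + r =
          W.addX (u ^ 2 * x₁ + r) (u ^ 2 * x₂ + r) (u * ℓ + s) := by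
        simp only [addX]
        linear_combination u * ℓ * H.a₁ - H.a₂
      refine ⟨ex, ?_⟩
      simp only [addY, negAddY, Affine.negY, ← ex]
      linear_combination -u ^ 2 * W'.addX x₁ x₂ ℓ * H.a₁ - H.a₃

theorem pointHom_some [DecidableEq F] (H : IsVariableChange W W' u r s t) [W.IsElliptic] {x y : F}
    (h : W'.Nonsingular x y) : ∃ h', H.pointHom (Point.some x y h) =
      Point.some (u ^ 2 * x + r) (u ^ 3 * y + u ^ 2 * s * x + t) h' :=
  ⟨_, rfl⟩

theorem pointHom_injective [DecidableEq F] (H : IsVariableChange W W' u r s t) [W.IsElliptic] :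
    Function.Injective H.pointHom := by
  rw [injective_iff_map_eq_zero]
  rintro (_ | ⟨x, y, h⟩) e
  · rfl
  · exact absurd e (Point.some_ne_zero _)

end IsVariableChange

end WeierstrassCurve.Affine

/-! ### From a point of order 15 to a point of `X1_15`. -/

section TateNormalForm

variable {K : Type*} [Field K] [DecidableEq K]

theorem nsmul_ne_zero_of_addOrderOf_eq {G : Type*} [AddMonoid G] {P : G} {n : ℕ}
    (hP : addOrderOf P = n) {m : ℕ} (h0 : 0 < m) (hm : m < n) : m • P ≠ 0 := by
  intro h
  exact absurd (Nat.le_of_dvd h0 (hP ▸ addOrderOf_dvd_iff_nsmul_eq_zero.mpr h)) (not_le.mpr hm)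

/-- Two multiples of a point of large order have the same abscissa only if they are equal up to
sign. -/
theorem ne_of_nsmul_eq_some {W : Affine K} {P : W.Point} {n : ℕ} (hP : addOrderOf P = n)
    {k l : ℕ} (hkl : k < l) (hln : k + l < n) {x₁ y₁ x₂ y₂ : K} {h₁ : W.Nonsingular x₁ y₁}
    {h₂ : W.Nonsingular x₂ y₂} (e₁ : k • P = Point.some x₁ y₁ h₁)
    (e₂ : l • P = Point.some x₂ y₂ h₂) : x₁ ≠ x₂ := by
  intro hx
  rcases Point.X_eq_iff.mp hx with e | e
  · rw [← e₁, ← e₂] at e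
    refine nsmul_ne_zero_of_addOrderOf_eq hP (m := l - k) (by omega) (by omega) ?_
    have : l • P = (l - k) • P + k • P := by rw [← add_nsmul, Nat.sub_add_cancel hkl.le]
    rw [this] at e
    exact left_eq_add.mp (by rw [add_comm] at e; exact e)
  · rw [← e₁, ← e₂, eq_neg_iff_add_eq_zero, ← add_nsmul] at e
    exact nsmul_ne_zero_of_addOrderOf_eq hP (by omega) hln e

/-- Move `P` to the origin and make its tangent horizontal, which removes `a₄` and `a₆`. Then scale
by `A₃ / A₂` to make `a₂` and `a₃` equal. -/
theorem exists_tateCurve {W : Affine K} [W.IsElliptic] {P : W.Point} {n : ℕ}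
    (hP : addOrderOf P = n) (hn : 3 < n) :
    ∃ (b c : K) (h : (tateCurve b c).toAffine.Nonsingular 0 0), b ≠ 0 ∧
      addOrderOf (Point.some 0 0 h) = n := by
  have h1 : 1 • P = P := one_nsmul P
  have h2 : 2 • P = P + P := two_nsmul P
  rcases P with _ | ⟨x, y, h⟩
  · exact absurd (nsmul_zero 1) (nsmul_ne_zero_of_addOrderOf_eq hP (m := 1) (by omega) (by omega))
  obtain ⟨A₃, hA₃⟩ : ∃ A₃, A₃ = 2 * y + W.a₁ * x + W.a₃ := ⟨_, rfl⟩
  have hA₃0 : A₃ ≠ 0 := by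
    intro h0
    have := (Point.add_self_eq_zero_iff h).mpr (hA₃ ▸ h0)
    rw [← h2] at this
    exact nsmul_ne_zero_of_addOrderOf_eq hP (m := 2) (by omega) (by omega) this
  obtain ⟨ℓ, hℓ⟩ : ∃ ℓ, ℓ * A₃ = 3 * x ^ 2 + 2 * W.a₂ * x + W.a₄ - W.a₁ * y :=
    ⟨_, div_mul_cancel₀ _ hA₃0⟩
  obtain ⟨A₂, hA₂⟩ : ∃ A₂, A₂ = W.a₂ - ℓ * W.a₁ + 3 * x - ℓ ^ 2 := ⟨_, rfl⟩
  -- `A₂` is `x(P) - x(2P)`, which is nonzero because `P` is not killed by 3.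
  have hA₂0 : A₂ ≠ 0 := by
    intro h0
    obtain ⟨h', e⟩ := Point.add_self_eq_some_of_slope (h := h) (hA₃ ▸ hA₃0) (hA₃ ▸ hℓ) rfl rfl
    rw [← h2] at e
    refine ne_of_nsmul_eq_some hP (k := 1) (l := 2) (by omega) (by omega) h1 e ?_
    linear_combination h0 - hA₂
  have heq := (W.equation_iff x y).mp h.1
  have H : IsVariableChange W (tateCurve (-A₂ ^ 3 / A₃ ^ 2) (1 - (W.a₁ + 2 * ℓ) * A₂ / A₃))
      (A₃ / A₂) x ℓ y := by
    refine ⟨div_ne_zero hA₃0 hA₂0, ?_, ?_, ?_, ?_, ?_⟩ <;> simp only [tateCurve]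
    · field_simp
      ring
    · field_simp
      linear_combination hA₂
    · field_simp
      linear_combination hA₃
    · linear_combination hℓ - ℓ * hA₃
    · linear_combination heq
  have hb : -A₂ ^ 3 / A₃ ^ 2 ≠ 0 := div_ne_zero (neg_ne_zero.mpr (pow_ne_zero 3 hA₂0))
    (pow_ne_zero 2 hA₃0)
  have hns : (tateCurve (-A₂ ^ 3 / A₃ ^ 2) (1 - (W.a₁ + 2 * ℓ) * A₂ / A₃)).toAffine.Nonsingular
      0 0 := by
    rw [nonsingular_zero]
    exact ⟨rfl, Or.inl (neg_ne_zero.mpr hb)⟩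
  refine ⟨_, _, hns, hb, ?_⟩
  rw [← hP, ← addOrderOf_injective H.pointHom H.pointHom_injective]
  obtain ⟨h', e⟩ := H.pointHom_some hns
  rw [e]
  congr 1
  rw [Point.some.injEq]
  constructor <;> ring

/-- The equation of `X₁(15)` in the parameters `r = b / c` and `s = c² / (b - c)`. -/
theorem exists_parameters_of_order_fifteen {b c : K}
    {h : (tateCurve b c).toAffine.Nonsingular 0 0} (hb : b ≠ 0)
    (hP : addOrderOf (Point.some 0 0 h) = 15) :
    ∃ r s : K, r ≠ 1 ∧ s ≠ 0 ∧ s ≠ 1 ∧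
      -r ^ 3 + r ^ 2 * s ^ 5 - 7 * r ^ 2 * s ^ 4 + 18 * r ^ 2 * s ^ 3 - 19 * r ^ 2 * s ^ 2 +
        10 * r ^ 2 * s + r * s ^ 5 - 4 * r * s ^ 4 + 5 * r * s ^ 2 - 5 * r * s + s ^ 5 - s ^ 4 +
        s ^ 3 - s ^ 2 + s = 0 := by
  have h1 : 1 • Point.some 0 0 h = Point.some 0 0 h := one_nsmul _
  -- The abscissae of `2P`, `3P`, `4P`, `5P` are `b`, `c`, `r(r - 1)`, `rs(s - 1)`. Each differs
  -- from that of `P`, and this makes the next parameter available.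
  obtain ⟨h2', h2⟩ := Point.add_self_eq_some_of_slope (h := h) (ℓ := 0) (x₃ := b) (y₃ := b * c)
    (by simpa [tateCurve] using hb) (by simp [tateCurve]) (by simp [tateCurve])
    (by simp only [tateCurve]; ring)
  rw [← two_nsmul] at h2
  have h12 := ne_of_nsmul_eq_some hP (by norm_num) (by norm_num) h1 h2
  obtain ⟨h3', h3⟩ := Point.add_eq_some_of_slope (h₁ := h) (h₂ := h2') (ℓ := c) (x₃ := c)
    (y₃ := b - c) h12 (by ring) (by simp only [tateCurve]; ring) (by simp only [tateCurve]; ring)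
  rw [← h2, ← succ_nsmul'] at h3
  have hc : c ≠ 0 := (ne_of_nsmul_eq_some hP (by norm_num) (by norm_num) h1 h3).symm
  obtain ⟨r, rfl⟩ : ∃ r, b = r * c := ⟨b / c, (div_mul_cancel₀ b hc).symm⟩
  have hr : r ≠ 0 := left_ne_zero_of_mul hb
  obtain ⟨h4', h4⟩ := Point.add_eq_some_of_slope (h₁ := h) (h₂ := h3') (ℓ := r - 1)
    (x₃ := r * (r - 1)) (y₃ := r ^ 2 * (c - r + 1)) hc.symm (by ring)
    (by simp only [tateCurve]; ring) (by simp only [tateCurve]; ring)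
  rw [← h3, ← succ_nsmul'] at h4
  have h14 := ne_of_nsmul_eq_some hP (by norm_num) (by norm_num) h1 h4
  have hr1 : r - 1 ≠ 0 := (mul_ne_zero_iff.mp h14.symm).2
  obtain ⟨s, rfl⟩ : ∃ s, c = s * (r - 1) := ⟨c / (r - 1), (div_mul_cancel₀ c hr1).symm⟩
  have hs : s ≠ 0 := left_ne_zero_of_mul hc
  obtain ⟨h5', h5⟩ := Point.add_eq_some_of_slope (h₁ := h) (h₂ := h4') (ℓ := r * (s - 1))
    (x₃ := r * s * (s - 1))
    (y₃ := -(r * (s - 1) * (r * s * (s - 1))) - (1 - s * (r - 1)) * (r * s * (s - 1)) +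
      r * (s * (r - 1)))
    h14 (by ring) (by simp only [tateCurve]; ring) (by simp only [tateCurve]; ring)
  rw [← h4, ← succ_nsmul'] at h5
  have h15 := ne_of_nsmul_eq_some hP (by norm_num) (by norm_num) h1 h5
  have hs1 : s - 1 ≠ 0 := (mul_ne_zero_iff.mp h15.symm).2
  refine ⟨r, s, sub_ne_zero.mp hr1, hs, sub_ne_zero.mp hs1, ?_⟩
  -- `5P` has order 3, so the abscissa `rs(s - 1)` is a root of the 3-division polynomial. The
  -- factor `r³s³` is removed afterwards.
  have h10 : Point.some _ _ h5' + Point.some _ _ h5' = -Point.some _ _ h5' := by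
    rw [eq_neg_iff_add_eq_zero, ← h5, ← add_nsmul, ← add_nsmul,
      ← addOrderOf_dvd_iff_nsmul_eq_zero, hP]
  rw [Point.neg_some] at h10
  obtain ⟨-, e₁, e₂⟩ := Point.add_self_eq_some h10
  rw [e₂] at e₁
  simp only [tateCurve, b₂, b₄, b₆, b₈] at e₁
  have h0 : r ^ 3 * s ^ 3 ≠ 0 := mul_ne_zero (pow_ne_zero 3 hr) (pow_ne_zero 3 hs)
  apply (mul_eq_zero.mp (_ : r ^ 3 * s ^ 3 * _ = 0)).resolve_left h0
  linear_combination e₁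

/-- The cofactor identities that express the point on `X₁(15)` by the parameters. -/
theorem exists_equation_of_parameters {K : Type*} [Field K] {r s : K} (hr1 : r ≠ 1) (hs : s ≠ 0) (hs1 : s ≠ 1)
    (hF : -r ^ 3 + r ^ 2 * s ^ 5 - 7 * r ^ 2 * s ^ 4 + 18 * r ^ 2 * s ^ 3 - 19 * r ^ 2 * s ^ 2 +
      10 * r ^ 2 * s + r * s ^ 5 - 4 * r * s ^ 4 + 5 * r * s ^ 2 - 5 * r * s + s ^ 5 - s ^ 4 +
      s ^ 3 - s ^ 2 + s = 0) :
    ∃ x y : K, y ^ 2 + x * y + y = x ^ 3 + x ^ 2 ∧ x + y ≠ 0 ∧ x + y ≠ -1 ∧ x ^ 2 + x + 1 ≠ 0 := by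
  -- The point is `x = -A / (sB)`, `y = -1/s - x`, so that `s = -1 / (x + y)`. With this, `h3`
  -- becomes the equation of `X1_15`, and `h2` a relation linear in `r` that excludes `x² + x + 1 =
  -- 0`.
  obtain ⟨A, hA⟩ : ∃ A, A = r ^ 2 * s ^ 3 - 4 * r ^ 2 * s ^ 2 + 5 * r ^ 2 * s - r ^ 2 - 2 * r * s +
    s ^ 3 - s ^ 2 + s := ⟨_, rfl⟩
  obtain ⟨B, hB⟩ : ∃ B, B = r ^ 2 * s ^ 3 - 5 * r ^ 2 * s ^ 2 + 8 * r ^ 2 * s - 3 * r ^ 2 +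
    r * s ^ 3 - 3 * r * s ^ 2 - r * s + r + s ^ 3 := ⟨_, rfl⟩
  have h3 : -A ^ 3 + s * A ^ 2 * B - s * (s - 1) * A * B ^ 2 + s * (s - 1) * B ^ 3 = 0 := by
    rw [hA, hB]
    linear_combination (r ^ 3 * s ^ 6 - 8 * r ^ 3 * s ^ 5 + 24 * r ^ 3 * s ^ 4 - 32 * r ^ 3 * s ^ 3 + 16 * r ^ 3 * s ^ 2 - r ^ 3 +
      r ^ 2 * s ^ 6 - 4 * r ^ 2 * s ^ 5 - r ^ 2 * s ^ 4 + 20 * r ^ 2 * s ^ 3 - 20 * r ^ 2 * s ^ 2 + 4 * r ^ 2 * s + r * s ^ 6 - 2 * r * s ^ 5 -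
      3 * r * s ^ 4 + 2 * r * s ^ 3 + 2 * r * s ^ 2 + 2 * s ^ 5 - 3 * s ^ 4 + 2 * s ^ 3 - s ^ 2) * hF
  have h2 : (r - s) * A ^ 2 - s * (3 * r - 1 - s - r * s) * A * B +
      s * (2 * r - 1 - r * s) * B ^ 2 = 0 := by
    rw [hA, hB]
    linear_combination (s - 1) * (r - s) ^ 2 * hF
  have hs1' : s - 1 ≠ 0 := sub_ne_zero.mpr hs1
  have hB0 : B ≠ 0 := by
    intro hB0
    have hA0 : A = 0 := by
      rw [hB0] at h3
      exact pow_eq_zero_iff three_ne_zero |>.mp (by linear_combination -h3)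
    rw [hB0] at hB
    rw [hA0] at hA
    -- This product is `B - A`. Each factor containing `r` determines `r` in terms of `s`, and
    -- substitution leaves a power of `s - 1`, in one case times `s`.
    have hD : (s - 1) * ((r - s) * ((r - 1) * (s - 1) - (r - 1) + (s - 1))) = 0 := by
      linear_combination hB - hA
    rcases mul_eq_zero.mp ((mul_eq_zero.mp hD).resolve_left hs1') with e | e
    · obtain rfl : r = s := sub_eq_zero.mp e
      refine mul_ne_zero hs (pow_ne_zero 4 hs1') ?_
      linear_combination -hB
    · refine pow_ne_zero 5 hs1' ?_
      linear_combination -(2 - s) ^ 2 * hA +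
        (((s - 1) ^ 3 - (s - 1) ^ 2 + 1) * (s - 1 + (r - 1) * (2 - s)) +
          2 * ((s - 1) ^ 3 - (s - 1) ^ 2 - (s - 1)) * (2 - s)) * e
  have hx0 : s * B ≠ 0 := mul_ne_zero hs hB0
  obtain ⟨x, hx⟩ : ∃ x, A = -x * (s * B) := ⟨-(A / (s * B)), by field_simp⟩
  obtain ⟨y, hy⟩ : ∃ y, s * (x + y) = -1 := ⟨-1 / s - x, by field_simp; ring⟩
  rw [hx] at h2 h3
  have h3' : s ^ 2 * x ^ 3 + s ^ 2 * x ^ 2 + s * (s - 1) * x + (s - 1) = 0 := by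
    apply mul_left_cancel₀ (mul_ne_zero hs (pow_ne_zero 3 hB0))
    linear_combination h3
  have h2' : s * (r - s) * x ^ 2 + s * (3 * r - 1 - s - r * s) * x + (2 * r - 1 - r * s) = 0 := by
    apply mul_left_cancel₀ (mul_ne_zero hs (pow_ne_zero 2 hB0))
    linear_combination h2
  have heq : y ^ 2 + x * y + y = x ^ 3 + x ^ 2 := by
    apply mul_left_cancel₀ (pow_ne_zero 2 hs)
    linear_combination (s * y + s - 1) * hy - h3'
  refine ⟨x, y, heq, ?_, ?_, ?_⟩
  · intro e
    rw [e, mul_zero] at hy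
    exact one_ne_zero (neg_eq_zero.mp hy.symm)
  · intro e
    rw [e] at hy
    exact hs1 (by linear_combination -hy)
  · intro e
    have hxy : (y + x) * (y + 1) = 0 := by linear_combination heq + x * e
    rcases mul_eq_zero.mp hxy with e' | e'
    · rw [add_comm, e', mul_zero] at hy
      exact one_ne_zero (neg_eq_zero.mp hy.symm)
    · obtain rfl : y = -1 := eq_neg_of_add_eq_zero_left e'
      have hx00 : x ≠ 0 := by
        rintro rfl
        norm_num at e
      have hS : s * (1 - x) - 1 = 0 := by linear_combination -hy
      have : x * (r - 1) = 0 := by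
        linear_combination -(1 - x) ^ 2 * h2' - (r * (x - 1) + 1) * e +
          (-(s * (1 - x) + 1) * x ^ 2 + r * (1 - x) * x ^ 2 + (3 * r - 1) * (1 - x) * x -
            (s * (1 - x) + 1) * (1 + r) * x - r * (1 - x)) * hS
      exact hr1 (sub_eq_zero.mp ((mul_eq_zero.mp this).resolve_left hx00))

/-- Over `ℚ(i)` and `ℚ(√-3)` there is no elliptic curve with torsion group `ℤ/15ℤ`. -/
theorem not_torsionAppears_fifteen {K : Type*} [Field K] [NumberField K] (hK : IsQuadraticField K)
    {d : ℤ} (hd : d = -1 ∨ d = -3) {α : K} (hα : α ^ 2 = d) : ¬ TorsionAppears K 15 := by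
  classical
  rintro ⟨E, hE, ⟨e⟩⟩
  have hP : addOrderOf ((e.symm 1 : AddCommGroup.torsion _) : E.toAffine.Point) = 15 := by
    rw [AddSubgroup.addOrderOf_coe, AddEquiv.addOrderOf_eq, ZMod.addOrderOf_one]
  obtain ⟨b, c, h, hb, ho⟩ := exists_tateCurve (W := E.toAffine) (by convert hP) (by norm_num)
  obtain ⟨r, s, hr, hs, hs1, hF⟩ := exists_parameters_of_order_fifteen hb ho
  obtain ⟨x, y, heq, h1, h2, h3⟩ := exists_equation_of_parameters hr hs hs1 hF
  rcases X1_15.eq_or_eq_of_sq_eq hK hd hα heq with ⟨rfl, rfl⟩ | ⟨rfl, rfl⟩ | ⟨rfl, rfl⟩ | h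
  · exact h2 (by ring)
  · exact h1 (by ring)
  · exact h2 (by ring)
  · exact h3 h

end TateNormalForm

/-! ### Torsion injects under reduction at an unramified place. -/

theorem Valuation.integer.exists_mul_eq_one {K Γ : Type*} [Field K]
    [LinearOrderedCommGroupWithZero Γ] {v : Valuation K Γ} {z : v.integer} (hz : v z < 1)
    (k : v.integer) : ∃ u : v.integer, (u : K) * (1 + z * k) = 1 := by
  have hzk : v (z * k) < 1 := by
    rw [map_mul]
    exact mul_lt_one_of_nonneg_of_lt_one_left zero_le hz k.2
  have h1 : v (1 + z * k : K) = 1 := v.map_one_add_of_lt hzk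
  have h0 : (1 + z * k : K) ≠ 0 := by
    intro h
    rw [h, map_zero] at h1
    exact zero_ne_one h1
  refine ⟨⟨(1 + z * k : K)⁻¹, ?_⟩, inv_mul_cancel₀ h0⟩
  rw [Valuation.mem_integer_iff, map_inv₀, h1, inv_one]

/-- The curve `y² = x³ + ax + b`. -/
def shortWeierstrass {K : Type*} [Field K] (a b : K) : WeierstrassCurve K := ⟨0, 0, 0, a, b⟩

namespace shortWeierstrass

variable {K Γ : Type*} [Field K] [LinearOrderedCommGroupWithZero Γ]
  {v : Valuation K Γ} {a b : v.integer}

theorem equation {K : Type*} [Field K] {a b x y : K}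
    (h : (shortWeierstrass a b).toAffine.Nonsingular x y) : y ^ 2 = x ^ 3 + a * x + b := by
  have := ((shortWeierstrass a b).toAffine.equation_iff x y).mp h.1
  simp only [shortWeierstrass] at this
  linear_combination this

theorem coe_two : ((2 : v.integer) : K) = 2 := rfl

theorem coe_four : ((4 : v.integer) : K) = 4 := rfl

variable [DecidableEq K]

/-- In terms of `1/x` the duplication formula is 4 times a quotient of units congruent to 1. Working
with `1/x` alone avoids the formal group and its parameter. -/
theorem inv_of_add_self {x y x' y' : K}
    {h : (shortWeierstrass (a : K) b).toAffine.Nonsingular x y}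
    {h' : (shortWeierstrass (a : K) b).toAffine.Nonsingular x' y'}
    (e : Point.some x y h + Point.some x y h = Point.some x' y' h') {z m : v.integer}
    (hz : v z < 1) (hx0 : x ≠ 0) (hx : x⁻¹ = z * m) :
    x' ≠ 0 ∧ ∃ g : v.integer, x'⁻¹ = 4 * (z * m) + z ^ 3 * g := by
  obtain ⟨-, e₁, e₂⟩ := Point.add_self_eq_some e
  rw [e₂] at e₁
  simp only [shortWeierstrass, b₂, b₄, b₆, b₈] at e₁
  have hxz : x * (z * m) = 1 := by rw [← hx, mul_inv_cancel₀ hx0]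
  obtain ⟨u, hu⟩ := Valuation.integer.exists_mul_eq_one hz
    (-(2 * a * z * m ^ 2) - 2 * 4 * b * z ^ 2 * m ^ 3 + a ^ 2 * z ^ 3 * m ^ 4)
  push_cast [coe_two, coe_four] at hu
  replace e₁ : x' * (4 * (x ^ 3 + a * x + b)) = x ^ 4 - 2 * a * x ^ 2 - 8 * b * x + a ^ 2 := by
    linear_combination e₁
  have hz0 : (z * m : K) ≠ 0 := right_ne_zero_of_mul (hxz ▸ one_ne_zero)
  obtain rfl : x = (z * m : K)⁻¹ := eq_inv_of_mul_eq_one_left hxz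
  have hx' : x' * (4 * (z * m) * (1 + a * (z * m) ^ 2 + b * (z * m) ^ 3) * u) = 1 := by
    have hz0' := left_ne_zero_of_mul hz0
    have hm0 := right_ne_zero_of_mul hz0
    field_simp at e₁
    linear_combination u * e₁ + hu
  have hx'0 : x' ≠ 0 := left_ne_zero_of_mul (hx' ▸ one_ne_zero)
  refine ⟨hx'0, u * (4 * m ^ 3 * ((4 - 1) * a + (4 + 4 + 1) * b * z * m - a ^ 2 * z ^ 2 * m ^ 2)), ?_⟩
  rw [inv_eq_of_mul_eq_one_right hx']
  push_cast [coe_two, coe_four]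
  linear_combination 4 * z * m * hu

/-- In the product of the two abscissae the ordinates enter only through `y₁²` and `y₂²`, which the
curve equation eliminates. -/
theorem abscissa_mul_abscissa {K : Type*} [Field K] [DecidableEq K] {a b x₁ y₁ x₂ y₂ x₃ y₃ x y : K}
    {h₁ : (shortWeierstrass a b).toAffine.Nonsingular x₁ y₁}
    {h₂ : (shortWeierstrass a b).toAffine.Nonsingular x₂ y₂}
    {h₃ : (shortWeierstrass a b).toAffine.Nonsingular x₃ y₃}
    {h : (shortWeierstrass a b).toAffine.Nonsingular x y}
    (e₃ : Point.some x₁ y₁ h₁ + Point.some x₂ y₂ h₂ = Point.some x₃ y₃ h₃)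
    (e : Point.some x₁ y₁ h₁ - Point.some x₂ y₂ h₂ = Point.some x y h) (hne : x₁ ≠ x₂) :
    x₃ * x * (x₁ - x₂) ^ 2 = (x₁ * x₂ - a) ^ 2 - 4 * b * (x₁ + x₂) := by
  have hδ : x₁ - x₂ ≠ 0 := sub_ne_zero.mpr hne
  rw [sub_eq_add_neg, Point.neg_some] at e
  obtain ⟨_, e₃'⟩ := Point.add_eq_some_of_slope (h₁ := h₁) (h₂ := h₂) hne
    (div_mul_cancel₀ _ hδ) rfl rfl
  obtain ⟨_, e'⟩ := Point.add_eq_some_of_slope (h₁ := h₁) (h₂ := (nonsingular_neg ..).mpr h₂) hne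
    (div_mul_cancel₀ _ hδ) rfl rfl
  rw [e₃', Point.some.injEq] at e₃
  rw [e', Point.some.injEq] at e
  have hA : x₃ * (x₁ - x₂) ^ 2 = (y₁ - y₂) ^ 2 - (x₁ + x₂) * (x₁ - x₂) ^ 2 := by
    rw [← e₃.1]
    simp only [shortWeierstrass]
    field_simp
    ring
  have hB : x * (x₁ - x₂) ^ 2 = (y₁ + y₂) ^ 2 - (x₁ + x₂) * (x₁ - x₂) ^ 2 := by
    rw [← e.1]
    simp only [shortWeierstrass, negY]
    field_simp
    ring
  apply mul_left_cancel₀ (pow_ne_zero 2 hδ)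
  calc (x₁ - x₂) ^ 2 * (x₃ * x * (x₁ - x₂) ^ 2)
      = (x₃ * (x₁ - x₂) ^ 2) * (x * (x₁ - x₂) ^ 2) := by ring
    _ = (y₁ ^ 2 - y₂ ^ 2) ^ 2 - 2 * ((x₁ + x₂) * (x₁ - x₂) ^ 2) * (y₁ ^ 2 + y₂ ^ 2) +
        ((x₁ + x₂) * (x₁ - x₂) ^ 2) ^ 2 := by rw [hA, hB]; ring
    _ = _ := by rw [equation h₁, equation h₂]; ring

/-- Applied to `(k + 1)P` and `kP`, whose difference is `P`, this gives the leading coefficient `((k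
+ 1)² - k²)² = (2k + 1)²`. -/
theorem inv_of_add {x₁ y₁ x₂ y₂ x₃ y₃ x y : K}
    {h₁ : (shortWeierstrass (a : K) b).toAffine.Nonsingular x₁ y₁}
    {h₂ : (shortWeierstrass (a : K) b).toAffine.Nonsingular x₂ y₂}
    {h₃ : (shortWeierstrass (a : K) b).toAffine.Nonsingular x₃ y₃}
    {h : (shortWeierstrass (a : K) b).toAffine.Nonsingular x y}
    (e₃ : Point.some x₁ y₁ h₁ + Point.some x₂ y₂ h₂ = Point.some x₃ y₃ h₃)
    (e : Point.some x₁ y₁ h₁ - Point.some x₂ y₂ h₂ = Point.some x y h)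
    (hne : x₁ ≠ x₂) {z f₁ f₂ : v.integer} {n₁ n₂ : ℤ}
    (hz : v z < 1) (hx0 : x ≠ 0) (hx : x⁻¹ = z)
    (hx₁0 : x₁ ≠ 0) (hx₁ : x₁⁻¹ = n₁ * z + z ^ 3 * f₁)
    (hx₂0 : x₂ ≠ 0) (hx₂ : x₂⁻¹ = n₂ * z + z ^ 3 * f₂) :
    x₃ ≠ 0 ∧ ∃ g : v.integer, x₃⁻¹ = (n₁ - n₂) ^ 2 * z + z ^ 3 * g := by
  have key := abscissa_mul_abscissa e₃ e hne
  have hz0 : (z : K) ≠ 0 := hx ▸ inv_ne_zero hx0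
  obtain ⟨m₁, hm₁⟩ : ∃ m₁ : v.integer, m₁ = n₁ + z ^ 2 * f₁ := ⟨_, rfl⟩
  obtain ⟨m₂, hm₂⟩ : ∃ m₂ : v.integer, m₂ = n₂ + z ^ 2 * f₂ := ⟨_, rfl⟩
  have hm₁' : (m₁ : K) = n₁ + z ^ 2 * f₁ := by rw [hm₁]; push_cast; rfl
  have hm₂' : (m₂ : K) = n₂ + z ^ 2 * f₂ := by rw [hm₂]; push_cast; rfl
  have hx₁' : x₁⁻¹ = z * m₁ := by rw [hx₁, hm₁']; ring
  have hx₂' : x₂⁻¹ = z * m₂ := by rw [hx₂, hm₂']; ring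
  have hζ₁ : (z * m₁ : K) ≠ 0 := hx₁' ▸ inv_ne_zero hx₁0
  have hζ₂ : (z * m₂ : K) ≠ 0 := hx₂' ▸ inv_ne_zero hx₂0
  have hm₁0 := right_ne_zero_of_mul hζ₁
  have hm₂0 := right_ne_zero_of_mul hζ₂
  rw [← inv_inv x₁, ← inv_inv x₂, ← inv_inv x, hx₁', hx₂', hx] at key
  obtain ⟨u, hu⟩ := Valuation.integer.exists_mul_eq_one hz
    (z * (-(2 * a) * m₁ * m₂ + a ^ 2 * z ^ 2 * m₁ ^ 2 * m₂ ^ 2 - 4 * b * z * m₁ * m₂ * (m₁ + m₂)))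
  push_cast [coe_two, coe_four] at hu
  field_simp at key
  have hx₃ : x₃ * (u * z * (m₁ - m₂) ^ 2) = 1 := by
    linear_combination u * key + hu
  have hx₃0 : x₃ ≠ 0 := left_ne_zero_of_mul (hx₃ ▸ one_ne_zero)
  refine ⟨hx₃0, u * (2 * (n₁ - n₂) * (f₁ - f₂) + z ^ 2 * (f₁ - f₂) ^ 2 - (n₁ - n₂) ^ 2 *
    (-(2 * a) * m₁ * m₂ + a ^ 2 * z ^ 2 * m₁ ^ 2 * m₂ ^ 2 - 4 * b * z * m₁ * m₂ * (m₁ + m₂))), ?_⟩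
  rw [inv_eq_of_mul_eq_one_right hx₃]
  have hm : (m₁ - m₂ : K) = n₁ - n₂ + z ^ 2 * (f₁ - f₂) := by rw [hm₁', hm₂']; ring
  rw [hm]
  push_cast [coe_two, coe_four]
  linear_combination (n₁ - n₂ : K) ^ 2 * z * hu

/-- In the kernel of reduction multiplication by `j` multiplies `1 / x` by `j²`, up to higher order
terms. -/
theorem exists_nsmul_eq_some {x y : K} {h : (shortWeierstrass (a : K) b).toAffine.Nonsingular x y}
    {z : v.integer} (hz : v z < 1) (hx0 : x ≠ 0) (hx : x⁻¹ = z) (j : ℕ) (hj0 : 0 < j)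
    (hj : ∀ i, 0 < i → i ≤ j → i • Point.some x y h ≠ 0) :
    ∃ x' y' h', j • Point.some x y h = Point.some x' y' h' ∧ x' ≠ 0 ∧
      ∃ g : v.integer, x'⁻¹ = (j : ℤ) ^ 2 * z + z ^ 3 * g := by
  induction j using Nat.strong_induction_on with
  | _ j ih =>
  rcases hjP : j • Point.some x y h with _ | ⟨x', y', h'⟩
  · exact absurd hjP (hj j hj0 le_rfl)
  refine ⟨x', y', h', rfl, ?_⟩
  obtain ⟨k, rfl | rfl⟩ := Nat.even_or_odd' j
  · obtain ⟨x₁, y₁, h₁, e₁, hx₁, g, hg⟩ := ih k (by omega) (by omega)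
      fun i hi hik ↦ hj i hi (by omega)
    rw [two_mul, add_nsmul, e₁] at hjP
    obtain ⟨hx', g', hg'⟩ := inv_of_add_self hjP (m := (k : ℤ) ^ 2 + z ^ 2 * g) hz hx₁
      (by rw [hg]; push_cast; ring)
    refine ⟨hx', 4 * g + g', ?_⟩
    rw [hg']
    push_cast [coe_four]
    ring
  · rcases Nat.eq_zero_or_pos k with rfl | hk
    · rw [mul_zero, zero_add, one_nsmul, Point.some.injEq] at hjP
      refine ⟨hjP.1 ▸ hx0, 0, ?_⟩
      rw [← hjP.1, hx]
      push_cast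
      ring
    · obtain ⟨x₁, y₁, h₁, e₁, hx₁, g₁, hg₁⟩ := ih (k + 1) (by omega) (by omega)
        fun i hi hik ↦ hj i hi (by omega)
      obtain ⟨x₂, y₂, h₂, e₂, hx₂, g₂, hg₂⟩ := ih k (by omega) hk
        fun i hi hik ↦ hj i hi (by omega)
      have e₃ : Point.some x₁ y₁ h₁ + Point.some x₂ y₂ h₂ = Point.some x' y' h' := by
        rw [← e₁, ← e₂, ← hjP, ← add_nsmul]
        congr 1
        omega
      have e : Point.some x₁ y₁ h₁ - Point.some x₂ y₂ h₂ = Point.some x y h := by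
        rw [← e₁, ← e₂, add_nsmul, one_nsmul, add_sub_cancel_left]
      have hne : x₁ ≠ x₂ := by
        intro he
        rcases Point.X_eq_iff.mp he with he | he
        · rw [he, sub_self] at e
          exact Point.some_ne_zero _ e.symm
        · rw [he, neg_add_cancel] at e₃
          exact Point.some_ne_zero _ e₃.symm
      obtain ⟨hx', g', hg'⟩ := inv_of_add e₃ e hne (f₁ := g₁) (f₂ := g₂) (n₁ := ((k + 1 : ℕ) : ℤ) ^ 2)
        (n₂ := (k : ℤ) ^ 2) hz hx0 hx hx₁ (by rw [hg₁]; push_cast; ring) hx₂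
        (by rw [hg₂]; push_cast; ring)
      refine ⟨hx', g', ?_⟩
      rw [hg']
      push_cast
      ring

/-- `hv` says that the place is unramified. If `ℓ = 2k + 1` killed the point, `kP` and `(k + 1)P`
would share their abscissa. Comparing leading coefficients, `ℓ` would be `z²` times an integral
element, hence smaller than `z`. For `ℓ = 2` the point has `y = 0`, which is impossible for a pole
of `x`. -/
theorem prime_nsmul_ne_zero (hv : ∀ ℓ : ℕ, ℓ.Prime → ∀ t : K, v t < 1 → v t ≤ v ℓ) {x y : K}
    {h : (shortWeierstrass (a : K) b).toAffine.Nonsingular x y} (hx : 1 < v x) {ℓ : ℕ}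
    (hℓ : ℓ.Prime) : ℓ • Point.some x y h ≠ 0 := by
  intro h0
  have hx0 : x ≠ 0 := by
    rintro rfl
    simp at hx
  have hz1 : v x⁻¹ < 1 := by
    rw [map_inv₀]
    exact inv_lt_one_of_one_lt₀ hx
  obtain ⟨z, hz⟩ : ∃ z : v.integer, x⁻¹ = z := ⟨⟨x⁻¹, hz1.le⟩, rfl⟩
  rw [hz] at hz1
  have hz0 : (z : K) ≠ 0 := hz ▸ inv_ne_zero hx0
  have hord : addOrderOf (Point.some x y h) = ℓ := by
    have := Fact.mk hℓ
    exact addOrderOf_eq_prime h0 (Point.some_ne_zero _)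
  have hne : ∀ i, 0 < i → i < ℓ → i • Point.some x y h ≠ 0 :=
    fun i hi hiℓ ↦ nsmul_ne_zero_of_addOrderOf_eq hord hi hiℓ
  have hle := hv ℓ hℓ z hz1
  have hvz0 : 0 < v (z : K) := zero_lt_iff.mpr ((Valuation.ne_zero_iff v).mpr hz0)
  obtain ⟨k, rfl | rfl⟩ := Nat.even_or_odd' ℓ
  · obtain rfl : k = 1 := by
      have := (Nat.prime_dvd_prime_iff_eq Nat.prime_two hℓ).mp ⟨k, rfl⟩
      omega
    rw [mul_one, two_nsmul, Point.add_self_eq_zero_iff] at h0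
    simp only [shortWeierstrass] at h0
    have h2 : (2 : K) ≠ 0 := by
      intro e
      rw [mul_one, Nat.cast_two, e, map_zero] at hle
      exact absurd hle (not_le.mpr hvz0)
    have hy : y = 0 := by
      have : 2 * y = 0 := by linear_combination h0
      exact (mul_eq_zero.mp this).resolve_left h2
    have heq := equation h
    rw [hy] at heq
    obtain ⟨u, hu⟩ := Valuation.integer.exists_mul_eq_one hz1 (a * z + b * z ^ 2)
    have hxz : x * z = 1 := by rw [← hz, mul_inv_cancel₀ hx0]
    obtain rfl : x = (z : K)⁻¹ := eq_inv_of_mul_eq_one_left hxz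
    push_cast at hu
    field_simp at heq
    apply one_ne_zero (α := K)
    linear_combination -hu - u * heq
  · have hk : 0 < k := by
      rcases Nat.eq_zero_or_pos k with rfl | hk
      · exact absurd hℓ (by norm_num)
      · exact hk
    obtain ⟨x₁, y₁, h₁, e₁, hx₁, g₁, hg₁⟩ := exists_nsmul_eq_some hz1 hx0 hz k hk
      fun i hi hik ↦ hne i hi (by omega)
    obtain ⟨x₂, y₂, h₂, e₂, hx₂, g₂, hg₂⟩ := exists_nsmul_eq_some hz1 hx0 hz (k + 1) (by omega)
      fun i hi hik ↦ hne i hi (by omega)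
    have he : k • Point.some x y h = -((k + 1) • Point.some x y h) := by
      rw [eq_neg_iff_add_eq_zero, ← add_nsmul, ← h0]
      congr 1
      omega
    rw [e₁, e₂] at he
    have hx : x₁ = x₂ := Point.X_eq_iff.mpr (Or.inr he)
    rw [← hx, hg₁] at hg₂
    have hℓz : ((2 * k + 1 : ℕ) : K) = z * (z * (g₁ - g₂ : v.integer)) := by
      apply mul_left_cancel₀ hz0
      push_cast at hg₂ ⊢
      linear_combination -hg₂
    have hlt : v ((2 * k + 1 : ℕ) : K) < v z := by
      rw [hℓz, map_mul]
      refine mul_lt_of_lt_one_right hvz0 ?_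
      rw [map_mul]
      exact mul_lt_one_of_nonneg_of_lt_one_left zero_le hz1 (g₁ - g₂).2
    exact absurd hle (not_le.mpr hlt)

/-- The kernel of reduction contains no torsion points. -/
theorem le_one_of_isOfFinAddOrder (hv : ∀ ℓ : ℕ, ℓ.Prime → ∀ t : K, v t < 1 → v t ≤ v ℓ) {x y : K}
    {h : (shortWeierstrass (a : K) b).toAffine.Nonsingular x y}
    (hP : IsOfFinAddOrder (Point.some x y h)) : v x ≤ 1 := by
  by_contra! hx
  have hn : addOrderOf (Point.some x y h) ≠ 1 := by
    rw [Ne, AddMonoid.addOrderOf_eq_one_iff]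
    exact Point.some_ne_zero _
  have hpos := addOrderOf_pos_iff.mpr hP
  -- A suitable multiple has prime order and still lies in the kernel of reduction.
  obtain ⟨m, hm⟩ := Nat.minFac_dvd (addOrderOf (Point.some x y h))
  have hprime := Nat.minFac_prime hn
  generalize (addOrderOf (Point.some x y h)).minFac = ℓ at *
  have hm0 : 0 < m := by
    rcases Nat.eq_zero_or_pos m with rfl | hm0
    · rw [mul_zero] at hm
      omega
    · exact hm0
  have hmn : m < addOrderOf (Point.some x y h) := by
    rw [hm]
    exact lt_mul_of_one_lt_left hm0 hprime.one_lt
  have hx0 : x ≠ 0 := by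
    rintro rfl
    simp at hx
  have hz1 : v x⁻¹ < 1 := by
    rw [map_inv₀]
    exact inv_lt_one_of_one_lt₀ hx
  obtain ⟨z, hz⟩ : ∃ z : v.integer, x⁻¹ = z := ⟨⟨x⁻¹, hz1.le⟩, rfl⟩
  rw [hz] at hz1
  obtain ⟨x', y', h', e, hx', g, hg⟩ := exists_nsmul_eq_some (h := h) hz1 hx0 hz m hm0
    fun i hi him ↦ nsmul_ne_zero_of_addOrderOf_eq rfl hi (by omega)
  refine prime_nsmul_ne_zero hv (h := h') (x := x') ?_ hprime ?_
  · have : v x'⁻¹ < 1 := by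
      have e' : x'⁻¹ = z * ((m : ℤ) ^ 2 + z ^ 2 * g : v.integer) := by
        rw [hg]
        push_cast
        ring
      rw [e', map_mul]
      exact mul_lt_one_of_nonneg_of_lt_one_left zero_le hz1
        ((m : ℤ) ^ 2 + z ^ 2 * g : v.integer).2
    rw [map_inv₀] at this
    exact (inv_lt_one₀ (zero_lt_iff.mpr ((Valuation.ne_zero_iff v).mpr hx'))).mp this
  · rw [← e, smul_smul, ← hm, addOrderOf_nsmul_eq_zero]

/-- Reduction is injective on torsion points. -/
theorem eq_of_sub_lt_one (hv : ∀ ℓ : ℕ, ℓ.Prime → ∀ t : K, v t < 1 → v t ≤ v ℓ) {x y x' y' : K}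
    {h : (shortWeierstrass (a : K) b).toAffine.Nonsingular x y}
    {h' : (shortWeierstrass (a : K) b).toAffine.Nonsingular x' y'}
    (hP : IsOfFinAddOrder (Point.some x y h)) (hP' : IsOfFinAddOrder (Point.some x' y' h'))
    (hx : v (x - x') < 1) (hy : v (y + y') = 1) : Point.some x y h = Point.some x' y' h' := by
  by_cases hxx : x = x'
  · rcases Point.X_eq_iff.mp hxx with e | e
    · exact e
    · exfalso
      rw [Point.neg_some, Point.some.injEq] at e
      have := e.2
      simp only [negY, shortWeierstrass] at this
      have h0 : y + y' = 0 := by linear_combination this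
      rw [h0, map_zero] at hy
      exact zero_ne_one hy
  · exfalso
    have hδ : x - x' ≠ 0 := sub_ne_zero.mpr hxx
    have hvδ : 0 < v (x - x') := zero_lt_iff.mpr ((Valuation.ne_zero_iff v).mpr hδ)
    -- The chord through the first point and the negative of the second has the non-integral slope
    -- `(y + y') / (x - x')`. So their difference has non-integral abscissa, yet it is a torsion
    -- point.
    obtain ⟨h'', e⟩ := Point.add_eq_some_of_slope (h₁ := h) (h₂ := (nonsingular_neg ..).mpr h') hxx
      (div_mul_cancel₀ _ hδ) rfl rfl
    rw [← Point.neg_some h', ← sub_eq_add_neg] at e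
    have hfin := hP.add hP'.neg
    rw [← sub_eq_add_neg, e] at hfin
    have hle := le_one_of_isOfFinAddOrder hv hfin
    have hx1 := le_one_of_isOfFinAddOrder hv hP
    have hx1' := le_one_of_isOfFinAddOrder hv hP'
    have hsq : v (((y + y') / (x - x')) ^ 2) ≤ 1 := by
      simp only [negY, shortWeierstrass] at hle
      have e' : ((y + y') / (x - x')) ^ 2 = (((y - (-y' - 0 * x' - 0)) / (x - x')) ^ 2 +
          0 * ((y - (-y' - 0 * x' - 0)) / (x - x')) - 0 - x - x') + x + x' := by
        ring
      rw [e']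
      exact v.map_add_le (v.map_add_le hle hx1) hx1'
    rw [map_pow, map_div₀, hy] at hsq
    have : 1 < 1 / v (x - x') := by
      rw [one_div]
      exact (one_lt_inv₀ hvδ).mpr hx
    exact absurd hsq (not_le.mpr (one_lt_pow₀ this two_ne_zero))

end shortWeierstrass

/-! ### The explicit curve over `ℚ(√5)`. -/

namespace curve15

/-- The points `(A + B√5, C + D√5)`, one from each pair of nonzero multiples `±P` of the point `P` of
order `15`. -/
def multiples : List (ℤ × ℤ × ℤ × ℤ) :=
  [(-585, 264, -11340, 5076), (3195, -1428, 251640, -112536), (-189, 84, -16416, 7344),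
    (855, -384, 29700, -13284), (135, -60, -9180, 4104), (459, -204, 8208, -3672),
    (315, -132, -5400, 2376)]

variable {K : Type*} [Field K] [CharZero K] {s : K}

theorem add_mul_ne_zero (hs : s ^ 2 = 5) (p q : ℤ) (hpq : p ^ 2 ≠ 5 * q ^ 2) :
    (p : K) + q * s ≠ 0 := by
  intro e
  apply hpq
  have : (p : K) ^ 2 = 5 * q ^ 2 := by linear_combination (p - q * s) * e + q ^ 2 * hs
  exact_mod_cast this

theorem isElliptic (hs : s ^ 2 = 5) : (curve15 s).IsElliptic := by
  have h : (curve15 s).Δ = ((-29068996855991500800 : ℤ) : K) + (13000050601544908800 : ℤ) * s := by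
    simp only [WeierstrassCurve.Δ, b₂, b₄, b₆, b₈, curve15]
    push_cast
    linear_combination (-16 * (4 * (281880 ^ 3 * s - 3 * 281880 ^ 2 * 630315) +
      27 * 146861640 ^ 2)) * hs
  exact ⟨isUnit_iff_ne_zero.mpr (h ▸ add_mul_ne_zero hs _ _ (by norm_num))⟩

theorem nonsingular (hs : s ^ 2 = 5) :
    (curve15 s).toAffine.Nonsingular (264 * s - 585) (5076 * s - 11340) := by
  have := isElliptic hs
  refine equation_iff_nonsingular.mp ?_
  rw [Affine.equation_iff]
  simp only [curve15]
  linear_combination (5076 ^ 2 - (264 ^ 3 * s - 3 * 264 ^ 2 * 585) - 281880 * 264) * hs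

variable [DecidableEq K]

theorem exists_nsmul_eq_some (hs : s ^ 2 = 5)
    (h : (curve15 s).toAffine.Nonsingular (264 * s - 585) (5076 * s - 11340)) :
    addOrderOf (Point.some _ _ h) = 15 ∧ ∀ q ∈ multiples, ∃ (k : ℕ) (h' : _),
      k • Point.some _ _ h = Point.some ((q.1 : K) + q.2.1 * s) (q.2.2.1 + q.2.2.2 * s) h' := by
  have hne := fun p q hpq ↦ add_mul_ne_zero hs p q hpq
  have hy0 : 2 * (5076 * s - 11340) + (curve15 s).a₁ * (264 * s - 585) + (curve15 s).a₃ ≠ 0 := by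
    intro e
    refine hne (-11340) 5076 (by norm_num) ?_
    simp only [curve15] at e
    push_cast
    linear_combination e / 2
  obtain ⟨h2, e2⟩ := Point.add_self_eq_some_of_slope (h := h) (ℓ := -30 + 15 * s) (x₃ := 3195 - 1428 * s)
    (y₃ := 251640 - 112536 * s) hy0
    (by simp only [curve15]; linear_combination (-56808 : K) * hs)
    (by simp only [curve15]; linear_combination (-225 : K) * hs)
    (by simp only [curve15]; linear_combination (-25380 : K) * hs)
  rw [← two_nsmul] at e2
  obtain ⟨h3, e3⟩ := Point.add_eq_some_of_slope (h₁ := h2) (h₂ := h) (ℓ := 36 - 15 * s)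
    (x₃ := -189 + 84 * s) (y₃ := -16416 + 7344 * s)
    (fun e ↦ hne 3780 (-1692) (by norm_num) (by push_cast; linear_combination e))
    (by linear_combination (25380 : K) * hs)
    (by simp only [curve15]; linear_combination (-225 : K) * hs)
    (by simp only [curve15]; linear_combination (-22680 : K) * hs)
  rw [← e2, ← succ_nsmul] at e3
  obtain ⟨h4, e4⟩ := Point.add_eq_some_of_slope (h₁ := h3) (h₂ := h) (ℓ := -6 + 3 * s)
    (x₃ := 855 - 384 * s) (y₃ := 29700 - 13284 * s)
    (fun e ↦ hne 396 (-180) (by norm_num) (by push_cast; linear_combination e))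
    (by linear_combination (-540 : K) * hs)
    (by simp only [curve15]; linear_combination (-9 : K) * hs)
    (by simp only [curve15]; linear_combination (-1404 : K) * hs)
  rw [← e3, ← succ_nsmul] at e4
  obtain ⟨h5, e5⟩ := Point.add_eq_some_of_slope (h₁ := h4) (h₂ := h) (ℓ := 15 - 6 * s)
    (x₃ := 135 - 60 * s) (y₃ := -9180 + 4104 * s)
    (fun e ↦ hne 1440 (-648) (by norm_num) (by push_cast; linear_combination e))
    (by linear_combination (3888 : K) * hs)
    (by simp only [curve15]; linear_combination (-36 : K) * hs)
    (by simp only [curve15]; linear_combination (-1944 : K) * hs)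
  rw [← e4, ← succ_nsmul] at e5
  obtain ⟨h6, e6⟩ := Point.add_eq_some_of_slope (h₁ := h5) (h₂ := h) (ℓ := 3)
    (x₃ := 459 - 204 * s) (y₃ := 8208 - 3672 * s)
    (fun e ↦ hne 720 (-324) (by norm_num) (by push_cast; linear_combination e))
    (by linear_combination (0 : K) * hs)
    (by simp only [curve15]; linear_combination (0 : K) * hs)
    (by simp only [curve15]; linear_combination (0 : K) * hs)
  rw [← e5, ← succ_nsmul] at e6
  obtain ⟨h7, e7⟩ := Point.add_eq_some_of_slope (h₁ := h6) (h₂ := h) (ℓ := 12 - 3 * s)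
    (x₃ := 315 - 132 * s) (y₃ := -5400 + 2376 * s)
    (fun e ↦ hne 1044 (-468) (by norm_num) (by push_cast; linear_combination e))
    (by linear_combination (1404 : K) * hs)
    (by simp only [curve15]; linear_combination (-9 : K) * hs)
    (by simp only [curve15]; linear_combination (-216 : K) * hs)
  rw [← e6, ← succ_nsmul] at e7
  obtain ⟨h8, e8⟩ := Point.add_eq_some_of_slope (h₁ := h7) (h₂ := h) (ℓ := -(3 * s))
    (x₃ := 315 - 132 * s) (y₃ := 5400 - 2376 * s)
    (fun e ↦ hne 900 (-396) (by norm_num) (by push_cast; linear_combination e))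
    (by linear_combination (1188 : K) * hs)
    (by simp only [curve15]; linear_combination (-9 : K) * hs)
    (by simp only [curve15]; linear_combination (0 : K) * hs)
  rw [← e7, ← succ_nsmul] at e8
  refine ⟨?_, ?_⟩
  -- `7P` and `8P` have the same abscissa and opposite ordinates.
  · have h15 : (15 : ℕ) • Point.some _ _ h = 0 := by
      rw [show (15 : ℕ) = (2 + 1 + 1 + 1 + 1 + 1 + 1) + (2 + 1 + 1 + 1 + 1 + 1) from rfl,
        add_nsmul, e8, e7]
      refine Point.add_of_Y_eq rfl ?_
      simp only [negY, curve15]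
      ring
    refine addOrderOf_eq_of_nsmul_and_div_prime_nsmul (by norm_num) h15 fun p hp hdvd ↦ ?_
    rcases (hp.dvd_mul (m := 3) (n := 5)).mp hdvd with hd | hd
    · obtain rfl := (Nat.prime_dvd_prime_iff_eq hp Nat.prime_three).mp hd
      intro h0
      exact Point.some_ne_zero _ (e5.symm.trans h0)
    · obtain rfl := (Nat.prime_dvd_prime_iff_eq hp Nat.prime_five).mp hd
      intro h0
      exact Point.some_ne_zero _ (e3.symm.trans h0)
  · intro q hq
    simp only [multiples, List.mem_cons, List.not_mem_nil, or_false] at hq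
    have hcast : ∀ (k : ℕ) (x y x' y' : K) (h' : (curve15 s).toAffine.Nonsingular x y),
        k • Point.some _ _ h = Point.some x y h' → x = x' → y = y' →
        ∃ (k : ℕ) (h' : _), k • Point.some _ _ h = Point.some x' y' h' := by
      rintro k x y _ _ h' e rfl rfl
      exact ⟨k, h', e⟩
    rcases hq with rfl | rfl | rfl | rfl | rfl | rfl | rfl
    · exact hcast 1 _ _ _ _ h (one_nsmul _) (by push_cast; ring) (by push_cast; ring)
    · exact hcast _ _ _ _ _ h2 e2 (by push_cast; ring) (by push_cast; ring)
    · exact hcast _ _ _ _ _ h3 e3 (by push_cast; ring) (by push_cast; ring)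
    · exact hcast _ _ _ _ _ h4 e4 (by push_cast; ring) (by push_cast; ring)
    · exact hcast _ _ _ _ _ h5 e5 (by push_cast; ring) (by push_cast; ring)
    · exact hcast _ _ _ _ _ h6 e6 (by push_cast; ring) (by push_cast; ring)
    · exact hcast _ _ _ _ _ h7 e7 (by push_cast; ring) (by push_cast; ring)

end curve15

theorem Padic.norm_le_norm_natCast_of_lt_one {p : ℕ} [hp : Fact p.Prime] {t : ℚ_[p]} (ht : ‖t‖ < 1)
    {ℓ : ℕ} (hℓ : ℓ.Prime) : ‖t‖ ≤ ‖(ℓ : ℚ_[p])‖ := by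
  by_cases h : ℓ = p
  · subst h
    rw [Padic.norm_p, ← zpow_neg_one, Padic.norm_le_pow_iff_norm_lt_pow_add_one]
    simpa using ht
  · rw [Padic.norm_natCast_eq_one_iff.mpr
      ((Nat.coprime_primes hp.out hℓ).mpr (Ne.symm h))]
    exact ht.le

namespace curve15

/-- Reduction modulo the prime `(11, √5 - 4)` of `ℚ(√5)`. -/
theorem exists_reduction {K : Type*} [Field K] [NumberField K] (hK : IsQuadraticField K) {s : K}
    (hs : s ^ 2 = 5) : ∃ (v : Valuation K NNReal) (ρ : v.integer →+* ZMod 11),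
      (∀ t, ρ t = 0 ↔ v t < 1) ∧ (∃ σ : v.integer, (σ : K) = s ∧ ρ σ = 4) ∧
        ∀ ℓ : ℕ, ℓ.Prime → ∀ t : K, v t < 1 → v t ≤ v ℓ := by
  have hp : Fact (Nat.Prime 11) := ⟨by norm_num⟩
  -- Hensel's lemma applies because `4² = 16` is 5 modulo 11 and the derivative `2 · 4` is a unit.
  obtain ⟨β, hβ, hβ4⟩ : ∃ β : ℤ_[11], β ^ 2 = 5 ∧ ‖β - 4‖ < 1 := by
    have h8 : ‖(8 : ℤ_[11])‖ = 1 := by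
      have := PadicInt.norm_natCast_eq_one_iff (p := 11) (n := 8)
      exact_mod_cast this.mpr (by norm_num)
    have h11 : ‖(11 : ℤ_[11])‖ < 1 := by
      have := PadicInt.norm_lt_one_iff_dvd (p := 11) 11
      exact this.mpr (by norm_num)
    obtain ⟨β, hβ, hβ', -⟩ := hensels_lemma (p := 11) (F := (.X ^ 2 - 5 : Polynomial ℤ_[11]))
      (a := 4) (by
        norm_num [Polynomial.derivative_X_pow, h8, h11])
    refine ⟨β, ?_, ?_⟩
    · simpa [sub_eq_zero] using hβ
    · refine hβ'.trans_le (PadicInt.norm_le_one _)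
  obtain ⟨φ, hφ⟩ := hK.exists_algHom (d := 5) IsQuadraticField.not_isSquare_five (α := s)
    (by exact_mod_cast hs) (β := (β : ℚ_[11])) (by exact_mod_cast congrArg _ hβ)
  let v : Valuation K NNReal := (NormedField.valuation (K := ℚ_[11])).comap (φ : K →+* ℚ_[11])
  have hv : ∀ t, v t = ‖φ t‖₊ := fun _ ↦ rfl
  let ψ : v.integer →+* ℤ_[11] := RingHom.codRestrict ((φ : K →+* ℚ_[11]).comp v.integer.subtype)
    (PadicInt.subring 11) fun t ↦ t.2
  have hψ : ∀ t, (ψ t : ℚ_[11]) = φ t := fun _ ↦ rfl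
  have hρ : ∀ z : ℤ_[11], PadicInt.toZMod z = 0 ↔ ‖z‖ < 1 := by
    intro z
    rw [← RingHom.mem_ker, PadicInt.ker_toZMod, IsLocalRing.mem_maximalIdeal, PadicInt.mem_nonunits]
  refine ⟨v, PadicInt.toZMod.comp ψ, ?_, ⟨⟨s, ?_⟩, rfl, ?_⟩, ?_⟩
  · intro t
    rw [RingHom.comp_apply, hρ, PadicInt.norm_def, hψ, hv]
    exact Iff.rfl
  · change ‖φ s‖ ≤ 1
    rw [hφ]
    exact β.2
  · have : ψ ⟨s, by change ‖φ s‖ ≤ 1; rw [hφ]; exact β.2⟩ = β := Subtype.ext hφ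
    rw [RingHom.comp_apply, this]
    have h := (hρ _).mpr hβ4
    rwa [map_sub, map_ofNat, sub_eq_zero] at h
  · intro ℓ hℓ t ht
    rw [hv, hv, map_natCast]
    exact Padic.norm_le_norm_natCast_of_lt_one ht hℓ

/-- This is the reduced curve, with `√5 ↦ 4`. Every affine point over `F_11` is the reduction of
some `±kP` with `1 ≤ k ≤ 7`, and `y ≠ 0` lets the ordinate decide the sign. -/
theorem exists_mem_multiples_of_equation : ∀ x y : ZMod 11, y ^ 2 = x ^ 3 + 5 * x + 8 →
    ∃ q ∈ multiples, x = (q.1 : ZMod 11) + q.2.1 * 4 ∧ y ≠ 0 ∧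
      (y = (q.2.2.1 : ZMod 11) + q.2.2.2 * 4 ∨ y = -((q.2.2.1 : ZMod 11) + q.2.2.2 * 4)) := by
  decide

variable {K : Type*} [Field K] [NumberField K] [DecidableEq K] {s : K}

theorem mem_zmultiples_of_isOfFinAddOrder (hK : IsQuadraticField K) (hs : s ^ 2 = 5)
    (h : (curve15 s).toAffine.Nonsingular (264 * s - 585) (5076 * s - 11340))
    (Q : (curve15 s).toAffine.Point) (hQ : IsOfFinAddOrder Q) :
    Q ∈ AddSubgroup.zmultiples (Point.some _ _ h) := by
  obtain ⟨h15, hmul⟩ := exists_nsmul_eq_some hs h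
  have hP : IsOfFinAddOrder (Point.some _ _ h) := addOrderOf_pos_iff.mp (by omega)
  obtain ⟨v, ρ, hρ, ⟨σ, rfl, hσ⟩, hv⟩ := exists_reduction hK hs
  obtain ⟨a, ha⟩ : ∃ a : v.integer, a = 281880 * σ - 630315 := ⟨_, rfl⟩
  obtain ⟨b, hb⟩ : ∃ b : v.integer, b = 328392630 - 146861640 * σ := ⟨_, rfl⟩
  have hE : curve15 (σ : K) = shortWeierstrass (a : K) b := by
    rw [ha, hb]; rfl
  have hle : ∀ (x y : K) (h : (curve15 (σ : K)).toAffine.Nonsingular x y),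
      IsOfFinAddOrder (Point.some x y h) → v x ≤ 1 := by
    rw [hE]
    exact fun _ _ _ ↦ shortWeierstrass.le_one_of_isOfFinAddOrder hv
  have heq : ∀ (x y x' y' : K) (h : (curve15 (σ : K)).toAffine.Nonsingular x y)
      (h' : (curve15 (σ : K)).toAffine.Nonsingular x' y'), IsOfFinAddOrder (Point.some x y h) →
      IsOfFinAddOrder (Point.some x' y' h') → v (x - x') < 1 → v (y + y') = 1 →
      Point.some x y h = Point.some x' y' h' := by
    rw [hE]
    exact fun _ _ _ _ _ _ ↦ shortWeierstrass.eq_of_sub_lt_one hv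
  rcases Q with _ | ⟨x, y, hxy⟩
  · exact zero_mem _
  have hx := hle x y hxy hQ
  have hcurve : y ^ 2 = x ^ 3 + a * x + b := by
    rw [hE] at hxy
    exact shortWeierstrass.equation hxy
  lift x to v.integer using hx
  have hy : v y ≤ 1 := by
    rw [← pow_le_one_iff_of_nonneg zero_le two_ne_zero, ← map_pow, hcurve]
    exact (x ^ 3 + a * x + b).2
  lift y to v.integer using hy
  have hcurve' : y ^ 2 = x ^ 3 + a * x + b := Subtype.ext hcurve
  have hred : ρ y ^ 2 = ρ x ^ 3 + 5 * ρ x + 8 := by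
    have := congrArg ρ hcurve'
    simp only [ha, hb, map_add, map_sub, map_mul, map_pow, map_ofNat, hσ] at this
    rw [this]
    congr 1
  obtain ⟨q, hq, hxq, hy0, hyq⟩ := exists_mem_multiples_of_equation _ _ hred
  obtain ⟨k, h', e⟩ := hmul q hq
  have hR : IsOfFinAddOrder (Point.some _ _ h') := e ▸ hP.nsmul
  have hmem : Point.some _ _ h' ∈ AddSubgroup.zmultiples (Point.some _ _ h) :=
    e ▸ AddSubgroup.nsmul_mem_zmultiples _ k
  have hsub : v (x - (q.1 + q.2.1 * σ) : K) < 1 := by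
    refine (hρ (x - (q.1 + q.2.1 * σ))).mp ?_
    simp [hσ, hxq]
  have hunit : ∀ t : v.integer, ρ t ≠ 0 → v t = 1 := fun t ht ↦
    le_antisymm t.2 (not_lt.mp fun hlt ↦ ht ((hρ t).mpr hlt))
  have h2 : ρ y + ρ y ≠ 0 := by
    rw [← two_mul]
    have : Fact (Nat.Prime 11) := ⟨by norm_num⟩
    exact mul_ne_zero (by decide) hy0
  rcases hyq with hyq | hyq
  · rw [heq _ _ _ _ hxy h' hQ hR hsub (hunit (y + (q.2.2.1 + q.2.2.2 * σ)) ?_)]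
    · exact hmem
    · simpa [hσ, ← hyq] using h2
  · rw [← neg_mem_iff, Point.neg_some, heq _ _ _ _ _ h' (by simpa using hQ.neg) hR hsub ?_]
    · exact hmem
    · have := hunit (-y + (q.2.2.1 + q.2.2.2 * σ)) ?_
      · convert this using 2
        simp [curve15]
      · simp only [map_add, map_neg, map_mul, map_intCast, hσ]
        rw [← neg_ne_zero]
        convert h2 using 1
        linear_combination -hyq

theorem torsionIso {K : Type*} [Field K] [NumberField K] (hK : IsQuadraticField K) {s : K}
    (hs : s ^ 2 = 5) : (curve15 s).TorsionIso (ZMod 15) := by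
  classical
  have h := AddCommGroup.nonempty_torsion_equiv_zmod (n := 15) (by norm_num)
    (exists_nsmul_eq_some hs (nonsingular hs)).1
    (mem_zmultiples_of_isOfFinAddOrder hK hs (nonsingular hs))
  unfold WeierstrassCurve.TorsionIso
  convert h

theorem isPointOfOrder {K : Type*} [Field K] [CharZero K] {s : K} (hs : s ^ 2 = 5) :
    (curve15 s).IsPointOfOrder (264 * s - 585) (5076 * s - 11340) 15 := by
  classical
  refine ⟨nonsingular hs, ?_⟩
  convert (exists_nsmul_eq_some hs (nonsingular hs)).1

end curve15

theorem theorem5 :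
    -- `ℚ(√5)` is the quadratic field of smallest `|Δ|` over which `ℤ/15ℤ` appears
    (IsQuadraticField (QSqrt 5) ∧ TorsionAppears (QSqrt 5) 15 ∧
      ∀ (K : Type*) [Field K] [NumberField K], IsQuadraticField K → TorsionAppears K 15 →
        ¬ IsQSqrt K 5 → |NumberField.discr (QSqrt 5)| < |NumberField.discr K|) ∧
    -- the rational torsion of `X₁(15)` is `ℤ/4ℤ` and consists of cusps
    ((X1_15.baseChange ℚ).TorsionIso (ZMod 4) ∧
      ∀ P : (X1_15.baseChange ℚ).toAffine.Point,
        WeierstrassCurve.IsTorsionPoint P → ¬ X1_15.IsNoncuspidal P) ∧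
    -- torsion of `X₁(15)` over quadratic fields
    (∀ (K : Type*) [Field K] [NumberField K], IsQuadraticField K →
      -- the fields over which the torsion grows
      (X1_15.GainsTorsion K ↔ IsQSqrt K (-3) ∨ IsQSqrt K 5 ∨ IsQSqrt K (-15)) ∧
      -- the fields over which there are noncuspidal torsion points
      ((∃ P : (X1_15.baseChange K).toAffine.Point,
          WeierstrassCurve.IsTorsionPoint P ∧ X1_15.IsNoncuspidal P) ↔
        IsQSqrt K 5 ∨ IsQSqrt K (-15)) ∧
      -- over these two fields all the new torsion points are noncuspidal
      (IsQSqrt K 5 ∨ IsQSqrt K (-15) → ∀ P : (X1_15.baseChange K).toAffine.Point,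
        WeierstrassCurve.IsTorsionPoint P → ¬ WeierstrassCurve.IsRationalPoint P →
          X1_15.IsNoncuspidal P)) ∧
    -- the explicit curve over `ℚ(√5)`
    (∀ s : QSqrt 5, s ^ 2 = 5 →
      (curve15 s).IsElliptic ∧ (curve15 s).TorsionIso (ZMod 15) ∧
        (curve15 s).IsPointOfOrder (264 * s - 585) (5076 * s - 11340) 15) := by
  have h5 := IsQuadraticField.not_isSquare_five
  have hK5 := QSqrt.isQuadraticField h5
  refine ⟨⟨hK5, ?_, ?_⟩, ⟨X1_15.torsionIso_rat, X1_15.not_isNoncuspidal_rat⟩, ?_, ?_⟩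
  · obtain ⟨s, hs⟩ := QSqrt.exists_sq_eq 5
    have hs' : s ^ 2 = 5 := by exact_mod_cast hs
    exact ⟨curve15 s, curve15.isElliptic hs', curve15.torsionIso hK5 hs'⟩
  · intro K _ _ hK hT hne
    -- A counterexample would have `|Δ| ≤ 5`, hence be `ℚ(√5)`, `ℚ(i)` or `ℚ(√-3)`.
    by_contra! h
    obtain ⟨d, rfl | hd, α, hα⟩ :=
      hK.exists_sq_eq_of_abs_discr_le (h.trans IsQuadraticField.abs_discr_QSqrt_five)
    · exact hne ((isQSqrt_iff hK h5).mpr ⟨α, hα⟩)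
    · exact not_torsionAppears_fifteen hK hd hα hT
  · intro K _ _ hK
    exact ⟨X1_15.gainsTorsion_iff hK, X1_15.exists_isNoncuspidal_iff hK,
      X1_15.isNoncuspidal_of_not_isRationalPoint hK⟩
  · intro s hs
    exact ⟨curve15.isElliptic hs, curve15.torsionIso hK5 hs, curve15.isPointOfOrder hs⟩
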